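/- **Setting (NPIR).** There are $N\ge 1$ databases, each storing the same $M$ messages $W_1,\dots,W_M$, which are independent and uniform in $\mathbb F_2^L$. Database $n$ is connected to the user by a discrete memoryless channel with finite alphabets $\mathcal X_n$ (nonempty), $\mathcal Y_n$ and transition probabilities $p_n(y|x)$; its capacity is $C_n=\max_{p(x_n)} I(X_n;Y_n)$ (in bits), and the databases are numbered so that $C_1\ge C_2\ge\dots\ge C_N$ (the channels are otherwise arbitrary; $C_n=0$ is allowed). A retrieval scheme for message length $L$ consists of answer lengths $t_1,\dots,t_N$; for each desired message $i$, random (discrete) queries $(Q_1^{[i]},\dots,Q_N^{[i]})$ independent of $W_{1:M}$; answer strings $A_n^{[i]}\in\mathcal X_n^{t_n}$ that are deterministic functions of $W_{1:M}$ and $Q_n^{[i]}$; and a decoder for each $i$. The letters of all answer strings are transmitted independently, those of database $n$ over the $n$th channel, giving $\tilde A_n^{[i]}\in\mathcal Y_n^{t_n}$, and the user estimates $W_i$ from $(Q_{1:N}^{[i]},\tilde A_{1:N}^{[i]})$. The scheme is private if for each $n$ the law of $(Q_n^{[i]},A_n^{[i]},W_{1:M})$ does not depend on $i$. A rate $R$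 is achievable with traffic ratio vector $\tau$ (where $\tau_n\ge 0$, $\sum_n\tau_n=1$) if there is a sequence of private schemes, indexed by $L$, such that for every $i$ the probability of decoding $W_i$ wrongly tends to $0$, $t_n/\sum_j t_j\to\tau_n$ for each $n$, and $L/\sum_n t_n\to R$ as $L\to\infty$. The capacity $C_{\mathrm{PIR}}(\mathbf C)$ is the supremum of all rates achievable with some $\tau$ (and $0$ if there are none). **Corollary 1 (exact capacity for $M=2$ and $M=3$).** For every $N\ge1$ and all such channels, with the conventions $c/0=\infty$ for $c>0$, $c/\infty=0$, and empty sums equal to $0$: for $M=2$, $$C_{\mathrm{PIR}}(\mathbf C)=\max_{n_0,n_1\in\{1,\dots,N\}}\frac{n_0n_1}{\sum_{n=1}^{n_0}\frac{n_0+1}{C_n}+\sum_{n=n_0+1}^{n_1}\frac{n_0}{C_n}};$$ for $M=3$, $$C_{\mathrm{PIR}}(\mathbf C)=\max_{n_0,n_1,n_2\in\{1,\dots,N\}}\frac{n_0n_1n_2}{\sum_{n=1}^{n_0}\frac{n_0n_1+n_0+1}{C_n}+\sum_{n=n_0+1}^{n_1}\frac{n_0n_1+n_0}{C_n}+\sum_{n=n_1+1}^{n_2}\frac{n_0n_1}{C_n}}.$$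 -/

import Mathlib

open Filter Topology
open scoped ENNReal

namespace NPIR

noncomputable section

/-! ### Discrete memoryless channels -/

/-- The mutual information `I(X;Y)`, in bits, between the input `X ∼ p` of the channel with
transition probabilities `W x y = p(y|x)` and its output `Y`. -/
def mutualInfo {α β : Type*} [Fintype α] [Fintype β] (p : PMF α) (W : α → PMF β) : ℝ :=
  ∑ x, ∑ y, (p x).toReal * (W x y).toReal *
    Real.logb 2 ((W x y).toReal / ((p.bind W) y).toReal)

/-- The capacity of the channel `W`, in bits per channel use: the maximum of the mutual information
over all input distributions. -/
def channelCapacity {α β : Type*} [Fintype α] [Fintype β] (W : α → PMF β) : ℝ≥0∞ :=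
  ⨆ p : PMF α, ENNReal.ofReal (mutualInfo p W)

/-- The law of the noisy answer strings when the noiseless answer strings are `x`: all letters of all
databases are transmitted independently, those of database `n` through the channel `W n`. -/
def noisyLaw {N : ℕ} {X Y : Fin N → Type*} [∀ n, Fintype (Y n)] (W : ∀ n, X n → PMF (Y n))
    (t : Fin N → ℕ) (x : ∀ n, Fin (t n) → X n) : PMF (∀ n, Fin (t n) → Y n) :=
  PMF.ofFintype (fun y => ∏ n, ∏ η, W n (x n η) (y n η)) (by
    classical
    have h1 : ∀ (n : Fin N) (a : X n), ∑ b, W n a b = 1 := fun n a => by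
      rw [← tsum_fintype (L := .unconditional _)]; exact (W n a).tsum_coe
    have h2 : ∀ n, ∑ z : Fin (t n) → Y n, ∏ η, W n (x n η) (z η) = 1 := fun n => by
      rw [← Fintype.prod_sum (fun η b => W n (x n η) b)]
      exact Finset.prod_eq_one fun η _ => h1 n (x n η)
    rw [← Fintype.prod_sum (fun n (z : Fin (t n) → Y n) => ∏ η, W n (x n η) (z η))]
    exact Finset.prod_eq_one fun n _ => h2 n)

/-! ### Retrieval schemes -/

/-- A tuple `W_{1:M}` of `M` messages, each a vector in `𝔽₂^L`. -/
abbrev Messages (M L : ℕ) : Type := Fin M → Fin L → ZMod 2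

/-- A retrieval scheme for `M` messages of length `L` and `N` databases, where database `n` sends
letters of the alphabet `X n` and the user receives letters of `Y n`.  Privacy and reliability are
stated separately below. -/
structure Scheme {N : ℕ} (X Y : Fin N → Type*) (M L : ℕ) where
  /-- the set of queries to the `n`th database -/
  Query : Fin N → Type
  /-- the joint law of the queries `Q_{1:N}^{[i]}`, for each desired message `i` -/
  queryLaw : Fin M → PMF (∀ n, Query n)
  /-- the lengths `t_n` of the answer strings -/
  len : Fin N → ℕ
  /-- the answer string of the `n`th database, a function of all messages and its own query -/
  answer : ∀ n, Messages M L → Query n → Fin (len n) → X n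
  /-- the user's estimate of the desired message `i` from all queries and noisy answer strings -/
  decode : Fin M → (∀ n, Query n) → (∀ n, Fin (len n) → Y n) → Fin L → ZMod 2

namespace Scheme

variable {N : ℕ} {X Y : Fin N → Type*} {M L : ℕ}

/-- The joint law of `(W_{1:M}, Q_{1:N}^{[i]})`: the messages are independent and uniform, and the
queries are independent of them. -/
def inputLaw (S : Scheme X Y M L) (i : Fin M) : PMF (Messages M L × (∀ n, S.Query n)) :=
  (PMF.uniformOfFintype (Messages M L)).bind fun w => (S.queryLaw i).map fun q => (w, q)

/-- The joint law of `(W_{1:M}, Q_{1:N}^{[i]}, Ã_{1:N}^{[i]})`. -/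
def jointLaw [∀ n, Fintype (Y n)] (S : Scheme X Y M L) (W : ∀ n, X n → PMF (Y n)) (i : Fin M) :
    PMF (Messages M L × (∀ n, S.Query n) × (∀ n, Fin (S.len n) → Y n)) :=
  (S.inputLaw i).bind fun wq =>
    (noisyLaw W S.len fun n => S.answer n wq.1 (wq.2 n)).map fun y => (wq.1, wq.2, y)

/-- Privacy: for every database `n`, the law of `(Q_n^{[i]}, A_n^{[i]}, W_{1:M})` does not depend on
the desired message `i`. -/
def IsPrivate (S : Scheme X Y M L) : Prop :=
  ∀ (n : Fin N) (i j : Fin M),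
    (S.inputLaw i).map (fun wq => (wq.2 n, S.answer n wq.1 (wq.2 n), wq.1)) =
      (S.inputLaw j).map (fun wq => (wq.2 n, S.answer n wq.1 (wq.2 n), wq.1))

/-- The probability that the user, who wants message `i`, does not decode it correctly. -/
def errorProb [∀ n, Fintype (Y n)] (S : Scheme X Y M L) (W : ∀ n, X n → PMF (Y n)) (i : Fin M) :
    ℝ≥0∞ :=
  (S.jointLaw W i).toOuterMeasure {ω | S.decode i ω.2.1 ω.2.2 ≠ ω.1 i}

end Scheme

/-! ### Achievable rates and capacity -/

/-- The rate `R` is achievable with traffic ratio vector `τ`: there is a sequence of private schemes,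
indexed by the message length `L`, whose error probabilities tend to `0`, whose traffic ratios
`t_n / ∑ t_j` tend to `τ_n`, and whose rates `L / ∑ t_n` tend to `R`. -/
def Achievable {N : ℕ} {X Y : Fin N → Type*} [∀ n, Fintype (Y n)] (W : ∀ n, X n → PMF (Y n))
    (M : ℕ) (τ : Fin N → ℝ) (R : ℝ≥0∞) : Prop :=
  ∃ S : ∀ L : ℕ, Scheme X Y M L,
    (∀ L, (S L).IsPrivate) ∧
    (∀ i : Fin M, Tendsto (fun L => (S L).errorProb W i) atTop (𝓝 0)) ∧
    (∀ n, Tendsto (fun L => ((S L).len n : ℝ) / ∑ j, ((S L).len j : ℝ)) atTop (𝓝 (τ n))) ∧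
    Tendsto (fun L : ℕ => (L : ℝ≥0∞) / ∑ n, ((S L).len n : ℝ≥0∞)) atTop (𝓝 R)

/-- The capacity of noisy private information retrieval of `M` messages over the channels `W`: the
supremum of the achievable rates, over all traffic ratio vectors and all schemes (`0` if no rate is
achievable). -/
def capacity {N : ℕ} {X Y : Fin N → Type*} [∀ n, Fintype (Y n)] (W : ∀ n, X n → PMF (Y n))
    (M : ℕ) : ℝ≥0∞ :=
  sSup {R : ℝ≥0∞ | ∃ τ ∈ stdSimplex ℝ (Fin N), Achievable W M τ R}

/-- `∑_{n=a+1}^{b} c / C_n` for databases numbered from `1` to `N`; the database numbered `n` is the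
element `n - 1` of `Fin N`.  Here `c / 0 = ∞` for `c ≠ 0`. -/
def sumInv {N : ℕ} (C : Fin N → ℝ≥0∞) (a b : ℕ) (c : ℝ≥0∞) : ℝ≥0∞ :=
  ∑ n : Fin N with a < n.val + 1 ∧ n.val + 1 ≤ b, c / C n

end

end NPIR

/-!
The capacity is computed as the value `1 / v` of a linear program over the traffic, which is bounded
below by explicit schemes and above by information inequalities. Number the databases from `0`, and
write `c n` for the reciprocal capacity of database `n`, so that `c` is increasing, and `S k` for the
sum of the first `k` reciprocal capacities.

*Value.* For two messages `v = min_k (S k + c 0) / k`. For three messages the same minimum is the inner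
level `g`, and `v = min_k (S k + g) / k`. Since `S k / k` is at least `c 0`, the choice `n₀ = 1` is
always optimal in the closed formulas, and every value of the formulas is at most `1 / v`
(`formula_two_le`, `formula_three_le`). The minimisers can be taken in increasing order
(`exists_levels`), and then the formula attains `1 / v` at them. Databases of capacity zero lie beyond
the first `P` ones and drop out on both sides.

*Converse.* Given the queries, the received letters are independent given the messages, so Shannon
inequalities on a finite space apply. Decoding message `m` costs `L` bits of the information of all
letters about the messages from `m` on (`condInfo_firstMessages`, by Fano's inequality). This
information is at most the sum of what the first `k` databases reveal separately, plus the capacities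
of the other ones (`Scheme.condInfo_univ_le`); by privacy, each of the former terms is bounded by the
information left when the preceding message is wanted (`Scheme.avgInfo_step`). Iterating over the
messages and passing to the limit gives the linear constraints `converse_two`, `converse_three` on the
rate and the traffic. Their dual solution comes from water filling: `v` is the level at which
`∑ (v - c n)⁺` equals `c 0`, respectively `g` (`sum_max_eq`, `lp_two`, `lp_three`).

*Achievability.* The optimal traffic is attained by schemes that send sums of randomly permuted symbols
of the messages (`twoMessages`, `threeMessages`). A database sees, for every message, uniformly random
distinct symbols in the same pattern whatever the desired message is, while the sums are arranged such
that the interference in one answer is known from another one. The sums are protected by channel codes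
with small maximal error probability, at rates close to the capacities; these come from Feinstein's
greedy construction and a Chernoff bound (`channel_coding`).
-/

namespace NPIR

noncomputable section

set_option linter.unusedSectionVars false

/-! ### Entropy of functions on a finite probability space -/

section Entropy

variable {Ω α β γ : Type*} [Fintype Ω]

open Classical in
/-- The probability that `f = a`, when the points of the finite space `Ω` have weights `P`. -/
def prob (P : Ω → ℝ) (f : Ω → α) (a : α) : ℝ := ∑ ω with f ω = a, P ω

/-- The Shannon entropy, in nats, of the random variable `f` on the finite space `Ω` with weights
`P`, written as the expectation of `-log p(f)`. -/
def entropy (P : Ω → ℝ) (f : Ω → α) : ℝ := -∑ ω, P ω * Real.log (prob P f (f ω))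

variable {P : Ω → ℝ}

lemma prob_nonneg (hP : P ∈ stdSimplex ℝ Ω) (f : Ω → α) (a : α) : 0 ≤ prob P f a :=
  Finset.sum_nonneg fun _ _ => hP.1 _

lemma prob_pos (hP : P ∈ stdSimplex ℝ Ω) (f : Ω → α) {ω : Ω} (h : 0 < P ω) :
    0 < prob P f (f ω) := by
  classical
  exact Finset.sum_pos' (fun _ _ => hP.1 _) ⟨ω, by simp, h⟩

lemma sum_mul_comp [Fintype α] (f : Ω → α) (F : α → ℝ) :
    ∑ ω, P ω * F (f ω) = ∑ a, prob P f a * F a := by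
  classical
  rw [← Finset.sum_fiberwise (s := Finset.univ) (g := f)]
  refine Finset.sum_congr rfl fun a _ => ?_
  rw [prob, Finset.sum_mul]
  refine Finset.sum_congr (by ext; simp) fun ω h => ?_
  rw [(Finset.mem_filter.1 h).2]

lemma sum_prob [Fintype α] (hP : P ∈ stdSimplex ℝ Ω) (f : Ω → α) : ∑ a, prob P f a = 1 := by
  have := sum_mul_comp (P := P) f (fun _ => 1)
  simpa [hP.2] using this.symm

lemma sum_prob_pair [Fintype α] (f : Ω → α) (h : Ω → β) (b : β) :
    ∑ a, prob P (fun ω => (f ω, h ω)) (a, b) = prob P h b := by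
  classical
  unfold prob
  rw [← Finset.sum_fiberwise (s := Finset.univ.filter fun ω => h ω = b) (g := f)]
  refine Finset.sum_congr rfl fun a _ => Finset.sum_congr ?_ fun _ _ => rfl
  ext ω; simp [and_comm]

lemma entropy_eq_sum [Fintype α] (f : Ω → α) :
    entropy P f = -∑ a, prob P f a * Real.log (prob P f a) := by
  rw [entropy, sum_mul_comp f fun a => Real.log (prob P f a)]

/-- The entropy of `f` depends only on the partition into the fibres of `f`. -/
lemma entropy_congr {f : Ω → α} {g : Ω → β} (h : ∀ ω ω', f ω = f ω' ↔ g ω = g ω') :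
    entropy P f = entropy P g := by
  classical
  unfold entropy prob
  congr 1
  refine Finset.sum_congr rfl fun ω _ => ?_
  congr 3
  ext ω'
  simp [h]

/-- Gibbs' inequality: the cross entropy is at least the entropy. -/
lemma entropy_le_cross [Fintype α] (hP : P ∈ stdSimplex ℝ Ω) (f : Ω → α) (r : α → ℝ)
    (hr : ∀ a, 0 ≤ r a) (hr1 : ∑ a, r a ≤ 1) (hpos : ∀ ω, 0 < P ω → 0 < r (f ω)) :
    entropy P f ≤ -∑ ω, P ω * Real.log (r (f ω)) := by
  have key : ∑ ω, (P ω * Real.log (r (f ω)) - P ω * Real.log (prob P f (f ω))) ≤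
      ∑ ω, (P ω * (r (f ω) / prob P f (f ω)) - P ω) := by
    refine Finset.sum_le_sum fun ω _ => ?_
    rcases (hP.1 ω).eq_or_lt with h | h
    · simp [← h]
    · have hp := prob_pos hP f h
      have := Real.log_le_sub_one_of_pos (div_pos (hpos ω h) hp)
      rw [Real.log_div (hpos ω h).ne' hp.ne'] at this
      nlinarith [mul_le_mul_of_nonneg_left this h.le]
  have h2 : ∑ ω, P ω * (r (f ω) / prob P f (f ω)) ≤ 1 := by
    rw [sum_mul_comp f fun a => r a / prob P f a]
    refine le_trans (Finset.sum_le_sum fun a _ => ?_) hr1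
    rcases (prob_nonneg hP f a).eq_or_lt with h | h
    · simpa [← h] using hr a
    · rw [mul_div_cancel₀ _ h.ne']
  rw [Finset.sum_sub_distrib, Finset.sum_sub_distrib, hP.2] at key
  rw [entropy]
  linarith

lemma entropy_le_log_card [Fintype α] [Nonempty α] (hP : P ∈ stdSimplex ℝ Ω) (f : Ω → α) :
    entropy P f ≤ Real.log (Fintype.card α) := by
  have hc : (0 : ℝ) < Fintype.card α := by exact_mod_cast Fintype.card_pos
  refine (entropy_le_cross hP f (fun _ => (Fintype.card α : ℝ)⁻¹) (fun _ => by positivity)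
    (by simp [hc.ne']) (fun _ _ => by positivity)).trans_eq ?_
  rw [← Finset.sum_mul, hP.2, Real.log_inv]
  ring

/-- Strong subadditivity: the conditional mutual information `I(f;g|h)` is nonnegative. -/
lemma entropy_submodular [Fintype α] [Fintype β] [Fintype γ] (hP : P ∈ stdSimplex ℝ Ω)
    (f : Ω → α) (g : Ω → β) (h : Ω → γ) :
    entropy P (fun ω => (f ω, g ω, h ω)) + entropy P h ≤
      entropy P (fun ω => (f ω, h ω)) + entropy P (fun ω => (g ω, h ω)) := by
  have key := entropy_le_cross hP (fun ω => (f ω, g ω, h ω))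
    (fun x => prob P (fun ω => (f ω, h ω)) (x.1, x.2.2) *
      prob P (fun ω => (g ω, h ω)) (x.2.1, x.2.2) / prob P h x.2.2)
    (fun x => div_nonneg (mul_nonneg (prob_nonneg hP _ _) (prob_nonneg hP _ _))
      (prob_nonneg hP _ _)) ?_ ?_
  · have e : ∑ ω, P ω * Real.log (prob P (fun ω => (f ω, h ω)) (f ω, h ω) *
        prob P (fun ω => (g ω, h ω)) (g ω, h ω) / prob P h (h ω)) =
        ∑ ω, (P ω * Real.log (prob P (fun ω => (f ω, h ω)) (f ω, h ω)) +
          P ω * Real.log (prob P (fun ω => (g ω, h ω)) (g ω, h ω)) -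
          P ω * Real.log (prob P h (h ω))) := by
      refine Finset.sum_congr rfl fun ω _ => ?_
      rcases (hP.1 ω).eq_or_lt with h0 | h0
      · simp [← h0]
      · have h1 := (prob_pos hP (fun ω => (f ω, h ω)) h0).ne'
        have h2 := (prob_pos hP (fun ω => (g ω, h ω)) h0).ne'
        have h3 := (prob_pos hP h h0).ne'
        rw [Real.log_div (mul_ne_zero h1 h2) h3, Real.log_mul h1 h2]
        ring
    rw [e, Finset.sum_sub_distrib, Finset.sum_add_distrib] at key
    simp only [entropy] at key ⊢
    linarith
  · rw [Fintype.sum_prod_type]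
    simp only [Fintype.sum_prod_type]
    have e1 : ∀ a : α, ∑ b : β, ∑ c : γ, prob P (fun ω => (f ω, h ω)) (a, c) *
        prob P (fun ω => (g ω, h ω)) (b, c) / prob P h c =
        ∑ c : γ, prob P (fun ω => (f ω, h ω)) (a, c) * (prob P h c / prob P h c) := by
      intro a
      rw [Finset.sum_comm]
      refine Finset.sum_congr rfl fun c _ => ?_
      rw [← Finset.sum_div, ← Finset.mul_sum, sum_prob_pair, mul_div_assoc]
    simp only [e1]
    rw [Finset.sum_comm]
    simp only [← Finset.sum_mul, sum_prob_pair]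
    rw [← sum_prob hP h]
    refine Finset.sum_le_sum fun c _ => ?_
    rcases (prob_nonneg hP h c).eq_or_lt with h0 | h0
    · simp [← h0]
    · rw [div_self h0.ne', mul_one]
  · intro ω h0
    have h1 := prob_pos hP (fun ω => (f ω, h ω)) h0
    have h2 := prob_pos hP (fun ω => (g ω, h ω)) h0
    have h3 := prob_pos hP h h0
    positivity

/-- Fano's inequality for the estimate `d z` of `x` from `z`, in the weak form where the entropy of
the error event is bounded by `log 2`. -/
lemma fano [Fintype α] [DecidableEq α] [Nonempty α] [Fintype β] (hP : P ∈ stdSimplex ℝ Ω)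
    (x : Ω → α) (z : Ω → β) (d : β → α) :
    entropy P (fun ω => (x ω, z ω)) ≤ entropy P z + Real.log 2 +
      (∑ ω with d (z ω) ≠ x ω, P ω) * Real.log (Fintype.card α) := by
  have hc : (0 : ℝ) < Fintype.card α := by exact_mod_cast Fintype.card_pos
  -- the competing law picks the estimate with probability `1/2` and is uniform otherwise
  set q : α → β → ℝ := fun a b => if d b = a then 1 / 2 else 1 / 2 * (Fintype.card α : ℝ)⁻¹
  have hq : ∀ a b, 0 < q a b := fun a b => by
    simp only [q]; split_ifs <;> positivity
  have hq1 : ∀ b, ∑ a, q a b ≤ 1 := fun b => by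
    calc ∑ a, q a b ≤ ∑ a, ((if d b = a then 1 / 2 else 0) + 1 / 2 * (Fintype.card α : ℝ)⁻¹) := by
          refine Finset.sum_le_sum fun a _ => ?_
          simp only [q]
          split_ifs
          · have : 0 ≤ 1 / 2 * (Fintype.card α : ℝ)⁻¹ := by positivity
            linarith
          · linarith
      _ = 1 := by
          rw [Finset.sum_add_distrib, Finset.sum_ite_eq]
          simp only [Finset.mem_univ, if_true, Finset.sum_const, Finset.card_univ, nsmul_eq_mul]
          field_simp
          norm_num
  have key := entropy_le_cross hP (fun ω => (x ω, z ω)) (fun y => prob P z y.2 * q y.1 y.2)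
    (fun y => mul_nonneg (prob_nonneg hP _ _) (hq _ _).le) ?_
    (fun ω h => mul_pos (prob_pos hP z h) (hq _ _))
  · have e : ∑ ω, P ω * Real.log (prob P z (z ω) * q (x ω) (z ω)) =
        ∑ ω, (P ω * Real.log (prob P z (z ω)) - P ω * Real.log 2 -
          (if d (z ω) ≠ x ω then P ω else 0) * Real.log (Fintype.card α)) := by
      refine Finset.sum_congr rfl fun ω _ => ?_
      rcases (hP.1 ω).eq_or_lt with h0 | h0
      · simp [← h0]
      · rw [Real.log_mul (prob_pos hP z h0).ne' (hq _ _).ne']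
        simp only [q]
        by_cases h : d (z ω) = x ω
        · simp [h]; ring
        · rw [if_neg h, if_pos h, Real.log_mul (by norm_num) (by positivity), Real.log_inv,
            one_div, Real.log_inv]
          ring
    rw [e, Finset.sum_sub_distrib, Finset.sum_sub_distrib, ← Finset.sum_mul, ← Finset.sum_mul,
      hP.2, ← Finset.sum_filter] at key
    simp only [entropy] at key ⊢
    linarith
  · rw [Fintype.sum_prod_type, Finset.sum_comm]
    simp only [← Finset.mul_sum]
    rw [← sum_prob hP z]
    exact Finset.sum_le_sum fun b _ => mul_le_of_le_one_right (prob_nonneg hP _ _) (hq1 b)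

end Entropy

/-! ### Information carried by letters that are independent given the messages -/

section Memoryless

variable {Msg ι γ X : Type*} [Fintype Msg] [Nonempty Msg] [Fintype ι] [DecidableEq ι]
  {Y : ι → Type*} [∀ l, Fintype (Y l)]

lemma pmf_sum_toReal {α : Type*} [Fintype α] (p : PMF α) : ∑ a, (p a).toReal = 1 := by
  rw [← ENNReal.toReal_sum fun a _ => p.apply_ne_top a, ← tsum_fintype (L := .unconditional _),
    p.tsum_coe, ENNReal.toReal_one]

/-- The law of a uniform message together with letters that are independent given the message, the
letter `l` having law `V w l` given the message `w`. -/
def jointWeight (V : Msg → ∀ l, PMF (Y l)) (ω : Msg × ∀ l, Y l) : ℝ :=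
  (Fintype.card Msg : ℝ)⁻¹ * ∏ l, (V ω.1 l (ω.2 l)).toReal

lemma sum_prod_restrict (v : ∀ l, PMF (Y l)) (S : Finset ι) (F : (∀ l : S, Y l) → ℝ) :
    ∑ y : ∀ l, Y l, (∏ l, (v l (y l)).toReal) * F (S.restrict y) =
      ∑ z : ∀ l : S, Y l, (∏ l : S, (v l (z l)).toReal) * F z := by
  rw [← (Equiv.piEquivPiSubtypeProd (· ∈ S) Y).symm.sum_comp, Fintype.sum_prod_type]
  refine Finset.sum_congr rfl fun z _ => ?_
  have h1 : ∀ b : ∀ l : {l // l ∉ S}, Y l,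
      (∏ l, (v l ((Equiv.piEquivPiSubtypeProd (· ∈ S) Y).symm (z, b) l)).toReal) *
        F (S.restrict ((Equiv.piEquivPiSubtypeProd (· ∈ S) Y).symm (z, b))) =
      ((∏ l : S, (v l (z l)).toReal) * F z) * ∏ l : {l // l ∉ S}, (v l (b l)).toReal := by
    intro b
    have e1 : S.restrict ((Equiv.piEquivPiSubtypeProd (· ∈ S) Y).symm (z, b)) = z := by
      ext l
      simp [Equiv.piEquivPiSubtypeProd]
    rw [e1, ← Fintype.prod_subtype_mul_prod_subtype (· ∈ S)]
    have e2 : ∀ l : {l // l ∈ S}, (Equiv.piEquivPiSubtypeProd (· ∈ S) Y).symm (z, b) l = z l := by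
      intro l; simp [Equiv.piEquivPiSubtypeProd]
    have e3 : ∀ l : {l // l ∉ S}, (Equiv.piEquivPiSubtypeProd (· ∈ S) Y).symm (z, b) l = b l := by
      intro l; simp [Equiv.piEquivPiSubtypeProd, l.2]
    simp only [e2, e3]
    rw [mul_right_comm]
    congr!
  simp only [h1]
  rw [← Finset.mul_sum]
  have := (Fintype.prod_sum (fun (l : {l // l ∉ S}) (b : Y l) => (v l b).toReal)).symm
  rw [this]
  simp [pmf_sum_toReal]

lemma sum_jointWeight (V : Msg → ∀ l, PMF (Y l)) (S : Finset ι)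
    (F : Msg → (∀ l : S, Y l) → ℝ) :
    ∑ ω, jointWeight V ω * F ω.1 (S.restrict ω.2) =
      (Fintype.card Msg : ℝ)⁻¹ * ∑ w, ∑ z : ∀ l : S, Y l, (∏ l : S, (V w l (z l)).toReal) * F w z := by
  rw [Fintype.sum_prod_type, Finset.mul_sum]
  refine Finset.sum_congr rfl fun w _ => ?_
  rw [← sum_prod_restrict (V w) S (F w), Finset.mul_sum]
  exact Finset.sum_congr rfl fun y _ => by simp only [jointWeight]; ring

lemma sum_jointWeight_fst (V : Msg → ∀ l, PMF (Y l)) (F : Msg → ℝ) :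
    ∑ ω, jointWeight V ω * F ω.1 = (Fintype.card Msg : ℝ)⁻¹ * ∑ w, F w := by
  rw [sum_jointWeight V ∅ fun w _ => F w]
  simp

lemma jointWeight_mem (V : Msg → ∀ l, PMF (Y l)) :
    jointWeight V ∈ stdSimplex ℝ (Msg × ∀ l, Y l) := by
  refine ⟨fun ω => mul_nonneg (by positivity) (Finset.prod_nonneg fun _ _ => ENNReal.toReal_nonneg),
    ?_⟩
  have h := sum_jointWeight_fst V fun _ => 1
  simp only [mul_one, Finset.sum_const, Finset.card_univ, nsmul_eq_mul] at h
  rw [h, inv_mul_cancel₀]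
  exact_mod_cast Fintype.card_ne_zero

lemma prob_jointWeight [DecidableEq γ] (V : Msg → ∀ l, PMF (Y l)) (g : Msg → γ) (S : Finset ι)
    (a : γ) (z : ∀ l : S, Y l) :
    prob (jointWeight V) (fun ω => (g ω.1, S.restrict ω.2)) (a, z) =
      (Fintype.card Msg : ℝ)⁻¹ * ∑ w, if g w = a then ∏ l : S, (V w l (z l)).toReal else 0 := by
  classical
  have h := sum_jointWeight V S fun w y => if (g w, y) = (a, z) then 1 else 0
  have e : prob (jointWeight V) (fun ω => (g ω.1, S.restrict ω.2)) (a, z) =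
      ∑ ω, jointWeight V ω * (if (g ω.1, S.restrict ω.2) = (a, z) then 1 else 0) := by
    rw [prob, Finset.sum_filter]
    exact Finset.sum_congr rfl fun ω _ => by split_ifs <;> simp
  rw [e, h]
  congr 1
  refine Finset.sum_congr rfl fun w _ => ?_
  by_cases hw : g w = a <;> simp [hw]

lemma prob_jointWeight_fst (V : Msg → ∀ l, PMF (Y l)) (w : Msg) :
    prob (jointWeight V) Prod.fst w = (Fintype.card Msg : ℝ)⁻¹ := by
  classical
  have h := sum_jointWeight_fst V fun w' => if w' = w then 1 else 0
  have e : prob (jointWeight V) Prod.fst w =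
      ∑ ω, jointWeight V ω * (if ω.1 = w then 1 else 0) := by
    rw [prob, Finset.sum_filter]
    exact Finset.sum_congr rfl fun ω _ => by split_ifs <;> simp
  rw [e, h]
  simp

/-- The conditional mutual information `I(w ; y_S | g(w))`, in nats, between the message `w` and the
letters `y_S` with index in `S`, given the function `g` of the message. -/
def condInfo (V : Msg → ∀ l, PMF (Y l)) (g : Msg → γ) (S : Finset ι) : ℝ :=
  entropy (jointWeight V) (fun ω => (g ω.1, S.restrict ω.2)) -
    entropy (jointWeight V) (fun ω => g ω.1) -
  (entropy (jointWeight V) (fun ω => (ω.1, S.restrict ω.2)) - entropy (jointWeight V) Prod.fst)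

/-- The entropy of the letters in `S` given the message is the sum of their separate conditional
entropies, as the letters are independent given the message. -/
lemma entropy_fst_restrict (V : Msg → ∀ l, PMF (Y l)) (S : Finset ι) :
    entropy (jointWeight V) (fun ω => (ω.1, S.restrict ω.2)) =
      entropy (jointWeight V) Prod.fst +
        ∑ l ∈ S, -∑ ω, jointWeight V ω * Real.log (V ω.1 l (ω.2 l)).toReal := by
  classical
  have hc : (0 : ℝ) < Fintype.card Msg := by exact_mod_cast Fintype.card_pos
  simp only [entropy]
  rw [Finset.sum_neg_distrib, Finset.sum_comm, ← neg_add, ← Finset.sum_add_distrib]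
  congr 1
  refine Finset.sum_congr rfl fun ω _ => ?_
  rcases ((jointWeight_mem V).1 ω).eq_or_lt with h | h
  · simp [← h]
  · have hne : ∀ l, (V ω.1 l (ω.2 l)).toReal ≠ 0 := fun l h0 => by
      rw [jointWeight, Finset.prod_eq_zero (Finset.mem_univ l) h0, mul_zero] at h
      exact h.false
    have e : prob (jointWeight V) (fun ω => (ω.1, S.restrict ω.2)) (ω.1, S.restrict ω.2) =
        (Fintype.card Msg : ℝ)⁻¹ * ∏ l ∈ S, (V ω.1 l (ω.2 l)).toReal := by
      refine (prob_jointWeight V (fun w => w) S _ _).trans ?_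
      rw [← Finset.prod_coe_sort]
      simp
    rw [e, prob_jointWeight_fst, Real.log_mul (by positivity)
      (Finset.prod_ne_zero_iff.2 fun l _ => hne l), Real.log_prod fun l _ => hne l, mul_add,
      Finset.mul_sum]

lemma condInfo_eq (V : Msg → ∀ l, PMF (Y l)) (g : Msg → γ) (S : Finset ι) :
    condInfo V g S = entropy (jointWeight V) (fun ω => (g ω.1, S.restrict ω.2)) -
      entropy (jointWeight V) (fun ω => g ω.1) -
        ∑ l ∈ S, -∑ ω, jointWeight V ω * Real.log (V ω.1 l (ω.2 l)).toReal := by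
  rw [condInfo, entropy_fst_restrict]
  ring

lemma entropy_restrict_congr [Fintype γ] {V V' : Msg → ∀ l, PMF (Y l)} (g : Msg → γ) {S : Finset ι}
    (h : ∀ w, ∀ l ∈ S, V w l = V' w l) :
    entropy (jointWeight V) (fun ω => (g ω.1, S.restrict ω.2)) =
      entropy (jointWeight V') (fun ω => (g ω.1, S.restrict ω.2)) := by
  classical
  have e : ∀ x, prob (jointWeight V) (fun ω => (g ω.1, S.restrict ω.2)) x =
      prob (jointWeight V') (fun ω => (g ω.1, S.restrict ω.2)) x := by
    rintro ⟨a, z⟩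
    rw [prob_jointWeight, prob_jointWeight]
    congr 1
    refine Finset.sum_congr rfl fun w _ => ?_
    congr 1
    exact Finset.prod_congr rfl fun l _ => by rw [h w l l.2]
  simp only [entropy_eq_sum, e]

lemma entropy_fst_congr [Fintype γ] (V V' : Msg → ∀ l, PMF (Y l)) (g : Msg → γ) :
    entropy (jointWeight V) (fun ω => g ω.1) = entropy (jointWeight V') (fun ω => g ω.1) := by
  have e : ∀ V : Msg → ∀ l, PMF (Y l), entropy (jointWeight V) (fun ω => g ω.1) =
      entropy (jointWeight V) (fun ω => (g ω.1, (∅ : Finset ι).restrict ω.2)) := fun V =>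
    entropy_congr fun ω ω' => by
      rw [Prod.mk.injEq]; exact (and_iff_left (Subsingleton.elim _ _)).symm
  rw [e, e, entropy_restrict_congr g (V' := V')]
  simp

/-- The information in the letters of `S` depends on the laws of these letters only. -/
lemma condInfo_congr [Fintype γ] {V V' : Msg → ∀ l, PMF (Y l)} (g : Msg → γ) {S : Finset ι}
    (h : ∀ w, ∀ l ∈ S, V w l = V' w l) : condInfo V g S = condInfo V' g S := by
  unfold condInfo
  rw [entropy_restrict_congr g h, entropy_restrict_congr (fun w => w) h, entropy_fst_congr V V' g,
    entropy_fst_congr V V' fun w => w]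

lemma condInfo_empty (V : Msg → ∀ l, PMF (Y l)) (g : Msg → γ) : condInfo V g ∅ = 0 := by
  rw [condInfo_eq, Finset.sum_empty, sub_zero, sub_eq_zero]
  refine entropy_congr fun ω ω' => ?_
  rw [Prod.mk.injEq]
  exact and_iff_left (Subsingleton.elim _ _)

lemma restrict_eq_iff {S : Finset ι} (y y' : ∀ l, Y l) :
    S.restrict y = S.restrict y' ↔ ∀ l ∈ S, y l = y' l := by
  simp [funext_iff, Finset.restrict]

lemma restrict_univ_eq_iff (y y' : ∀ l, Y l) :
    (Finset.univ : Finset ι).restrict y = (Finset.univ : Finset ι).restrict y' ↔ y = y' := by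
  rw [restrict_eq_iff]
  simp [funext_iff]

lemma condInfo_union_le [Fintype γ] (V : Msg → ∀ l, PMF (Y l)) (g : Msg → γ) {S T : Finset ι}
    (h : Disjoint S T) : condInfo V g (S ∪ T) ≤ condInfo V g S + condInfo V g T := by
  have h1 := entropy_submodular (jointWeight_mem V) (fun ω => S.restrict ω.2)
    (fun ω => T.restrict ω.2) (fun ω => g ω.1)
  have e1 : entropy (jointWeight V) (fun ω => (S.restrict ω.2, T.restrict ω.2, g ω.1)) =
      entropy (jointWeight V) (fun ω => (g ω.1, (S ∪ T).restrict ω.2)) := by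
    refine entropy_congr fun ω ω' => ?_
    simp only [Prod.mk.injEq, restrict_eq_iff, Finset.mem_union]
    constructor
    · rintro ⟨a, b, c⟩; exact ⟨c, fun l hl => hl.elim (a l) (b l)⟩
    · rintro ⟨c, a⟩; exact ⟨fun l hl => a l (Or.inl hl), fun l hl => a l (Or.inr hl), c⟩
  have e2 : ∀ U : Finset ι, entropy (jointWeight V) (fun ω => (U.restrict ω.2, g ω.1)) =
      entropy (jointWeight V) (fun ω => (g ω.1, U.restrict ω.2)) := fun U =>
    entropy_congr fun ω ω' => by simp only [Prod.mk.injEq, and_comm]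
  rw [e1, e2, e2] at h1
  simp only [condInfo_eq, Finset.sum_union h]
  linarith

lemma condInfo_mono [Fintype γ] (V : Msg → ∀ l, PMF (Y l)) (g : Msg → γ) {S T : Finset ι}
    (h : S ⊆ T) : condInfo V g S ≤ condInfo V g T := by
  have h1 := entropy_submodular (jointWeight_mem V) (fun ω => ω.1)
    (fun ω => T.restrict ω.2) (fun ω => (g ω.1, S.restrict ω.2))
  have e1 : entropy (jointWeight V)
      (fun ω => (ω.1, T.restrict ω.2, (g ω.1, S.restrict ω.2))) =
      entropy (jointWeight V) (fun ω => (ω.1, T.restrict ω.2)) := by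
    refine entropy_congr fun ω ω' => ?_
    simp only [Prod.mk.injEq, restrict_eq_iff]
    exact ⟨fun a => ⟨a.1, a.2.1⟩, fun a => ⟨a.1, a.2, by rw [a.1], fun l hl => a.2 l (h hl)⟩⟩
  have e2 : entropy (jointWeight V) (fun ω => (ω.1, (g ω.1, S.restrict ω.2))) =
      entropy (jointWeight V) (fun ω => (ω.1, S.restrict ω.2)) := by
    refine entropy_congr fun ω ω' => ?_
    simp only [Prod.mk.injEq, restrict_eq_iff]
    exact ⟨fun a => ⟨a.1, a.2.2⟩, fun a => ⟨a.1, by rw [a.1], a.2⟩⟩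
  have e3 : entropy (jointWeight V) (fun ω => (T.restrict ω.2, (g ω.1, S.restrict ω.2))) =
      entropy (jointWeight V) (fun ω => (g ω.1, T.restrict ω.2)) := by
    refine entropy_congr fun ω ω' => ?_
    simp only [Prod.mk.injEq, restrict_eq_iff]
    exact ⟨fun a => ⟨a.2.1, a.1⟩, fun a => ⟨a.2, a.1, fun l hl => a.2 l (h hl)⟩⟩
  rw [e1, e2, e3] at h1
  simp only [condInfo]
  linarith

lemma condInfo_nonneg [Fintype γ] (V : Msg → ∀ l, PMF (Y l)) (g : Msg → γ) (S : Finset ι) :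
    0 ≤ condInfo V g S :=
  (condInfo_empty V g).symm.le.trans (condInfo_mono V g (Finset.empty_subset S))

lemma condInfo_biUnion_le [Fintype γ] {κ : Type*} [DecidableEq κ] (V : Msg → ∀ l, PMF (Y l))
    (g : Msg → γ) (s : Finset κ) (S : κ → Finset ι)
    (h : ∀ a ∈ s, ∀ b ∈ s, a ≠ b → Disjoint (S a) (S b)) :
    condInfo V g (s.biUnion S) ≤ ∑ a ∈ s, condInfo V g (S a) := by
  induction s using Finset.induction_on with
  | empty => simp [condInfo_empty]
  | insert a s ha ih =>
    rw [Finset.biUnion_insert, Finset.sum_insert ha]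
    refine (condInfo_union_le V g ?_).trans ?_
    · rw [Finset.disjoint_biUnion_right]
      exact fun b hb => h a (by simp) b (by simp [hb]) (by rintro rfl; exact ha hb)
    · have := ih fun b hb c hc => h b (by simp [hb]) c (by simp [hc])
      linarith

/-- Conditioning on a function of the message does not increase the information about it. -/
lemma condInfo_le_const [Fintype γ] (V : Msg → ∀ l, PMF (Y l)) (g : Msg → γ) (S : Finset ι) :
    condInfo V g S ≤ condInfo V (fun _ => ()) S := by
  have h1 := entropy_submodular (jointWeight_mem V) (fun ω => g ω.1)
    (fun ω => S.restrict ω.2) (fun _ => ())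
  have e1 : entropy (jointWeight V) (fun ω => (g ω.1, S.restrict ω.2, ())) =
      entropy (jointWeight V) (fun ω => (g ω.1, S.restrict ω.2)) :=
    entropy_congr fun ω ω' => by simp
  have e2 : entropy (jointWeight V) (fun ω => (g ω.1, ())) =
      entropy (jointWeight V) (fun ω => g ω.1) :=
    entropy_congr fun ω ω' => by simp
  have e3 : entropy (jointWeight V) (fun ω => (S.restrict ω.2, ())) =
      entropy (jointWeight V) (fun ω => ((), S.restrict ω.2)) :=
    entropy_congr fun ω ω' => by simp
  rw [e1, e2, e3] at h1
  simp only [condInfo_eq]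
  linarith

/-- A letter that is the output of the channel `K` carries the mutual information of `K`, for the
law of the channel input induced by the uniform message. -/
lemma condInfo_singleton [Fintype X] (V : Msg → ∀ l, PMF (Y l)) (l : ι) (K : X → PMF (Y l))
    (x : Msg → X) (h : ∀ w, V w l = K (x w)) :
    condInfo V (fun _ => ()) {l} =
      Real.log 2 * mutualInfo ((PMF.uniformOfFintype Msg).map x) K := by
  classical
  set p := (PMF.uniformOfFintype Msg).map x
  have hc : (0 : ℝ) < Fintype.card Msg := by exact_mod_cast Fintype.card_pos
  have hp : ∀ F : X → ℝ, ∑ a, (p a).toReal * F a = (Fintype.card Msg : ℝ)⁻¹ * ∑ w, F (x w) := by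
    intro F
    have e : ∀ a, (p a).toReal = ∑ w, if x w = a then (Fintype.card Msg : ℝ)⁻¹ else 0 := by
      intro a
      simp only [p, PMF.map_apply, tsum_fintype, PMF.uniformOfFintype_apply]
      rw [ENNReal.toReal_sum fun w _ => by split_ifs <;> simp]
      refine Finset.sum_congr rfl fun w _ => ?_
      by_cases hw : x w = a
      · rw [if_pos hw.symm, if_pos hw]; simp
      · rw [if_neg fun h => hw h.symm, if_neg hw]; simp
    simp only [e, Finset.sum_mul]
    rw [Finset.sum_comm, Finset.mul_sum]
    refine Finset.sum_congr rfl fun w _ => ?_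
    simp
  have hq : ∀ b, ((p.bind K) b).toReal = (Fintype.card Msg : ℝ)⁻¹ * ∑ w, (V w l b).toReal := by
    intro b
    simp only [PMF.bind_apply, tsum_fintype]
    rw [ENNReal.toReal_sum fun a _ => ENNReal.mul_ne_top (p.apply_ne_top a) ((K a).apply_ne_top b)]
    simp only [ENNReal.toReal_mul]
    rw [hp fun a => (K a b).toReal]
    simp only [h]
  have hprob : ∀ z : ∀ k : ({l} : Finset ι), Y k,
      prob (jointWeight V) (fun ω => ((), ({l} : Finset ι).restrict ω.2)) ((), z) =
        ((p.bind K) (z ⟨l, by simp⟩)).toReal := by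
    intro z
    rw [prob_jointWeight V (fun _ => ()), hq]
    congr 1
    refine Finset.sum_congr rfl fun w _ => ?_
    rw [if_pos rfl, Fintype.prod_eq_single ⟨l, by simp⟩]
    rintro ⟨k, hk⟩ hne
    exact absurd (Subtype.ext (Finset.mem_singleton.1 hk)) hne
  have h0 : entropy (jointWeight V) (fun _ => ()) = 0 := by
    have : prob (jointWeight V) (fun _ => ()) () = 1 := by
      simp [prob, (jointWeight_mem V).2]
    simp [entropy, this]
  rw [condInfo_eq, h0, Finset.sum_singleton, entropy]
  simp only [hprob]
  have key := sum_jointWeight V {l} fun w z =>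
    Real.log (V w l (z ⟨l, by simp⟩)).toReal - Real.log ((p.bind K) (z ⟨l, by simp⟩)).toReal
  have lhs : ∑ ω, jointWeight V ω * (Real.log (V ω.1 l (ω.2 l)).toReal -
      Real.log ((p.bind K) (ω.2 l)).toReal) =
      (Fintype.card Msg : ℝ)⁻¹ * ∑ w, ∑ b, (V w l b).toReal *
        (Real.log (V w l b).toReal - Real.log ((p.bind K) b).toReal) := by
    refine key.trans ?_
    congr 1
    refine Finset.sum_congr rfl fun w _ => ?_
    have e : ∀ z : ∀ k : ({l} : Finset ι), Y k, ∏ k : ({l} : Finset ι), (V w k (z k)).toReal =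
        (V w l (z ⟨l, by simp⟩)).toReal := by
      intro z
      rw [Fintype.prod_eq_single ⟨l, by simp⟩]
      rintro ⟨k, hk⟩ hne
      exact absurd (Subtype.ext (Finset.mem_singleton.1 hk)) hne
    simp only [e]
    let eq : (∀ k : ({l} : Finset ι), Y k) ≃ Y l :=
      { toFun := fun z => z ⟨l, by simp⟩
        invFun := fun b k => (Finset.mem_singleton.1 k.2).symm ▸ b
        left_inv := by
          intro z
          ext ⟨k, hk⟩
          obtain rfl := Finset.mem_singleton.1 hk
          rfl
        right_inv := fun b => rfl }
    exact eq.sum_comp fun b => (V w l b).toReal *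
        (Real.log (V w l b).toReal - Real.log ((p.bind K) b).toReal)
  have rhs : Real.log 2 * mutualInfo p K = (Fintype.card Msg : ℝ)⁻¹ * ∑ w, ∑ b, (V w l b).toReal *
        (Real.log (V w l b).toReal - Real.log ((p.bind K) b).toReal) := by
    have := hp fun a => ∑ b, (K a b).toReal *
        (Real.log (K a b).toReal - Real.log ((p.bind K) b).toReal)
    simp only [h, ← this]
    rw [mutualInfo, Finset.mul_sum]
    refine Finset.sum_congr rfl fun a _ => ?_
    rw [Finset.mul_sum, Finset.mul_sum]
    refine Finset.sum_congr rfl fun b _ => ?_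
    rcases eq_or_ne (p a) 0 with ha | ha
    · simp [ha]
    rcases eq_or_ne (K a b) 0 with hb | hb
    · simp [hb]
    have h1 : (K a b).toReal ≠ 0 := ENNReal.toReal_ne_zero.2 ⟨hb, (K a).apply_ne_top b⟩
    have h2 : ((p.bind K) b).toReal ≠ 0 := by
      refine ENNReal.toReal_ne_zero.2 ⟨fun h0 => ?_, (p.bind K).apply_ne_top b⟩
      rw [PMF.bind_apply, ENNReal.tsum_eq_zero] at h0
      exact (mul_ne_zero ha hb) (h0 a)
    rw [Real.logb, Real.log_div h1 h2]
    have : Real.log 2 ≠ 0 := (Real.log_pos (by norm_num)).ne'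
    field_simp
  rw [rhs, ← lhs]
  simp only [mul_sub, Finset.sum_sub_distrib]
  simp only [Finset.restrict]
  ring

end Memoryless

/-! ### Finiteness of the channel capacity -/

section Capacity

variable {X Y : Type*} [Fintype X] [Fintype Y]

lemma mutualInfo_le_card (p : PMF X) (K : X → PMF Y) :
    mutualInfo p K ≤ ∑ _x : X, ∑ _y : Y, (Real.log 2)⁻¹ := by
  have h2 : 0 < Real.log 2 := Real.log_pos (by norm_num)
  refine Finset.sum_le_sum fun a _ => Finset.sum_le_sum fun b _ => ?_
  rcases eq_or_ne (p a) 0 with ha | ha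
  · simp [ha, h2.le]
  rcases eq_or_ne (K a b) 0 with hb | hb
  · simp [hb, h2.le]
  have hle : p a * K a b ≤ (p.bind K) b := by
    rw [PMF.bind_apply]
    exact ENNReal.le_tsum (f := fun a => p a * K a b) a
  have hle' : (p a).toReal * (K a b).toReal ≤ ((p.bind K) b).toReal := by
    rw [← ENNReal.toReal_mul]
    exact ENNReal.toReal_mono ((p.bind K).apply_ne_top b) hle
  have h1 : 0 < (K a b).toReal := ENNReal.toReal_pos hb ((K a).apply_ne_top b)
  have h3 : 0 < (p a).toReal := ENNReal.toReal_pos ha (p.apply_ne_top a)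
  have h4 : (K a b).toReal ≤ 1 := by
    rw [← ENNReal.toReal_one]; exact ENNReal.toReal_mono ENNReal.one_ne_top ((K a).coe_le_one b)
  set q := ((p.bind K) b).toReal
  set w := (K a b).toReal
  set r := (p a).toReal
  have hq : 0 < q := (mul_pos h3 h1).trans_le hle'
  have h5 := Real.log_le_sub_one_of_pos (div_pos h1 hq)
  rw [Real.logb, ← mul_div_assoc, div_le_iff₀ h2, inv_mul_cancel₀ h2.ne']
  calc r * w * Real.log (w / q) ≤ r * w * (w / q) :=
        mul_le_mul_of_nonneg_left (by linarith) (by positivity)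
    _ = (r * w / q) * w := by ring
    _ ≤ 1 * 1 := mul_le_mul ((div_le_one hq).2 hle') h4 h1.le zero_le_one
    _ = 1 := one_mul 1

lemma channelCapacity_ne_top (K : X → PMF Y) : channelCapacity K ≠ ⊤ := by
  refine ((iSup_le fun p => ?_).trans_lt
    (ENNReal.ofReal_lt_top (r := ∑ _x : X, ∑ _y : Y, (Real.log 2)⁻¹))).ne
  exact ENNReal.ofReal_le_ofReal (mutualInfo_le_card p K)

lemma mutualInfo_le_capacity (p : PMF X) (K : X → PMF Y) :
    mutualInfo p K ≤ (channelCapacity K).toReal :=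
  (ENNReal.ofReal_le_iff_le_toReal (channelCapacity_ne_top K)).1
    (le_iSup (fun p => ENNReal.ofReal (mutualInfo p K)) p)

end Capacity

/-! ### The converse for fixed queries -/

section FixedQuery

variable {M L : ℕ} {ι : Type*} [Fintype ι] [DecidableEq ι] {Y : ι → Type*} [∀ l, Fintype (Y l)]

/-- The messages with index less than `i`. -/
def firstMessages (i : ℕ) (w : Messages M L) : {j : Fin M // j.val < i} → Fin L → ZMod 2 :=
  fun j => w j

lemma log_card_bits {κ : Type*} [Fintype κ] [DecidableEq κ] :
    Real.log (Fintype.card (κ → Fin L → ZMod 2)) = Fintype.card κ * (L * Real.log 2) := by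
  simp [ZMod.card, Real.log_pow]

lemma entropy_firstMessages (V : Messages M L → ∀ l, PMF (Y l)) {i : ℕ} (hi : i ≤ M) :
    entropy (jointWeight V) (fun ω => firstMessages i ω.1) = i * (L * Real.log 2) := by
  have hP := jointWeight_mem V
  have hcard : Fintype.card {j : Fin M // j.val < i} = i := Fintype.card_fin_lt_of_le hi
  have hcard' : Fintype.card {j : Fin M // ¬ j.val < i} = M - i := by
    rw [Fintype.card_subtype_compl, hcard, Fintype.card_fin]
  refine le_antisymm ?_ ?_
  · refine (entropy_le_log_card hP _).trans_eq ?_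
    rw [log_card_bits, hcard]
  · -- the complementary messages have at most `(M - i) L` bits of the `M L` bits of all messages
    have h1 : entropy (jointWeight V) Prod.fst = M * (L * Real.log 2) := by
      simp only [entropy, prob_jointWeight_fst, ← Finset.sum_mul, hP.2]
      rw [Real.log_inv, one_mul, neg_neg, log_card_bits, Fintype.card_fin]
    have h2 := entropy_submodular hP (fun ω => firstMessages i ω.1)
      (fun ω => fun j : {j : Fin M // ¬ j.val < i} => ω.1 j) (fun _ => ())
    have h3 := entropy_le_log_card hP (fun ω => fun j : {j : Fin M // ¬ j.val < i} => ω.1 j)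
    rw [log_card_bits, hcard'] at h3
    have h4 : entropy (jointWeight V) (fun _ => ()) = 0 := by
      have : prob (jointWeight V) (fun _ => ()) () = 1 := by simp [prob, hP.2]
      simp [entropy, this]
    have e1 : entropy (jointWeight V) (fun ω => (firstMessages i ω.1,
        (fun j : {j : Fin M // ¬ j.val < i} => ω.1 j), ())) = entropy (jointWeight V) Prod.fst := by
      refine entropy_congr fun ω ω' => ?_
      simp only [Prod.mk.injEq, firstMessages, funext_iff, Subtype.forall, and_true]
      exact ⟨fun h j => by_cases (h.1 j) (h.2 j), fun h => ⟨fun j _ => h j, fun j _ => h j⟩⟩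
    have e2 : entropy (jointWeight V) (fun ω => (firstMessages i ω.1, ())) =
        entropy (jointWeight V) (fun ω => firstMessages i ω.1) :=
      entropy_congr fun ω ω' => by simp
    have e3 : entropy (jointWeight V)
          (fun ω => ((fun j : {j : Fin M // ¬ j.val < i} => ω.1 j), ())) =
        entropy (jointWeight V) (fun ω => fun j : {j : Fin M // ¬ j.val < i} => ω.1 j) :=
      entropy_congr fun ω ω' => by simp
    rw [e1, e2, e3, h1, h4] at h2
    rw [Nat.cast_sub hi] at h3
    linarith

/-- Decoding message `m` from all letters: among the unknown messages, the letters carry the `L`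
bits of message `m` on top of what they tell about the later ones, up to the Fano error. -/
lemma condInfo_firstMessages (V : Messages M L → ∀ l, PMF (Y l)) (m : Fin M)
    (d : (∀ l, Y l) → Fin L → ZMod 2) :
    L * Real.log 2 + condInfo V (firstMessages (m.val + 1)) Finset.univ ≤
      condInfo V (firstMessages m.val) Finset.univ +
        (Real.log 2 + (∑ ω with d ω.2 ≠ ω.1 m, jointWeight V ω) * (L * Real.log 2)) := by
  have hP := jointWeight_mem V
  have h1 := fano hP (fun ω => ω.1 m) (fun ω => ω.2) d
  have h2 := entropy_submodular hP (fun ω => ω.1 m) (fun ω => firstMessages m.val ω.1)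
    (fun ω => ω.2)
  have e1 : entropy (jointWeight V) (fun ω => (ω.1 m, firstMessages m.val ω.1, ω.2)) =
      entropy (jointWeight V)
        (fun ω => (firstMessages (m.val + 1) ω.1, (Finset.univ : Finset ι).restrict ω.2)) := by
    refine entropy_congr fun ω ω' => ?_
    simp only [Prod.mk.injEq, restrict_univ_eq_iff]
    constructor
    · rintro ⟨a, b, c⟩
      refine ⟨funext fun j => ?_, c⟩
      rcases (Nat.lt_succ_iff_lt_or_eq.1 j.2) with h | h
      · exact congrFun b ⟨j, h⟩
      · have : j.1 = m := Fin.ext h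
        simp only [firstMessages, this, a]
    · rintro ⟨a, b⟩
      exact ⟨congrFun a ⟨m, Nat.lt_succ_self _⟩,
        funext fun j => congrFun a ⟨j, j.2.trans (Nat.lt_succ_self _)⟩, b⟩
  have e2 : entropy (jointWeight V) (fun ω => (firstMessages m.val ω.1, ω.2)) =
      entropy (jointWeight V)
        (fun ω => (firstMessages m.val ω.1, (Finset.univ : Finset ι).restrict ω.2)) :=
    entropy_congr fun ω ω' => by simp only [Prod.mk.injEq, restrict_univ_eq_iff]
  have h3 : Real.log (Fintype.card (Fin L → ZMod 2)) = L * Real.log 2 := by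
    simp [ZMod.card, Real.log_pow]
  rw [e1, e2] at h2
  rw [h3] at h1
  simp only [condInfo, entropy_firstMessages V (show m.val + 1 ≤ M from m.2),
    entropy_firstMessages V m.2.le]
  push_cast
  linarith

end FixedQuery

/-! ### Averaging over the queries -/

section Average

lemma tsum_map_mul {α β : Type*} (p : PMF α) (φ : α → β) (F : β → ℝ≥0∞) :
    ∑' b, (p.map φ) b * F b = ∑' a, p a * F (φ a) := by
  simp only [PMF.map_apply, ← ENNReal.tsum_mul_right]
  rw [ENNReal.tsum_comm]
  refine tsum_congr fun a => ?_
  rw [tsum_eq_single (φ a)]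
  · simp
  · intro b hb; simp [hb]

lemma tsum_mul_const_pmf {α : Type*} (p : PMF α) (c : ℝ≥0∞) : ∑' a, p a * c = c := by
  rw [ENNReal.tsum_mul_right, p.tsum_coe, one_mul]

namespace Scheme

variable {N : ℕ} {X Y : Fin N → Type*} {M L : ℕ}

lemma inputLaw_map_query (S : Scheme X Y M L) (i : Fin M) (n : Fin N) :
    (S.inputLaw i).map (fun wq => wq.2 n) = (S.queryLaw i).map fun q => q n := by
  simp only [inputLaw, PMF.map_bind, PMF.map_comp, Function.comp_def, PMF.bind_const]

lemma IsPrivate.query_eq {S : Scheme X Y M L} (h : S.IsPrivate) (n : Fin N) (i j : Fin M) :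
    (S.queryLaw i).map (fun q => q n) = (S.queryLaw j).map fun q => q n := by
  have := congrArg (PMF.map Prod.fst) (h n i j)
  simp only [PMF.map_comp, Function.comp_def] at this
  rwa [inputLaw_map_query, inputLaw_map_query] at this

variable [∀ n, Fintype (Y n)]

/-- The conditional error probability given the queries `q`. -/
def errorGiven (S : Scheme X Y M L) (W : ∀ n, X n → PMF (Y n)) (i : Fin M)
    (q : ∀ n, S.Query n) : ℝ≥0∞ :=
  ∑ w, (Fintype.card (Messages M L) : ℝ≥0∞)⁻¹ *
    ∑ y, if S.decode i q y ≠ w i then noisyLaw W S.len (fun n => S.answer n w (q n)) y else 0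

lemma errorProb_eq (S : Scheme X Y M L) (W : ∀ n, X n → PMF (Y n)) (i : Fin M) :
    S.errorProb W i = ∑' q, S.queryLaw i q * S.errorGiven W i q := by
  classical
  have h : S.jointLaw W i = (S.queryLaw i).bind fun q =>
      (PMF.uniformOfFintype (Messages M L)).bind fun w =>
        (noisyLaw W S.len fun n => S.answer n w (q n)).map fun y => (w, q, y) := by
    rw [jointLaw, inputLaw, PMF.bind_bind, PMF.bind_comm]
    refine congrArg _ (funext fun w => ?_)
    rw [PMF.bind_map]
    rfl
  rw [errorProb, h, PMF.toOuterMeasure_bind_apply]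
  refine tsum_congr fun q => ?_
  rw [PMF.toOuterMeasure_bind_apply, tsum_fintype, errorGiven]
  congr 1
  refine Finset.sum_congr rfl fun w _ => ?_
  rw [PMF.uniformOfFintype_apply, PMF.toOuterMeasure_map_apply, PMF.toOuterMeasure_apply_fintype]
  congr 1
  refine Finset.sum_congr rfl fun y _ => ?_
  simp [Set.indicator_apply]

/-- The laws of the received letters, indexed by a database and a position in its answer string,
for fixed queries `q`. -/
def letterLaw (S : Scheme X Y M L) (W : ∀ n, X n → PMF (Y n)) (q : ∀ n, S.Query n)
    (w : Messages M L) (l : Σ n, Fin (S.len n)) : PMF (Y l.1) :=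
  W l.1 (S.answer l.1 w (q l.1) l.2)

/-- The letters of database `n`. -/
def letters (S : Scheme X Y M L) (n : Fin N) : Finset (Σ n, Fin (S.len n)) :=
  Finset.univ.map ⟨Sigma.mk n, sigma_mk_injective⟩

lemma mem_letters {S : Scheme X Y M L} {n : Fin N} {l : Σ n, Fin (S.len n)} :
    l ∈ S.letters n ↔ l.1 = n := by
  simp only [letters, Finset.mem_map, Finset.mem_univ, true_and, Function.Embedding.coeFn_mk]
  exact ⟨by rintro ⟨k, rfl⟩; rfl, by rintro rfl; exact ⟨l.2, rfl⟩⟩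

lemma errorGiven_toReal (S : Scheme X Y M L) (W : ∀ n, X n → PMF (Y n)) (i : Fin M)
    (q : ∀ n, S.Query n) :
    (S.errorGiven W i q).toReal =
      ∑ ω with S.decode i q (fun n k => ω.2 ⟨n, k⟩) ≠ ω.1 i, jointWeight (S.letterLaw W q) ω := by
  rw [errorGiven, ENNReal.toReal_sum, Finset.sum_filter, Fintype.sum_prod_type]
  · refine Finset.sum_congr rfl fun w _ => ?_
    rw [ENNReal.toReal_mul, ENNReal.toReal_inv, ENNReal.toReal_natCast, ENNReal.toReal_sum,
      Finset.mul_sum]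
    · rw [← (Equiv.piCurry fun n (_ : Fin (S.len n)) => Y n).sum_comp]
      refine Finset.sum_congr rfl fun y _ => ?_
      by_cases h : S.decode i q (fun n k => y ⟨n, k⟩) = w i
      · have h' : S.decode i q (Equiv.piCurry (fun n (_ : Fin (S.len n)) => Y n) y) = w i := h
        rw [if_neg (not_not.2 h), if_neg (not_not.2 h')]
        simp
      · have h' : S.decode i q (Equiv.piCurry (fun n (_ : Fin (S.len n)) => Y n) y) ≠ w i := h
        rw [if_pos h, if_pos h', jointWeight, noisyLaw, PMF.ofFintype_apply, ENNReal.toReal_prod,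
          Fintype.prod_sigma]
        simp only [ENNReal.toReal_prod]
        rfl
    · intro y _
      split_ifs
      · exact PMF.apply_ne_top _ _
      · exact ENNReal.zero_ne_top
  · intro w _
    refine ENNReal.mul_ne_top (by simp) ?_
    refine ENNReal.sum_ne_top.2 fun y _ => ?_
    split_ifs
    · exact PMF.apply_ne_top _ _
    · exact ENNReal.zero_ne_top

variable [∀ n, Fintype (X n)]

lemma condInfo_letter_le (S : Scheme X Y M L) (W : ∀ n, X n → PMF (Y n)) (q : ∀ n, S.Query n)
    {γ : Type*} [Fintype γ] (g : Messages M L → γ) (l : Σ n, Fin (S.len n)) :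
    condInfo (S.letterLaw W q) g {l} ≤ Real.log 2 * (channelCapacity (W l.1)).toReal := by
  refine (condInfo_le_const _ g _).trans ?_
  rw [condInfo_singleton (S.letterLaw W q) l (W l.1) (fun w => S.answer l.1 w (q l.1) l.2)
    fun w => rfl]
  exact mul_le_mul_of_nonneg_left (mutualInfo_le_capacity _ _) (Real.log_nonneg (by norm_num))

/-- The information in the letters of all databases is at most the one in the letters of the first
`k` databases, counted separately, plus the capacities of the other databases. -/
lemma condInfo_univ_le (S : Scheme X Y M L) (W : ∀ n, X n → PMF (Y n)) (q : ∀ n, S.Query n)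
    {γ : Type*} [Fintype γ] (g : Messages M L → γ) (k : ℕ) :
    condInfo (S.letterLaw W q) g Finset.univ ≤
      ∑ n with n.val < k, condInfo (S.letterLaw W q) g (S.letters n) +
        Real.log 2 * ∑ n with ¬ n.val < k, S.len n * (channelCapacity (W n)).toReal := by
  have h1 := condInfo_biUnion_le (S.letterLaw W q) g Finset.univ S.letters fun a _ b _ hab => by
    rw [Finset.disjoint_left]
    intro l hl hl'
    exact hab ((mem_letters.1 hl).symm.trans (mem_letters.1 hl'))
  have e1 : (Finset.univ : Finset (Fin N)).biUnion S.letters = Finset.univ := by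
    ext l; simp [mem_letters]
  rw [e1, ← Finset.sum_filter_add_sum_filter_not _ fun n : Fin N => n.val < k] at h1
  refine h1.trans (add_le_add le_rfl ?_)
  rw [Finset.mul_sum]
  refine Finset.sum_le_sum fun n _ => ?_
  have h2 := condInfo_biUnion_le (S.letterLaw W q) g (S.letters n) (fun l => {l})
    fun a _ b _ hab => by simpa using hab
  rw [Finset.biUnion_singleton_eq_self] at h2
  refine h2.trans ((Finset.sum_le_sum fun l _ => S.condInfo_letter_le W q g l).trans_eq ?_)
  have e2 : ∑ l ∈ S.letters n, Real.log 2 * (channelCapacity (W l.1)).toReal =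
      ∑ l ∈ S.letters n, Real.log 2 * (channelCapacity (W n)).toReal :=
    Finset.sum_congr rfl fun l hl => by rw [mem_letters.1 hl]
  have e3 : (S.letters n).card = S.len n := by simp [letters]
  rw [e2, Finset.sum_const, e3, nsmul_eq_mul]
  ring

/-- The average, over the queries for message `m`, of the information in all received letters about
the messages with index at least `i`, given the others. -/
def avgInfo (S : Scheme X Y M L) (W : ∀ n, X n → PMF (Y n)) (m : Fin M) (i : ℕ) : ℝ≥0∞ :=
  ∑' q, S.queryLaw m q *
    ENNReal.ofReal (condInfo (S.letterLaw W q) (firstMessages i) Finset.univ)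

/-- The induction step of the converse: by privacy, the letters of one database carry the same
information about the messages from `m` on whether message `m` or message `m'` is wanted. -/
lemma avgInfo_step {S : Scheme X Y M L} (hS : S.IsPrivate) (W : ∀ n, X n → PMF (Y n))
    (m m' : Fin M) {k : ℕ} (hk : k ≤ N) :
    ENNReal.ofReal (L * Real.log 2) + S.avgInfo W m (m.val + 1) ≤
      k * S.avgInfo W m' m.val +
        ENNReal.ofReal
          (Real.log 2 * ∑ n with ¬ n.val < k, S.len n * (channelCapacity (W n)).toReal) +
        (ENNReal.ofReal (Real.log 2) + S.errorProb W m * ENNReal.ofReal (L * Real.log 2)) := by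
  classical
  have hlog : 0 ≤ Real.log 2 := Real.log_nonneg (by norm_num)
  set θ := Real.log 2 * ∑ n with ¬ n.val < k, S.len n * (channelCapacity (W n)).toReal
  have hθ : 0 ≤ θ := by positivity
  have hfix : ∀ q, ENNReal.ofReal (L * Real.log 2) +
      ENNReal.ofReal (condInfo (S.letterLaw W q) (firstMessages (m.val + 1)) Finset.univ) ≤
      ∑ n with n.val < k,
        ENNReal.ofReal (condInfo (S.letterLaw W q) (firstMessages m.val) (S.letters n)) +
      ENNReal.ofReal θ + (ENNReal.ofReal (Real.log 2) +
        S.errorGiven W m q * ENNReal.ofReal (L * Real.log 2)) := by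
    intro q
    have h1 := condInfo_firstMessages (S.letterLaw W q) m
      fun y => S.decode m q fun n k => y ⟨n, k⟩
    rw [← errorGiven_toReal] at h1
    have h2 := S.condInfo_univ_le W q (firstMessages m.val) k
    have hne : S.errorGiven W m q ≠ ⊤ := by
      refine ENNReal.sum_ne_top.2 fun w _ => ENNReal.mul_ne_top (by simp) ?_
      refine ENNReal.sum_ne_top.2 fun y _ => ?_
      split_ifs
      · exact PMF.apply_ne_top _ _
      · exact ENNReal.zero_ne_top
    have h3 : ∀ n ∈ Finset.univ.filter (fun n : Fin N => n.val < k),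
        0 ≤ condInfo (S.letterLaw W q) (firstMessages m.val) (S.letters n) :=
      fun n _ => condInfo_nonneg _ _ _
    rw [← ENNReal.ofReal_toReal hne, ← ENNReal.ofReal_mul ENNReal.toReal_nonneg,
      ← ENNReal.ofReal_add hlog (by positivity), ← ENNReal.ofReal_sum_of_nonneg h3,
      ← ENNReal.ofReal_add (Finset.sum_nonneg h3) hθ,
      ← ENNReal.ofReal_add (add_nonneg (Finset.sum_nonneg h3) hθ) (by positivity),
      ← ENNReal.ofReal_add (by positivity) (condInfo_nonneg _ _ _)]
    exact ENNReal.ofReal_le_ofReal (by linarith)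
  have hsum := ENNReal.tsum_le_tsum fun q => mul_le_mul_right (hfix q) (S.queryLaw m q)
  simp only [mul_add, ENNReal.tsum_add, tsum_mul_const_pmf, Finset.mul_sum] at hsum
  refine hsum.trans ?_
  have herr : ∑' q, S.queryLaw m q * (S.errorGiven W m q * ENNReal.ofReal (L * Real.log 2)) =
      S.errorProb W m * ENNReal.ofReal (L * Real.log 2) := by
    rw [errorProb_eq, ← ENNReal.tsum_mul_right]
    exact tsum_congr fun q => (mul_assoc _ _ _).symm
  rw [herr]
  refine add_le_add (add_le_add ?_ le_rfl) le_rfl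
  rw [Summable.tsum_finsetSum fun _ _ => ENNReal.summable]
  have hn : ∀ n : Fin N, ∑' q, S.queryLaw m q *
      ENNReal.ofReal (condInfo (S.letterLaw W q) (firstMessages m.val) (S.letters n)) ≤
      S.avgInfo W m' m.val := by
    intro n
    by_cases hne : Nonempty (∀ n, S.Query n)
    · obtain ⟨q₀⟩ := hne
      have e : ∀ q : ∀ n, S.Query n,
          condInfo (S.letterLaw W q) (firstMessages m.val) (S.letters n) =
          condInfo (S.letterLaw W (Function.update q₀ n (q n))) (firstMessages m.val)
            (S.letters n) := by
        intro q
        refine condInfo_congr _ fun w l hl => ?_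
        obtain rfl := mem_letters.1 hl
        simp [letterLaw]
      calc _ = ∑' q, S.queryLaw m q * ENNReal.ofReal (condInfo
              (S.letterLaw W (Function.update q₀ n (q n))) (firstMessages m.val) (S.letters n)) :=
            tsum_congr fun q => by rw [e q]
        _ = ∑' q, S.queryLaw m' q * ENNReal.ofReal (condInfo
              (S.letterLaw W (Function.update q₀ n (q n))) (firstMessages m.val) (S.letters n)) := by
            rw [← tsum_map_mul (S.queryLaw m) (fun q => q n) fun a => ENNReal.ofReal (condInfo
              (S.letterLaw W (Function.update q₀ n a)) (firstMessages m.val) (S.letters n)),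
              hS.query_eq n m m', tsum_map_mul]
        _ ≤ _ := ENNReal.tsum_le_tsum fun q => mul_le_mul_right
            (ENNReal.ofReal_le_ofReal ((e q).symm.trans_le
              (condInfo_mono _ _ (Finset.subset_univ _)))) _
    · have : IsEmpty (∀ n, S.Query n) := not_nonempty_iff.1 hne
      simp
  refine (Finset.sum_le_sum fun n _ => hn n).trans ?_
  rw [Finset.sum_const, nsmul_eq_mul]
  refine mul_le_mul_left ?_ _
  have : (Finset.univ.filter fun n : Fin N => n.val < k).card = k := by
    rw [← Fintype.card_subtype, Fintype.card_fin_lt_of_le hk]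
  rw [this]

end Scheme

end Average

/-! ### The converse bounds on achievable rates -/

section Converse

namespace Scheme

variable {N : ℕ} {X Y : Fin N → Type*} {M L : ℕ} [∀ n, Fintype (Y n)]

lemma errorProb_le_one (S : Scheme X Y M L) (W : ∀ n, X n → PMF (Y n)) (i : Fin M) :
    S.errorProb W i ≤ 1 := by
  rw [errorProb, PMF.toOuterMeasure_apply, ← (S.jointLaw W i).tsum_coe]
  exact ENNReal.tsum_le_tsum fun ω => Set.indicator_le_self _ _ ω

variable [∀ n, Fintype (X n)]

/-- The answer lengths weighted with the capacities of the databases numbered above `k`. -/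
def tailCapacity (S : Scheme X Y M L) (W : ∀ n, X n → PMF (Y n)) (k : ℕ) : ℝ :=
  ∑ n with ¬ n.val < k, S.len n * (channelCapacity (W n)).toReal

/-- The average information of `avgInfo` about the messages after `m`, in bits. -/
def remInfo (S : Scheme X Y M L) (W : ∀ n, X n → PMF (Y n)) (m : Fin M) : ℝ :=
  (S.avgInfo W m (m.val + 1)).toReal / Real.log 2

lemma remInfo_nonneg (S : Scheme X Y M L) (W : ∀ n, X n → PMF (Y n)) (m : Fin M) :
    0 ≤ S.remInfo W m :=
  div_nonneg ENNReal.toReal_nonneg (Real.log_nonneg (by norm_num))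

lemma tailCapacity_nonneg (S : Scheme X Y M L) (W : ∀ n, X n → PMF (Y n)) (k : ℕ) :
    0 ≤ S.tailCapacity W k :=
  Finset.sum_nonneg fun _ _ => mul_nonneg (Nat.cast_nonneg _) ENNReal.toReal_nonneg

lemma avgInfo_ne_top {S : Scheme X Y M L} (hS : S.IsPrivate) (W : ∀ n, X n → PMF (Y n))
    (m : Fin M) : S.avgInfo W m (m.val + 1) ≠ ⊤ := by
  have h := (le_add_self).trans (S.avgInfo_step hS W m m (Nat.zero_le N))
  refine (h.trans_lt ?_).ne
  have := ((S.errorProb_le_one W m).trans_lt ENNReal.one_lt_top).ne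
  rw [Nat.cast_zero, zero_mul, zero_add]
  exact ENNReal.add_lt_top.2 ⟨ENNReal.ofReal_lt_top, ENNReal.add_lt_top.2
    ⟨ENNReal.ofReal_lt_top, ENNReal.mul_lt_top this.lt_top ENNReal.ofReal_lt_top⟩⟩

lemma remInfo_step {S : Scheme X Y M L} (hS : S.IsPrivate) (W : ∀ n, X n → PMF (Y n))
    (m m' : Fin M) {k : ℕ} (hk : k ≤ N) (h : k = 0 ∨ m.val = m'.val + 1) :
    L + S.remInfo W m ≤ k * S.remInfo W m' + S.tailCapacity W k +
      (1 + (S.errorProb W m).toReal * L) := by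
  have hlog : 0 < Real.log 2 := Real.log_pos (by norm_num)
  have hstep := S.avgInfo_step hS W m m' hk
  have hP := ((S.errorProb_le_one W m).trans_lt ENNReal.one_lt_top).ne
  have e : (k : ℝ≥0∞) * S.avgInfo W m' m.val =
      ENNReal.ofReal (k * (S.remInfo W m' * Real.log 2)) := by
    rcases h with rfl | h
    · simp
    · rw [h, remInfo, div_mul_cancel₀ _ hlog.ne', ENNReal.ofReal_mul (Nat.cast_nonneg k),
        ENNReal.ofReal_toReal (avgInfo_ne_top hS W m'), ENNReal.ofReal_natCast]
  have e2 : S.avgInfo W m (m.val + 1) = ENNReal.ofReal (S.remInfo W m * Real.log 2) := by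
    rw [remInfo, div_mul_cancel₀ _ hlog.ne', ENNReal.ofReal_toReal (avgInfo_ne_top hS W m)]
  have h1 := S.remInfo_nonneg W m
  have h2 := S.remInfo_nonneg W m'
  have h3 := S.tailCapacity_nonneg W k
  rw [e, e2, ← ENNReal.ofReal_toReal hP, ← ENNReal.ofReal_mul ENNReal.toReal_nonneg,
    ← tailCapacity, ← ENNReal.ofReal_add (by positivity) (by positivity),
    ← ENNReal.ofReal_add (by positivity) (by positivity),
    ← ENNReal.ofReal_add (by positivity) (by positivity),
    ← ENNReal.ofReal_add (by positivity) (by positivity),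
    ENNReal.ofReal_le_ofReal_iff (by positivity)] at hstep
  have : (L + S.remInfo W m) * Real.log 2 ≤ (k * S.remInfo W m' + S.tailCapacity W k +
      (1 + (S.errorProb W m).toReal * L)) * Real.log 2 := by linarith
  exact le_of_mul_le_mul_right this hlog

end Scheme

variable {N : ℕ} {X Y : Fin N → Type*} {M : ℕ} [∀ n, Fintype (Y n)]

/-- A bound on the message length, linear in the answer lengths and up to an error that is
negligible for reliable schemes, gives a bound on the rate. -/
lemma rate_le_of_length_le (W : ∀ n, X n → PMF (Y n)) {τ : Fin N → ℝ} (hτ : τ ∈ stdSimplex ℝ (Fin N))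
    {R : ℝ≥0∞} (S : ∀ L : ℕ, Scheme X Y M L)
    (herr : ∀ i : Fin M, Tendsto (fun L => (S L).errorProb W i) atTop (𝓝 0))
    (hlen : ∀ n, Tendsto (fun L => ((S L).len n : ℝ) / ∑ j, ((S L).len j : ℝ)) atTop (𝓝 (τ n)))
    (hR : Tendsto (fun L : ℕ => (L : ℝ≥0∞) / ∑ n, ((S L).len n : ℝ≥0∞)) atTop (𝓝 R))
    {A c : ℝ} (hA : 0 < A) (a : Fin N → ℝ)
    (h : ∀ L, A * L ≤ ∑ n, a n * (S L).len n +
      c * (1 + (∑ i, ((S L).errorProb W i).toReal) * L)) :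
    R ≤ ENNReal.ofReal ((∑ n, a n * τ n) / A) := by
  set T : ℕ → ℝ := fun L => ∑ j, ((S L).len j : ℝ) with hTdef
  have hT0 : ∀ L, 0 ≤ T L := fun L => Finset.sum_nonneg fun _ _ => Nat.cast_nonneg _
  have hsum : Tendsto (fun L => ∑ n, ((S L).len n : ℝ) / T L) atTop (𝓝 1) := by
    rw [← hτ.2]; exact tendsto_finsetSum _ fun n _ => hlen n
  have hTpos : ∀ᶠ L in atTop, 0 < T L := by
    filter_upwards [hsum.eventually (lt_mem_nhds zero_lt_one)] with L hL
    refine (hT0 L).lt_of_ne fun h0 => ?_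
    simp [← h0] at hL
  have hG : Tendsto (fun L => ∑ n, a n * (((S L).len n : ℝ) / T L)) atTop (𝓝 (∑ n, a n * τ n)) :=
    tendsto_finsetSum _ fun n _ => (hlen n).const_mul _
  have hε : Tendsto (fun L : ℕ => c * ((L : ℝ)⁻¹ + ∑ i, ((S L).errorProb W i).toReal)) atTop
      (𝓝 0) := by
    have h1 : Tendsto (fun L : ℕ => ∑ i, ((S L).errorProb W i).toReal) atTop
        (𝓝 (∑ _i : Fin M, (0 : ℝ))) :=
      tendsto_finsetSum _ fun i _ =>
        (ENNReal.tendsto_toReal ENNReal.zero_ne_top).comp (herr i)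
    have h2 := ((tendsto_inv_atTop_nhds_zero_nat (𝕜 := ℝ)).add h1).const_mul c
    simpa using h2
  have hAε := hε.const_sub A
  rw [sub_zero] at hAε
  have hlim := (ENNReal.continuous_ofReal.tendsto _).comp (hG.div hAε hA.ne')
  refine le_of_tendsto_of_tendsto hR hlim ?_
  filter_upwards [hTpos, hAε.eventually (lt_mem_nhds hA), eventually_gt_atTop 0] with L hT hpos hL
  have hL' : (0 : ℝ) < L := by exact_mod_cast hL
  have e : (L : ℝ≥0∞) / ∑ n, ((S L).len n : ℝ≥0∞) = ENNReal.ofReal (L / T L) := by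
    rw [ENNReal.ofReal_div_of_pos hT, ENNReal.ofReal_natCast, hTdef,
      ENNReal.ofReal_sum_of_nonneg fun _ _ => Nat.cast_nonneg _]
    simp
  rw [e]
  refine ENNReal.ofReal_le_ofReal ?_
  simp only [Pi.div_apply]
  rw [le_div_iff₀ hpos]
  have e2 : ∑ n, a n * (((S L).len n : ℝ) / T L) = (∑ n, a n * (S L).len n) / T L := by
    rw [Finset.sum_div]; exact Finset.sum_congr rfl fun n _ => by ring
  rw [e2, div_mul_eq_mul_div, div_le_div_iff_of_pos_right hT]
  have := h L
  have e3 : (L : ℝ) * (A - c * ((L : ℝ)⁻¹ + ∑ i, ((S L).errorProb W i).toReal)) =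
      A * L - c * (1 + (∑ i, ((S L).errorProb W i).toReal) * L) := by
    field_simp
  rw [e3]
  linarith

variable [∀ n, Fintype (X n)]

lemma sum_tail_eq {N : ℕ} (k : ℕ) (f g : Fin N → ℝ) :
    ∑ n with ¬ n.val < k, f n * g n = ∑ n, (if n.val < k then 0 else g n) * f n := by
  rw [Finset.sum_filter]
  exact Finset.sum_congr rfl fun n _ => by split_ifs <;> simp_all [mul_comm]

lemma toReal_le_of_le_ofReal {R : ℝ≥0∞} {A G : ℝ} (hA : 0 < A) (hG : 0 ≤ G)
    (h : R ≤ ENNReal.ofReal (G / A)) : R ≠ ⊤ ∧ A * R.toReal ≤ G := by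
  refine ⟨(h.trans_lt ENNReal.ofReal_lt_top).ne, ?_⟩
  have := ENNReal.toReal_mono ENNReal.ofReal_ne_top h
  rw [ENNReal.toReal_ofReal (div_nonneg hG hA.le), le_div_iff₀ hA] at this
  linarith

lemma converse_two (W : ∀ n, X n → PMF (Y n)) {τ : Fin N → ℝ} (hτ : τ ∈ stdSimplex ℝ (Fin N))
    {R : ℝ≥0∞} (hR : Achievable W 2 τ R) {k : ℕ} (hk : k ≤ N) :
    R ≠ ⊤ ∧ (k + 1) * R.toReal ≤
      k * ∑ n, τ n * (channelCapacity (W n)).toReal +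
        ∑ n with ¬ n.val < k, τ n * (channelCapacity (W n)).toReal := by
  obtain ⟨S, hpriv, herr, hlen, hlim⟩ := hR
  set C : Fin N → ℝ := fun n => (channelCapacity (W n)).toReal with hC
  have hC0 : ∀ n, 0 ≤ C n := fun n => ENNReal.toReal_nonneg
  have key := rate_le_of_length_le W hτ S herr hlen hlim (A := k + 1) (c := k + 1) (by positivity)
    (fun n => k * C n + if n.val < k then 0 else C n) ?_
  · refine toReal_le_of_le_ofReal (by positivity) (add_nonneg (mul_nonneg (by positivity) ?_) ?_) ?_
    · exact Finset.sum_nonneg fun n _ => mul_nonneg (hτ.1 n) (hC0 n)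
    · exact Finset.sum_nonneg fun n _ => mul_nonneg (hτ.1 n) (hC0 n)
    · refine key.trans_eq ?_
      rw [sum_tail_eq, Finset.mul_sum, ← Finset.sum_add_distrib]
      congr 2
      exact Finset.sum_congr rfl fun n _ => by ring
  · intro L
    have h0 := (S L).remInfo_step (hpriv L) W 0 0 (Nat.zero_le N) (Or.inl rfl)
    have h1 := (S L).remInfo_step (hpriv L) W 1 0 hk (Or.inr rfl)
    have hr := (S L).remInfo_nonneg W 1
    simp only [Scheme.tailCapacity, sum_tail_eq] at h0 h1
    simp only [add_mul, Finset.sum_add_distrib, mul_assoc, ← Finset.mul_sum, Fin.sum_univ_two]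
    simp only [not_lt_zero, if_false, Nat.cast_zero, zero_mul, zero_add] at h0
    have hp0 : 0 ≤ ((S L).errorProb W 0).toReal * L := by positivity
    have hp1 : 0 ≤ ((S L).errorProb W 1).toReal * L := by positivity
    have hk0 : (0 : ℝ) ≤ k := Nat.cast_nonneg k
    have h0' := mul_le_mul_of_nonneg_left h0 hk0
    nlinarith [mul_nonneg hk0 hp1]

lemma converse_three (W : ∀ n, X n → PMF (Y n)) {τ : Fin N → ℝ} (hτ : τ ∈ stdSimplex ℝ (Fin N))
    {R : ℝ≥0∞} (hR : Achievable W 3 τ R) {k₁ k₂ : ℕ} (hk₁ : k₁ ≤ N) (hk₂ : k₂ ≤ N) :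
    R ≠ ⊤ ∧ (k₂ * k₁ + k₂ + 1) * R.toReal ≤
      k₂ * k₁ * ∑ n, τ n * (channelCapacity (W n)).toReal +
        k₂ * ∑ n with ¬ n.val < k₁, τ n * (channelCapacity (W n)).toReal +
          ∑ n with ¬ n.val < k₂, τ n * (channelCapacity (W n)).toReal := by
  obtain ⟨S, hpriv, herr, hlen, hlim⟩ := hR
  set C : Fin N → ℝ := fun n => (channelCapacity (W n)).toReal with hC
  have hC0 : ∀ n, 0 ≤ C n := fun n => ENNReal.toReal_nonneg
  have key := rate_le_of_length_le W hτ S herr hlen hlim (A := k₂ * k₁ + k₂ + 1)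
    (c := k₂ * k₁ + k₂ + 1) (by positivity)
    (fun n => k₂ * k₁ * C n + k₂ * (if n.val < k₁ then 0 else C n) +
      if n.val < k₂ then 0 else C n) ?_
  · have hs : ∀ s : Finset (Fin N), 0 ≤ ∑ n ∈ s, τ n * C n := fun s =>
      Finset.sum_nonneg fun n _ => mul_nonneg (hτ.1 n) (hC0 n)
    have h1 := hs Finset.univ
    have h2 := hs (Finset.univ.filter fun n => ¬ n.val < k₁)
    have h3 := hs (Finset.univ.filter fun n => ¬ n.val < k₂)
    refine toReal_le_of_le_ofReal (by positivity) (by positivity) ?_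
    refine key.trans_eq ?_
    rw [sum_tail_eq, sum_tail_eq, Finset.mul_sum, Finset.mul_sum, ← Finset.sum_add_distrib,
      ← Finset.sum_add_distrib]
    congr 2
    exact Finset.sum_congr rfl fun n _ => by ring
  · intro L
    have h0 := (S L).remInfo_step (hpriv L) W 0 0 (Nat.zero_le N) (Or.inl rfl)
    have h1 := (S L).remInfo_step (hpriv L) W 1 0 hk₁ (Or.inr rfl)
    have h2 := (S L).remInfo_step (hpriv L) W 2 1 hk₂ (Or.inr rfl)
    have hr := (S L).remInfo_nonneg W 2
    simp only [Scheme.tailCapacity, sum_tail_eq] at h0 h1 h2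
    simp only [add_mul, Finset.sum_add_distrib, mul_assoc, ← Finset.mul_sum, Fin.sum_univ_three]
    simp only [not_lt_zero, if_false, Nat.cast_zero, zero_mul, zero_add] at h0
    have hp0 : 0 ≤ ((S L).errorProb W 0).toReal * L := by positivity
    have hp1 : 0 ≤ ((S L).errorProb W 1).toReal * L := by positivity
    have hp2 : 0 ≤ ((S L).errorProb W 2).toReal * L := by positivity
    have hk1 : (0 : ℝ) ≤ k₁ := Nat.cast_nonneg k₁
    have hk2 : (0 : ℝ) ≤ k₂ := Nat.cast_nonneg k₂
    have h0' := mul_le_mul_of_nonneg_left h0 (mul_nonneg hk2 hk1)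
    have h1' := mul_le_mul_of_nonneg_left h1 hk2
    have a1 := mul_nonneg (mul_nonneg hk2 hk1) hp1
    have a2 := mul_nonneg (mul_nonneg hk2 hk1) hp2
    have a3 := mul_nonneg hk2 hp0
    have a4 := mul_nonneg hk2 hp2
    linarith

end Converse

/-! ### Channel coding with small maximal error -/

section ChannelCoding

/-- Feinstein's lemma. The codewords are chosen greedily: as long as the decoding sets `D m` used so
far are jointly unlikely under the output law `q`, some input `x` still has a typical set `G x` that
is likely outside of them. -/
lemma feinstein {A B Code : Type*} [Fintype A] [Fintype B] [DecidableEq B] [DecidableEq Code]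
    {p : A → ℝ} (hp : p ∈ stdSimplex ℝ A) {V : A → B → ℝ} (hV : ∀ a, V a ∈ stdSimplex ℝ B)
    (G : A → Finset B) {θ δ ε : ℝ} (hθ : 0 ≤ θ)
    (hG : ∀ a, ∀ b ∈ G a, ∑ a', p a' * V a' b ≤ θ * V a b)
    (hδ : ∑ a, p a * ∑ b ∈ (G a)ᶜ, V a b ≤ δ) (s : Finset Code) (hs : δ + s.card * θ ≤ ε) :
    ∃ (enc : Code → A) (D : Code → Finset B),
      (∀ m ∈ s, ∀ m' ∈ s, m ≠ m' → Disjoint (D m) (D m')) ∧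
      (∀ m ∈ s, D m ⊆ G (enc m)) ∧ ∀ m ∈ s, 1 - ε ≤ ∑ b ∈ D m, V (enc m) b := by
  induction s using Finset.induction_on with
  | empty =>
    have : Nonempty A := by
      by_contra h
      have : IsEmpty A := not_nonempty_iff.1 h
      simpa using hp.2
    exact ⟨fun _ => Classical.arbitrary A, fun _ => ∅, by simp, by simp, by simp⟩
  | insert m s hm ih =>
    rw [Finset.card_insert_of_notMem hm] at hs
    push_cast at hs
    obtain ⟨enc, D, hdis, hDG, hD⟩ := ih (by linarith)
    set U := s.biUnion D
    have hqU : ∑ a, p a * ∑ b ∈ U, V a b ≤ s.card * θ := by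
      have e : ∑ a, p a * ∑ b ∈ U, V a b = ∑ b ∈ U, ∑ a, p a * V a b := by
        simp only [Finset.mul_sum]
        exact Finset.sum_comm
      rw [e, Finset.sum_biUnion hdis, ← nsmul_eq_mul, ← Finset.sum_const]
      refine Finset.sum_le_sum fun m' hm' => ?_
      calc ∑ b ∈ D m', ∑ a, p a * V a b ≤ ∑ b ∈ D m', θ * V (enc m') b :=
            Finset.sum_le_sum fun b hb => hG _ _ (hDG m' hm' hb)
        _ = θ * ∑ b ∈ D m', V (enc m') b := (Finset.mul_sum _ _ _).symm
        _ ≤ θ * 1 := by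
            refine mul_le_mul_of_nonneg_left ?_ hθ
            rw [← (hV (enc m')).2]
            exact Finset.sum_le_sum_of_subset_of_nonneg (Finset.subset_univ _)
              fun b _ _ => (hV _).1 b
        _ = θ := mul_one θ
    obtain ⟨a, ha⟩ : ∃ a, 1 - ε ≤ ∑ b ∈ G a \ U, V a b := by
      by_contra hcon
      push Not at hcon
      have hsplit : ∀ a, 1 - ∑ b ∈ (G a)ᶜ, V a b - ∑ b ∈ U, V a b ≤ ∑ b ∈ G a \ U, V a b := by
        intro a
        have h1 := Finset.sum_add_sum_compl (G a) (V a)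
        rw [(hV a).2] at h1
        have h2 := Finset.sum_inter_add_sum_sdiff (G a) U (V a)
        have h3 : ∑ b ∈ G a ∩ U, V a b ≤ ∑ b ∈ U, V a b :=
          Finset.sum_le_sum_of_subset_of_nonneg Finset.inter_subset_right fun b _ _ => (hV a).1 b
        linarith
      have h4 : ∑ a, p a * (1 - ∑ b ∈ (G a)ᶜ, V a b - ∑ b ∈ U, V a b) < ∑ a, p a * (1 - ε) := by
        refine Finset.sum_lt_sum (fun a _ => mul_le_mul_of_nonneg_left
          ((hsplit a).trans (hcon a).le) (hp.1 a)) ?_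
        obtain ⟨a, ha⟩ : ∃ a, p a ≠ 0 := by
          by_contra h0
          push Not at h0
          have := hp.2
          simp [h0] at this
        exact ⟨a, Finset.mem_univ _, mul_lt_mul_of_pos_left ((hsplit a).trans_lt (hcon a))
          ((hp.1 a).lt_of_ne ha.symm)⟩
      simp only [mul_sub, mul_one, Finset.sum_sub_distrib, hp.2, ← Finset.sum_mul, one_mul] at h4
      linarith
    refine ⟨Function.update enc m a, Function.update D m (G a \ U), ?_, ?_, ?_⟩
    · have hne : ∀ m' ∈ s, m' ≠ m := fun m' h h' => hm (h' ▸ h)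
      have hU : ∀ m' ∈ s, Disjoint (G a \ U) (D m') := fun m' h =>
        Finset.disjoint_of_subset_right (Finset.subset_biUnion_of_mem D h) Finset.sdiff_disjoint
      intro m₁ h₁ m₂ h₂ h12
      rcases Finset.mem_insert.1 h₁ with e₁ | k₁ <;> rcases Finset.mem_insert.1 h₂ with e₂ | k₂
      · exact absurd (e₁.trans e₂.symm) h12
      · rw [e₁, Function.update_self, Function.update_of_ne (hne _ k₂)]
        exact hU _ k₂
      · rw [e₂, Function.update_self, Function.update_of_ne (hne _ k₁)]
        exact (hU _ k₁).symm
      · rw [Function.update_of_ne (hne _ k₁), Function.update_of_ne (hne _ k₂)]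
        exact hdis _ k₁ _ k₂ h12
    · intro m' h
      rcases Finset.mem_insert.1 h with rfl | h
      · simp
      · have : m' ≠ m := fun h' => hm (h' ▸ h)
        simpa [Function.update_of_ne this] using hDG m' h
    · intro m' h
      rcases Finset.mem_insert.1 h with rfl | h
      · simpa using ha
      · have : m' ≠ m := fun h' => hm (h' ▸ h)
        simpa [Function.update_of_ne this] using hD m' h

lemma sum_sum_prod_pow {A B : Type*} [Fintype A] [Fintype B] (F : A → B → ℝ) (t : ℕ) :
    ∑ x : Fin t → A, ∑ y : Fin t → B, ∏ η, F (x η) (y η) = (∑ a, ∑ b, F a b) ^ t := by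
  have h1 : ∀ x : Fin t → A, ∑ y : Fin t → B, ∏ η, F (x η) (y η) = ∏ η, ∑ b, F (x η) b :=
    fun x => (Fintype.prod_sum fun η b => F (x η) b).symm
  simp only [h1]
  rw [← Fintype.prod_sum fun (_ : Fin t) a => ∑ b, F a b]
  simp

/-- An exponential tilt of small positive parameter has total mass below one if the mean of the
exponent is negative. -/
lemma exists_tilt_lt_one {κ : Type*} [Fintype κ] {c h : κ → ℝ} (hc : ∑ z, c z = 1)
    (hneg : ∑ z, c z * h z < 0) : ∃ s > 0, ∑ z, c z * Real.exp (s * h z) < 1 := by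
  have hd : HasDerivAt (fun s : ℝ => ∑ z, c z * Real.exp (s * h z)) (∑ z, c z * h z) 0 := by
    refine HasDerivAt.fun_sum fun z _ => ?_
    have := (((hasDerivAt_id (0 : ℝ)).mul_const (h z)).exp).const_mul (c z)
    simpa using this
  have ht := hd.tendsto_slope_zero_right
  have hev := (ht.eventually (gt_mem_nhds hneg)).and self_mem_nhdsWithin
  obtain ⟨s, hs, hs0⟩ := hev.exists
  refine ⟨s, hs0, ?_⟩
  have hs0 : 0 < s := hs0
  simp only [zero_add, zero_mul, Real.exp_zero, mul_one, hc, smul_eq_mul] at hs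
  have := (mul_neg_iff.1 hs).resolve_right (fun h => absurd h.1 (not_lt.2 (inv_pos.2 hs0).le))
  linarith

/-- Shannon's channel coding theorem: at rates `r` below the mutual information there are block codes
whose maximal error probability tends to zero with the block length `t`. -/
lemma channel_coding {X Y : Type*} [Fintype X] [Fintype Y] (K : X → PMF Y) (p : PMF X) {r : ℝ}
    (hr : r < mutualInfo p K) :
    ∃ err : ℕ → ℝ, Tendsto err atTop (𝓝 0) ∧
      ∀ (t : ℕ) (Code : Type) [Fintype Code] [Nonempty Code],
        (Fintype.card Code : ℝ) ≤ (2 : ℝ) ^ (r * t) →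
        ∃ (enc : Code → Fin t → X) (D : Code → Finset (Fin t → Y)) (dec : (Fin t → Y) → Code),
          (∀ m, ∀ y ∈ D m, dec y = m) ∧
          ∀ m, 1 - err t ≤ ∑ y ∈ D m, ∏ η, (K (enc m η) (y η)).toReal := by
  classical
  obtain ⟨a, hra, haI⟩ := exists_between hr
  have hlog : 0 < Real.log 2 := Real.log_pos (by norm_num)
  set q : Y → ℝ := fun b => ((p.bind K) b).toReal with hq
  set V : X → Y → ℝ := fun x b => (K x b).toReal with hVdef
  set P : X → ℝ := fun x => (p x).toReal with hPdef
  have hV0 : ∀ x b, 0 ≤ V x b := fun _ _ => ENNReal.toReal_nonneg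
  have hP0 : ∀ x, 0 ≤ P x := fun _ => ENNReal.toReal_nonneg
  have hqsum : ∀ b, q b = ∑ x, P x * V x b := by
    intro b
    simp only [hq, hPdef, hVdef, PMF.bind_apply, tsum_fintype]
    rw [ENNReal.toReal_sum fun a _ => ENNReal.mul_ne_top (p.apply_ne_top a) ((K a).apply_ne_top b)]
    simp only [ENNReal.toReal_mul]
  have hqpos : ∀ x b, 0 < P x * V x b → 0 < q b := fun x b h => by
    rw [hqsum]
    exact h.trans_le (Finset.single_le_sum (f := fun x => P x * V x b)
      (fun x _ => mul_nonneg (hP0 x) (hV0 x b)) (Finset.mem_univ x))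
  -- `h` is the excess of the threshold `a` over the information density
  set h : X × Y → ℝ := fun z => a * Real.log 2 - Real.log (V z.1 z.2 / q z.2) with hh
  set c : X × Y → ℝ := fun z => P z.1 * V z.1 z.2 with hcdef
  have hc1 : ∑ z, c z = 1 := by
    simp only [hcdef, Fintype.sum_prod_type, ← Finset.mul_sum, hVdef, hPdef, pmf_sum_toReal,
      mul_one]
  have hneg : ∑ z, c z * h z < 0 := by
    have e : ∑ z, c z * h z = (a - mutualInfo p K) * Real.log 2 := by
      simp only [hh, mul_sub, Finset.sum_sub_distrib, ← Finset.sum_mul, hc1, one_mul, sub_mul]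
      congr 1
      rw [mutualInfo, Fintype.sum_prod_type, Finset.sum_mul]
      refine Finset.sum_congr rfl fun x _ => ?_
      rw [Finset.sum_mul]
      refine Finset.sum_congr rfl fun b _ => ?_
      rw [Real.logb, mul_assoc _ (_ / _), div_mul_cancel₀ _ hlog.ne']
    rw [e]
    exact mul_neg_of_neg_of_pos (by linarith) hlog
  obtain ⟨s, hs, hβ⟩ := exists_tilt_lt_one hc1 hneg
  set β := ∑ z, c z * Real.exp (s * h z) with hβdef
  have hc0 : ∀ z, 0 ≤ c z := fun z => mul_nonneg (hP0 _) (hV0 _ _)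
  have hβ0 : 0 ≤ β := Finset.sum_nonneg fun z _ => mul_nonneg (hc0 z) (Real.exp_pos _).le
  have hκ : (2 : ℝ) ^ (r - a) < 1 := Real.rpow_lt_one_of_one_lt_of_neg (by norm_num) (by linarith)
  refine ⟨fun t => β ^ t + ((2 : ℝ) ^ (r - a)) ^ t, ?_, ?_⟩
  · have := (tendsto_pow_atTop_nhds_zero_of_lt_one hβ0 hβ).add
      (tendsto_pow_atTop_nhds_zero_of_lt_one (Real.rpow_nonneg (by norm_num) _) hκ)
    simpa using this
  intro t Code _ _ hcard
  set Pt : (Fin t → X) → ℝ := fun x => ∏ η, P (x η)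
  set Vt : (Fin t → X) → (Fin t → Y) → ℝ := fun x y => ∏ η, V (x η) (y η)
  set G : (Fin t → X) → Finset (Fin t → Y) := fun x =>
    Finset.univ.filter fun y => ∏ η, q (y η) ≤ ((2 : ℝ) ^ (-a)) ^ t * Vt x y with hG
  have hPt : Pt ∈ stdSimplex ℝ (Fin t → X) := by
    refine ⟨fun x => Finset.prod_nonneg fun η _ => hP0 _, ?_⟩
    rw [← Fintype.prod_sum fun (_ : Fin t) a => P a]
    simp [hPdef, pmf_sum_toReal]
  have hVt : ∀ x, Vt x ∈ stdSimplex ℝ (Fin t → Y) := by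
    refine fun x => ⟨fun y => Finset.prod_nonneg fun η _ => hV0 _ _, ?_⟩
    rw [← Fintype.prod_sum fun (η : Fin t) b => V (x η) b]
    simp [hVdef, pmf_sum_toReal]
  have hout : ∀ y : Fin t → Y, ∑ x, Pt x * Vt x y = ∏ η, q (y η) := by
    intro y
    simp only [hqsum, Pt, Vt, ← Finset.prod_mul_distrib]
    exact (Fintype.prod_sum fun (η : Fin t) x => P x * V x (y η)).symm
  have hδ : ∑ x, Pt x * ∑ y ∈ (G x)ᶜ, Vt x y ≤ β ^ t := by
    have e : β ^ t = ∑ x : Fin t → X, ∑ y : Fin t → Y,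
        ∏ η, (c (x η, y η) * Real.exp (s * h (x η, y η))) := by
      rw [sum_sum_prod_pow fun x b => c (x, b) * Real.exp (s * h (x, b)), hβdef,
        Fintype.sum_prod_type]
    rw [e]
    refine Finset.sum_le_sum fun x _ => ?_
    rw [Finset.mul_sum]
    have hnn : ∀ y : Fin t → Y, 0 ≤ ∏ η, (c (x η, y η) * Real.exp (s * h (x η, y η))) := fun y =>
      Finset.prod_nonneg fun η _ => mul_nonneg (hc0 _) (Real.exp_pos _).le
    refine le_trans (Finset.sum_le_sum fun y hy => ?_)
      (Finset.sum_le_sum_of_subset_of_nonneg (Finset.subset_univ _) fun y _ _ => hnn y)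
    have hy : ((2 : ℝ) ^ (-a)) ^ t * Vt x y < ∏ η, q (y η) := by
      simpa [hG] using hy
    have e2 : Pt x * Vt x y = ∏ η, c (x η, y η) := by
      simp only [Pt, Vt, hcdef, Finset.prod_mul_distrib]
    rw [Finset.prod_mul_distrib, ← e2]
    rcases (mul_nonneg (hPt.1 x) ((hVt x).1 y)).eq_or_lt with h0 | h0
    · simp [← h0]
    refine le_mul_of_one_le_right h0.le ?_
    rw [← Real.exp_sum, ← Finset.mul_sum]
    refine Real.one_le_exp (mul_nonneg hs.le ?_)
    have hcpos : ∀ η, 0 < c (x η, y η) := by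
      intro η
      refine (hc0 _).lt_of_ne fun h1 => ?_
      rw [e2, Finset.prod_eq_zero (Finset.mem_univ η) h1.symm] at h0
      exact h0.false
    have hVpos : ∀ η, 0 < V (x η) (y η) := fun η =>
      (hV0 _ _).lt_of_ne fun h1 => by have := hcpos η; simp [hcdef, ← h1] at this
    have hqpos' : ∀ η, 0 < q (y η) := fun η => hqpos _ _ (hcpos η)
    have h3 := Real.log_lt_log (mul_pos (pow_pos (Real.rpow_pos_of_pos (by norm_num) _) _)
      (Finset.prod_pos fun η _ => hVpos η)) hy
    rw [Real.log_mul (pow_pos (Real.rpow_pos_of_pos (by norm_num) _) _).ne'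
      (Finset.prod_pos fun η _ => hVpos η).ne', Real.log_pow, Real.log_rpow (by norm_num),
      Real.log_prod fun η _ => (hVpos η).ne', Real.log_prod fun η _ => (hqpos' η).ne'] at h3
    have e3 : ∑ η, h (x η, y η) = t * (a * Real.log 2) -
        (∑ η, Real.log (V (x η) (y η)) - ∑ η, Real.log (q (y η))) := by
      simp only [hh, Finset.sum_sub_distrib, Finset.sum_const, Finset.card_univ, Fintype.card_fin,
        nsmul_eq_mul, Real.log_div (hVpos _).ne' (hqpos' _).ne']
    rw [e3]
    linarith
  obtain ⟨enc, D, hdis, -, hD⟩ := feinstein (Code := Code) hPt hVt G (θ := ((2 : ℝ) ^ (-a)) ^ t)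
    (ε := β ^ t + ((2 : ℝ) ^ (r - a)) ^ t)
    (pow_nonneg (Real.rpow_nonneg (by norm_num) _) _) (fun x y hy => by
      rw [hout]; simpa [hG] using hy) hδ Finset.univ (by
      refine add_le_add le_rfl ?_
      rw [Finset.card_univ, sub_eq_add_neg, Real.rpow_add (by norm_num), mul_pow]
      refine mul_le_mul_of_nonneg_right ?_ (pow_nonneg (Real.rpow_nonneg (by norm_num) _) _)
      rwa [← Real.rpow_mul_natCast (by norm_num)])
  refine ⟨enc, D, fun y => if hy : ∃ m, y ∈ D m then hy.choose else Classical.arbitrary Code,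
    fun m y hy => ?_, fun m => hD m (Finset.mem_univ m)⟩
  have hex : ∃ m, y ∈ D m := ⟨m, hy⟩
  change (if hy : ∃ m, y ∈ D m then hy.choose else Classical.arbitrary Code) = m
  rw [dif_pos hex]
  by_contra hne
  exact Finset.disjoint_left.1 (hdis _ (Finset.mem_univ _) _ (Finset.mem_univ _) hne)
    hex.choose_spec hy

end ChannelCoding

/-! ### Retrieval schemes that send sums of randomly permuted symbols -/

section SlotSystem

/-- A combinatorial retrieval scheme. Every message consists of symbols indexed by `Sym`, and
database `n` sends, for each `σ : Slot n`, the sum over all messages `m` of the symbol number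
`index i n m σ` of message `m`, if any, where `i` is the desired message. The symbols of the messages
are understood to be permuted by private uniform permutations. -/
structure SlotSystem (N M : ℕ) where
  /-- the sums sent by database `n` -/
  Slot : Fin N → Type
  [fintypeSlot : ∀ n, Fintype (Slot n)]
  [decEqSlot : ∀ n, DecidableEq (Slot n)]
  /-- the symbols of one message -/
  Sym : Type
  [fintypeSym : Fintype Sym]
  [decEqSym : DecidableEq Sym]
  [nonemptySym : Nonempty Sym]
  /-- the symbol of message `m` in the sum `σ` of database `n`, when message `i` is desired -/
  index : Fin M → ∀ n, Fin M → Slot n → Option Sym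
  /-- up to a permutation, the symbols requested from one database do not depend on `i` -/
  exists_perm : ∀ i j n m, ∃ g : Equiv.Perm Sym, ∀ σ, index j n m σ = (index i n m σ).map g
  /-- the sums determine the desired message -/
  decodable : ∀ i (x : Fin M → Sym → ZMod 2),
    (∀ n σ, ∑ m, (index i n m σ).elim 0 (x m) = 0) → x i = 0

attribute [instance] SlotSystem.fintypeSlot SlotSystem.decEqSlot SlotSystem.fintypeSym
  SlotSystem.decEqSym SlotSystem.nonemptySym

lemma map_uniformOfFintype_equiv {α : Type*} [Fintype α] [Nonempty α] (e : α ≃ α) :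
    (PMF.uniformOfFintype α).map e = PMF.uniformOfFintype α := by
  classical
  ext a
  rw [PMF.map_apply, tsum_eq_single (e.symm a)]
  · simp
  · intro b hb
    rw [if_neg]
    rintro rfl
    simp at hb

lemma Scheme.isPrivate_of_query_eq {N : ℕ} {X Y : Fin N → Type*} {M L : ℕ} (S : Scheme X Y M L)
    (h : ∀ n i j, (S.queryLaw i).map (fun q => q n) = (S.queryLaw j).map fun q => q n) :
    S.IsPrivate := by
  intro n i j
  have e : ∀ i, (S.inputLaw i).map (fun wq => (wq.2 n, S.answer n wq.1 (wq.2 n), wq.1)) =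
      (PMF.uniformOfFintype (Messages M L)).bind fun w =>
        ((S.queryLaw i).map fun q => q n).map fun a => (a, S.answer n w a, w) := by
    intro i
    simp only [Scheme.inputLaw, PMF.map_bind, PMF.map_comp, Function.comp_def]
  rw [e, e, h n i j]

/-- If, given any messages and queries, the received letters lie with probability at least `s` in a
set on which decoding is correct, then the error probability is at most `1 - s`. -/
lemma Scheme.errorProb_le {N : ℕ} {X Y : Fin N → Type*} {M L : ℕ} [∀ n, Fintype (Y n)]
    (S : Scheme X Y M L) (W : ∀ n, X n → PMF (Y n)) (i : Fin M) (s : ℝ≥0∞)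
    (h : ∀ q, S.queryLaw i q ≠ 0 → ∀ w, ∃ U : Finset (∀ n, Fin (S.len n) → Y n),
      (∀ y ∈ U, S.decode i q y = w i) ∧
      s ≤ ∑ y ∈ U, noisyLaw W S.len (fun n => S.answer n w (q n)) y) :
    S.errorProb W i ≤ 1 - s := by
  classical
  rw [S.errorProb_eq, ← tsum_mul_const_pmf (S.queryLaw i) (1 - s)]
  refine ENNReal.tsum_le_tsum fun q => ?_
  rcases eq_or_ne (S.queryLaw i q) 0 with h0 | h0
  · simp [h0]
  refine mul_le_mul_right ?_ _
  have hw : ∀ w : Messages M L, ∑ y, (if S.decode i q y ≠ w i then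
      noisyLaw W S.len (fun n => S.answer n w (q n)) y else 0) ≤ 1 - s := by
    intro w
    obtain ⟨U, hU, hs⟩ := h q h0 w
    set p := noisyLaw W S.len (fun n => S.answer n w (q n))
    have hp : ∑ y, p y = 1 := by
      rw [← p.tsum_coe, tsum_fintype]
    rw [← Finset.sum_filter]
    have hsub : (Finset.univ.filter fun y => S.decode i q y ≠ w i) ⊆ Uᶜ := by
      intro y hy
      rw [Finset.mem_compl]
      exact fun hmem => (Finset.mem_filter.1 hy).2 (hU y hmem)
    refine (Finset.sum_le_sum_of_subset hsub).trans ?_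
    have h1 := Finset.sum_add_sum_compl U p
    rw [hp] at h1
    refine ENNReal.le_sub_of_add_le_left ?_ ?_
    · exact ((hs.trans ((Finset.sum_le_sum_of_subset (Finset.subset_univ _)).trans
        hp.le)).trans_lt ENNReal.one_lt_top).ne
    · exact (add_le_add hs le_rfl).trans h1.le
  rw [Scheme.errorGiven]
  refine (Finset.sum_le_sum fun w _ => mul_le_mul_right (hw w) _).trans_eq ?_
  rw [Finset.sum_const, Finset.card_univ, nsmul_eq_mul, ← mul_assoc, ENNReal.mul_inv_cancel,
    one_mul]
  · exact_mod_cast Fintype.card_ne_zero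
  · exact ENNReal.natCast_ne_top _

namespace SlotSystem

variable {N M : ℕ} (Q : SlotSystem N M)

/-- The queries for message `i` when the symbols of message `m` are permuted by `g m`. -/
def query (i : Fin M) (g : Fin M → Equiv.Perm Q.Sym) (n : Fin N) (m : Fin M) (σ : Q.Slot n) :
    Option Q.Sym :=
  (Q.index i n m σ).map (g m)

variable {L B : ℕ}

/-- The sums that database `n` sends upon the query `q`. A message of `L` bits is cut into symbols
of `B` bits through the embedding `e`, and padded with zeros. -/
def content (e : Fin L ↪ Q.Sym × Fin B) (n : Fin N) (w : Messages M L)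
    (q : Fin M → Q.Slot n → Option Q.Sym) (p : Q.Slot n × Fin B) : ZMod 2 :=
  ∑ m, (q m p.1).elim 0 fun a => Function.extend e (w m) 0 (a, p.2)

lemma exists_index (i : Fin M) (a : Q.Sym) : ∃ n σ, Q.index i n i σ = some a := by
  by_contra hcon
  push Not at hcon
  have := Q.decodable i (fun m b => if m = i ∧ b = a then 1 else 0) fun n σ => by
    refine Finset.sum_eq_zero fun m _ => ?_
    cases h : Q.index i n m σ with
    | none => rfl
    | some b =>
      have : ¬ (m = i ∧ b = a) := by rintro ⟨rfl, rfl⟩; exact hcon n σ h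
      simp [this]
  have h1 := congrFun this a
  simp at h1

/-- The queries and the noiseless answers determine the desired message. -/
lemma eq_of_content_eq (e : Fin L ↪ Q.Sym × Fin B) (i : Fin M) {g g' : Fin M → Equiv.Perm Q.Sym}
    {w w' : Messages M L} (hq : Q.query i g = Q.query i g')
    (h : ∀ n, Q.content e n w (Q.query i g n) = Q.content e n w' (Q.query i g' n)) :
    w i = w' i := by
  have hg : g i = g' i := by
    ext a
    obtain ⟨n, σ, hσ⟩ := Q.exists_index i a
    have := congrFun (congrFun (congrFun hq n) i) σ
    simpa [query, hσ] using this
  have key : ∀ a b, Function.extend e (w i) 0 (g i a, b) = Function.extend e (w' i) 0 (g' i a, b) := by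
    intro a b
    have := Q.decodable i (fun m a => Function.extend e (w m) 0 (g m a, b) -
      Function.extend e (w' m) 0 (g' m a, b)) fun n σ => by
        have h1 := congrFun (h n) (σ, b)
        rw [content, content, ← sub_eq_zero, ← Finset.sum_sub_distrib] at h1
        refine (Finset.sum_congr rfl fun m _ => ?_).trans h1
        cases hc : Q.index i n m σ with
        | none => simp [query, hc]
        | some c => simp [query, hc]
    exact sub_eq_zero.1 (congrFun this a)
  funext p
  have := key ((g i).symm (e p).1) (e p).2
  rw [← hg, Equiv.apply_symm_apply] at this
  rwa [e.injective.extend_apply, e.injective.extend_apply] at this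

variable {X Y : Fin N → Type*}

open Classical in
/-- The retrieval scheme of a slot system, in which database `n` encodes its sums with `enc n` and
the user recovers them with `dec n`. -/
def scheme (e : Fin L ↪ Q.Sym × Fin B) (t : Fin N → ℕ)
    (enc : ∀ n, (Q.Slot n × Fin B → ZMod 2) → Fin (t n) → X n)
    (dec : ∀ n, (Fin (t n) → Y n) → Q.Slot n × Fin B → ZMod 2) : Scheme X Y M L where
  Query n := Fin M → Q.Slot n → Option Q.Sym
  queryLaw i := (PMF.uniformOfFintype (Fin M → Equiv.Perm Q.Sym)).map (Q.query i)
  len := t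
  answer n w q := enc n (Q.content e n w q)
  decode i q y :=
    if h : ∃ w : Messages M L, ∃ g, q = Q.query i g ∧ ∀ n, dec n (y n) = Q.content e n w (q n)
    then h.choose i else 0

variable (e : Fin L ↪ Q.Sym × Fin B) (t : Fin N → ℕ)
  (enc : ∀ n, (Q.Slot n × Fin B → ZMod 2) → Fin (t n) → X n)
  (dec : ∀ n, (Fin (t n) → Y n) → Q.Slot n × Fin B → ZMod 2)

lemma scheme_isPrivate : (Q.scheme e t enc dec).IsPrivate := by
  refine Scheme.isPrivate_of_query_eq _ fun n i j => ?_
  change ((PMF.uniformOfFintype _).map (Q.query i)).map (fun q => q n) =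
    ((PMF.uniformOfFintype _).map (Q.query j)).map fun q => q n
  rw [PMF.map_comp, PMF.map_comp]
  choose γ hγ using fun m => Q.exists_perm i j n m
  rw [← map_uniformOfFintype_equiv
    (Equiv.mulRight γ : (Fin M → Equiv.Perm Q.Sym) ≃ (Fin M → Equiv.Perm Q.Sym)), PMF.map_comp]
  rw [map_uniformOfFintype_equiv]
  congr 1
  funext g m σ
  simp only [Function.comp_apply, query, hγ, Option.map_map]
  rfl

lemma scheme_decode (i : Fin M) (g : Fin M → Equiv.Perm Q.Sym) (w : Messages M L)
    (y : ∀ n, Fin (t n) → Y n)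
    (h : ∀ n, dec n (y n) = Q.content e n w (Q.query i g n)) :
    (Q.scheme e t enc dec).decode i (Q.query i g) y = w i := by
  have hex : ∃ w : Messages M L, ∃ g', Q.query i g = Q.query i g' ∧
      ∀ n, dec n (y n) = Q.content e n w (Q.query i g n) := ⟨w, g, rfl, h⟩
  simp only [scheme]
  rw [dif_pos hex]
  obtain ⟨g', hg', hw'⟩ := hex.choose_spec
  exact Q.eq_of_content_eq e i rfl fun n => (hw' n).symm.trans (h n)

/-- If the codewords of database `n` are received in their decoding sets `D n` with probability at
least `s n`, the desired message is recovered with probability at least `∏ n, s n`. -/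
lemma scheme_errorProb_le [∀ n, Fintype (Y n)] (W : ∀ n, X n → PMF (Y n)) (i : Fin M)
    (D : ∀ n, (Q.Slot n × Fin B → ZMod 2) → Finset (Fin (t n) → Y n))
    (hD : ∀ n z, ∀ y ∈ D n z, dec n y = z) (s : Fin N → ℝ≥0∞)
    (hs : ∀ n z, s n ≤ ∑ y ∈ D n z, ∏ η, W n (enc n z η) (y η)) :
    (Q.scheme e t enc dec).errorProb W i ≤ 1 - ∏ n, s n := by
  refine Scheme.errorProb_le _ W i _ fun q hq w => ?_
  obtain ⟨g, -, rfl⟩ := (PMF.mem_support_map_iff (Q.query i)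
    (PMF.uniformOfFintype (Fin M → Equiv.Perm Q.Sym)) q).1 hq
  refine ⟨Fintype.piFinset fun n => D n (Q.content e n w (Q.query i g n)), fun y hy =>
    Q.scheme_decode e t enc dec i g w y fun n => hD n _ _ (Fintype.mem_piFinset.1 hy n), ?_⟩
  refine (Finset.prod_le_prod' fun n _ => hs n (Q.content e n w (Q.query i g n))).trans_eq ?_
  rw [Finset.prod_univ_sum]
  rfl

end SlotSystem

end SlotSystem

section Achievability

/-! ### Rates achieved by a slot system with channel coding -/

lemma exists_pmf_lt_mutualInfo {X Y : Type*} [Fintype X] [Fintype Y] {K : X → PMF Y} {r : ℝ}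
    (hr : ENNReal.ofReal r < channelCapacity K) : ∃ p : PMF X, r < mutualInfo p K := by
  obtain ⟨p, hp⟩ := lt_iSup_iff.1 hr
  exact ⟨p, (ENNReal.ofReal_lt_ofReal_iff'.1 hp).1⟩

/-- Codes for the `s B` bits that a database sends for `s` sums of symbols of `B` bits, with
`⌈s B / r⌉` channel uses. A database without sums uses no channel at all. -/
lemma exists_codes {X Y : Type*} [Fintype X] [Fintype Y] [Nonempty X] (K : X → PMF Y)
    (Slot : Type) [Fintype Slot] [DecidableEq Slot] {r : ℝ}
    (hr : Nonempty Slot → 0 < r ∧ ENNReal.ofReal r < channelCapacity K)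
    (B : ℕ → ℕ) (hB : Tendsto B atTop atTop) :
    ∃ s : ℕ → ℝ≥0∞, Tendsto s atTop (𝓝 1) ∧ ∀ L,
      ∃ (enc : (Slot × Fin (B L) → ZMod 2) → Fin ⌈Fintype.card Slot / r * B L⌉₊ → X)
        (D : (Slot × Fin (B L) → ZMod 2) → Finset (Fin ⌈Fintype.card Slot / r * B L⌉₊ → Y))
        (dec : (Fin ⌈Fintype.card Slot / r * B L⌉₊ → Y) → Slot × Fin (B L) → ZMod 2),
        (∀ z, ∀ y ∈ D z, dec y = z) ∧ ∀ z, s L ≤ ∑ y ∈ D z, ∏ η, K (enc z η) (y η) := by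
  classical
  rcases isEmpty_or_nonempty Slot with hS | hS
  · refine ⟨fun _ => 1, tendsto_const_nhds, fun L => ⟨fun _ _ => Classical.arbitrary X,
      fun _ => Finset.univ, fun _ => 0, fun z y _ => Subsingleton.elim _ _, fun z => ?_⟩⟩
    rw [← Fintype.prod_sum fun (_ : Fin _) b => K (Classical.arbitrary X) b]
    have : ∑ b, K (Classical.arbitrary X) b = 1 := by
      rw [← tsum_fintype (L := .unconditional _), PMF.tsum_coe]
    simp [this]
  · obtain ⟨hr0, hr1⟩ := hr hS
    obtain ⟨p, hp⟩ := exists_pmf_lt_mutualInfo hr1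
    obtain ⟨err, herr, hcode⟩ := channel_coding K p hp
    have hκ : 0 < (Fintype.card Slot : ℝ) / r := div_pos (by exact_mod_cast Fintype.card_pos) hr0
    have ht : Tendsto (fun L => ⌈(Fintype.card Slot : ℝ) / r * B L⌉₊) atTop atTop :=
      tendsto_nat_ceil_atTop.comp
        ((tendsto_natCast_atTop_atTop.comp hB).const_mul_atTop hκ)
    refine ⟨fun L => ENNReal.ofReal (1 - err ⌈(Fintype.card Slot : ℝ) / r * B L⌉₊), ?_, fun L => ?_⟩
    · have h1 := (herr.comp ht).const_sub 1
      have h2 := (ENNReal.continuous_ofReal.tendsto _).comp h1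
      simpa [Function.comp_def] using h2
    · obtain ⟨enc, D, dec, h1, h2⟩ := hcode ⌈(Fintype.card Slot : ℝ) / r * B L⌉₊
        (Slot × Fin (B L) → ZMod 2) (by
          have e : (Fintype.card (Slot × Fin (B L) → ZMod 2) : ℝ) =
              (2 : ℝ) ^ ((Fintype.card Slot * B L : ℕ) : ℝ) := by
            rw [Real.rpow_natCast]
            simp [ZMod.card]
          rw [e]
          refine Real.rpow_le_rpow_of_exponent_le (by norm_num) ?_
          have := mul_le_mul_of_nonneg_left (Nat.le_ceil ((Fintype.card Slot : ℝ) / r * B L)) hr0.le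
          refine le_trans (le_of_eq ?_) this
          push_cast
          field_simp)
      refine ⟨enc, D, dec, h1, fun z => ENNReal.ofReal_le_of_le_toReal ((h2 z).trans_eq ?_)⟩
      rw [ENNReal.toReal_sum fun y _ =>
        ENNReal.prod_ne_top fun η _ => (K (enc z η)).apply_ne_top _]
      simp only [ENNReal.toReal_prod]

lemma tendsto_div_blocks {l : ℕ} (hl : 0 < l) :
    Tendsto (fun L : ℕ => (L : ℝ) / ((L / l + 1 : ℕ) : ℝ)) atTop (𝓝 l) := by
  have hB : Tendsto (fun L : ℕ => ((L / l + 1 : ℕ) : ℝ)) atTop atTop :=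
    tendsto_natCast_atTop_atTop.comp
      ((tendsto_add_atTop_nat 1).comp (Nat.tendsto_div_const_atTop hl.ne'))
  have h1 : Tendsto (fun L : ℕ => (l : ℝ) - l / ((L / l + 1 : ℕ) : ℝ)) atTop (𝓝 l) := by
    simpa using (tendsto_const_nhds.div_atTop hB).const_sub (l : ℝ)
  refine tendsto_of_tendsto_of_tendsto_of_le_of_le h1 tendsto_const_nhds (fun L => ?_) fun L => ?_
  · have hpos : (0 : ℝ) < ((L / l + 1 : ℕ) : ℝ) := by positivity
    simp only
    rw [sub_le_iff_le_add, ← add_div, le_div_iff₀ hpos]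
    have : l * (L / l) ≤ L := Nat.mul_div_le L l
    have : (l : ℝ) * ((L / l : ℕ) : ℝ) ≤ L := by exact_mod_cast this
    push_cast at *
    linarith
  · have hpos : (0 : ℝ) < ((L / l + 1 : ℕ) : ℝ) := by positivity
    simp only
    rw [div_le_iff₀ hpos]
    exact_mod_cast (Nat.lt_mul_div_succ L hl).le

/-- A slot system whose database `n` sends at the rate `r n`, below its capacity, retrieves messages
at the rate `|Sym| / ∑ n, |Slot n| / r n`. -/
lemma SlotSystem.achievable {N M : ℕ} (Q : SlotSystem N M) {X Y : Fin N → Type*}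
    [∀ n, Fintype (X n)] [∀ n, Nonempty (X n)] [∀ n, Fintype (Y n)] (W : ∀ n, X n → PMF (Y n))
    (hQ : ∃ n, Nonempty (Q.Slot n)) (r : Fin N → ℝ)
    (hr : ∀ n, Nonempty (Q.Slot n) → 0 < r n ∧ ENNReal.ofReal (r n) < channelCapacity (W n)) :
    ∃ τ ∈ stdSimplex ℝ (Fin N), Achievable W M τ
      (ENNReal.ofReal (Fintype.card Q.Sym / ∑ n, Fintype.card (Q.Slot n) / r n)) := by
  set l := Fintype.card Q.Sym
  have hl : 0 < l := Fintype.card_pos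
  set κ : Fin N → ℝ := fun n => Fintype.card (Q.Slot n) / r n with hκ
  have hκ0 : ∀ n, 0 ≤ κ n := by
    intro n
    rcases isEmpty_or_nonempty (Q.Slot n) with h | h
    · simp [hκ]
    · exact div_nonneg (Nat.cast_nonneg _) (hr n h).1.le
  have hκsum : 0 < ∑ n, κ n := by
    obtain ⟨n, hn⟩ := hQ
    exact Finset.sum_pos' (fun n _ => hκ0 n) ⟨n, Finset.mem_univ _,
      div_pos (by exact_mod_cast Fintype.card_pos) (hr n hn).1⟩
  set B : ℕ → ℕ := fun L => L / l + 1 with hBdef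
  have hB : Tendsto B atTop atTop :=
    (tendsto_add_atTop_nat 1).comp (Nat.tendsto_div_const_atTop hl.ne')
  have hBR : Tendsto (fun L => (B L : ℝ)) atTop atTop := tendsto_natCast_atTop_atTop.comp hB
  have hemb : ∀ L, Nonempty (Fin L ↪ Q.Sym × Fin (B L)) := fun L => by
    refine Function.Embedding.nonempty_of_card_le ?_
    rw [Fintype.card_fin, Fintype.card_prod, Fintype.card_fin]
    exact (Nat.lt_mul_div_succ L hl).le
  choose s hs hcodes using fun n => exists_codes (W n) (Q.Slot n) (hr n) B hB
  choose enc D dec hD hsD using hcodes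
  set t : ℕ → Fin N → ℕ := fun L n => ⌈κ n * B L⌉₊ with ht
  have hpos : ∀ L, (0 : ℝ) < B L := fun L => by simp only [hBdef]; positivity
  have htB : ∀ n, Tendsto (fun L => (t L n : ℝ) / B L) atTop (𝓝 (κ n)) := fun n =>
    (tendsto_nat_ceil_mul_div_atTop (hκ0 n)).comp hBR
  have hsumB : Tendsto (fun L => (∑ n, (t L n : ℝ)) / B L) atTop (𝓝 (∑ n, κ n)) := by
    simp only [Finset.sum_div]
    exact tendsto_finsetSum _ fun n _ => htB n
  refine ⟨fun n => κ n / ∑ n, κ n, ⟨fun n => div_nonneg (hκ0 n) hκsum.le, ?_⟩,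
    fun L => Q.scheme (hemb L).some (t L) (fun n => enc n L) (fun n => dec n L),
    fun L => Q.scheme_isPrivate _ _ _ _, fun i => ?_, fun n => ?_, ?_⟩
  · rw [← Finset.sum_div, div_self hκsum.ne']
  · have h1 : Tendsto (fun L => 1 - ∏ n, s n L) atTop (𝓝 0) := by
      have h2 : Tendsto (fun L => ∏ n, s n L) atTop (𝓝 (∏ _n : Fin N, 1)) :=
        ENNReal.tendsto_finsetProd_of_ne_top _ (fun n _ => hs n) fun n _ => ENNReal.one_ne_top
      have h3 := ENNReal.Tendsto.sub (tendsto_const_nhds (x := (1 : ℝ≥0∞))) h2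
        (Or.inl ENNReal.one_ne_top)
      simpa using h3
    refine tendsto_of_tendsto_of_tendsto_of_le_of_le tendsto_const_nhds h1 (fun L => zero_le)
      fun L => ?_
    exact Q.scheme_errorProb_le _ _ _ _ W i (fun n => D n L) (fun n => hD n L) (fun n => s n L)
      fun n => hsD n L
  · refine ((htB n).div hsumB hκsum.ne').congr fun L => ?_
    exact div_div_div_cancel_right₀ (hpos L).ne' _ _
  · have h1 := (ENNReal.continuous_ofReal.tendsto _).comp
      ((tendsto_div_blocks hl).div hsumB hκsum.ne')
    refine h1.congr' ?_
    filter_upwards [hsumB.eventually (lt_mem_nhds hκsum)] with L hL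
    have hT : 0 < ∑ n, (t L n : ℝ) := (div_pos_iff_of_pos_right (hpos L)).1 hL
    simp only [Function.comp_apply, Pi.div_apply]
    change ENNReal.ofReal ((L : ℝ) / (B L : ℝ) / ((∑ n, (t L n : ℝ)) / B L)) = _
    rw [div_div_div_cancel_right₀ (hpos L).ne', ENNReal.ofReal_div_of_pos hT,
      ENNReal.ofReal_natCast, ENNReal.ofReal_sum_of_nonneg fun _ _ => Nat.cast_nonneg _]
    simp only [ENNReal.ofReal_natCast]
    rfl

/-- Letting the rates of the databases tend to their capacities. -/
lemma SlotSystem.le_capacity {N M : ℕ} (Q : SlotSystem N M) {X Y : Fin N → Type*}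
    [∀ n, Fintype (X n)] [∀ n, Nonempty (X n)] [∀ n, Fintype (Y n)] (W : ∀ n, X n → PMF (Y n))
    (hQ : ∃ n, Nonempty (Q.Slot n)) (hW : ∀ n, Nonempty (Q.Slot n) → 0 < channelCapacity (W n)) :
    ENNReal.ofReal (Fintype.card Q.Sym /
      ∑ n, Fintype.card (Q.Slot n) / (channelCapacity (W n)).toReal) ≤ capacity W M := by
  set v := (Fintype.card Q.Sym : ℝ) /
      ∑ n, Fintype.card (Q.Slot n) / (channelCapacity (W n)).toReal
  have h1 : ∀ u : ℝ, u ∈ Set.Ioo 0 1 → ENNReal.ofReal (u * v) ≤ capacity W M := by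
    intro u hu
    have e : u * v = Fintype.card Q.Sym /
        ∑ n, Fintype.card (Q.Slot n) / (u * (channelCapacity (W n)).toReal) := by
      have : ∀ n, (Fintype.card (Q.Slot n) : ℝ) / (u * (channelCapacity (W n)).toReal) =
          u⁻¹ * (Fintype.card (Q.Slot n) / (channelCapacity (W n)).toReal) := fun n => by
        rw [div_mul_eq_div_div, div_right_comm, div_eq_mul_inv _ u, mul_comm]
      simp only [this, ← Finset.mul_sum, v]
      rw [div_mul_eq_div_div, div_inv_eq_mul]
      ring
    rw [e]
    refine le_sSup (Q.achievable W hQ (fun n => u * (channelCapacity (W n)).toReal) fun n hn => ?_)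
    have hc : 0 < (channelCapacity (W n)).toReal :=
      ENNReal.toReal_pos (hW n hn).ne' (channelCapacity_ne_top _)
    refine ⟨mul_pos hu.1 hc, ?_⟩
    rw [ENNReal.ofReal_lt_iff_lt_toReal (mul_pos hu.1 hc).le (channelCapacity_ne_top _)]
    exact mul_lt_of_lt_one_left hc hu.2
  have h2 : Tendsto (fun u : ℝ => ENNReal.ofReal (u * v)) (𝓝[<] 1) (𝓝 (ENNReal.ofReal (1 * v))) :=
    ((ENNReal.continuous_ofReal.comp (continuous_id.mul continuous_const)).tendsto 1).mono_left
      nhdsWithin_le_nhds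
  rw [one_mul] at h2
  refine le_of_tendsto h2 ?_
  filter_upwards [Ioo_mem_nhdsLT (show (0 : ℝ) < 1 by norm_num)] with u hu
  exact h1 u hu

end Achievability

/-! ### Slot systems for two and three messages -/

section Constructions

lemma exists_perm_of_injective {S A : Type*} [Finite A] (u u' : S → Option A)
    (hnone : ∀ σ, u σ = none ↔ u' σ = none)
    (hu : ∀ σ σ' a, u σ = some a → u σ' = some a → σ = σ')
    (hu' : ∀ σ σ' a, u' σ = some a → u' σ' = some a → σ = σ') :
    ∃ g : Equiv.Perm A, ∀ σ, u' σ = (u σ).map g := by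
  classical
  have := Fintype.ofFinite A
  have hsome : ∀ σ : {σ // u σ ≠ none}, ∃ a, u σ = some a := fun σ =>
    Option.ne_none_iff_exists'.1 σ.2
  have hsome' : ∀ σ : {σ // u σ ≠ none}, ∃ a, u' σ = some a := fun σ =>
    Option.ne_none_iff_exists'.1 fun h => σ.2 ((hnone σ).2 h)
  choose f hf using hsome
  choose f' hf' using hsome'
  have hfi : Function.Injective f := fun σ σ' h =>
    Subtype.ext (hu _ _ _ (hf σ) (h ▸ hf σ'))
  have hfi' : Function.Injective f' := fun σ σ' h =>
    Subtype.ext (hu' _ _ _ (hf' σ) (h ▸ hf' σ'))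
  let e : {a // a ∈ Set.range f} ≃ {a // a ∈ Set.range f'} :=
    (Equiv.ofInjective f hfi).symm.trans (Equiv.ofInjective f' hfi')
  refine ⟨e.extendSubtype, fun σ => ?_⟩
  by_cases h : u σ = none
  · rw [h, (hnone σ).1 h]; rfl
  · have h1 : e.extendSubtype (f ⟨σ, h⟩) = f' ⟨σ, h⟩ := by
      rw [e.extendSubtype_apply_of_mem _ (Set.mem_range_self _)]
      have : (Equiv.ofInjective f hfi).symm ⟨f ⟨σ, h⟩, Set.mem_range_self _⟩ = ⟨σ, h⟩ :=
        Equiv.ofInjective_symm_apply hfi _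
      simp only [e, Equiv.trans_apply, this]
      rfl
    rw [hf ⟨σ, h⟩, hf' ⟨σ, h⟩, Option.map_some, h1]

/-- Two messages and `k` databases: the first database sends one symbol of each message, and each of
the others the sum of a fresh symbol of the desired message and the symbol of the other message that
the first database has sent. -/
def twoMessages (N k : ℕ) (hk : 1 ≤ k) (hkN : k ≤ N) : SlotSystem N 2 where
  Slot n := {a : Fin 2 // n.val < k ∧ (n.val ≠ 0 → a = 0)}
  Sym := Fin k
  nonemptySym := ⟨⟨0, hk⟩⟩
  index i n m σ :=
    if n.val = 0 then if m = σ.1 then some ⟨0, hk⟩ else none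
    else if m = i then some ⟨n, σ.2.1⟩ else some ⟨0, hk⟩
  exists_perm i j n m := by
    refine exists_perm_of_injective _ _ (fun σ => ?_) ?_ ?_
    · split_ifs <;> simp
    all_goals
      rintro ⟨a, ha⟩ ⟨b, hb⟩ c h1 h2
      refine Subtype.ext ?_
      by_cases hn : n.val = 0
      · simp only [hn, if_true] at h1 h2
        split_ifs at h1 h2 with h3 h4
        exact h3.symm.trans h4
      · exact (ha.2 hn).trans (hb.2 hn).symm
  decodable i x h := by
    have h0 : ∀ m, x m ⟨0, hk⟩ = 0 := by
      intro m
      have := h ⟨0, hk.trans hkN⟩ ⟨m, hk, fun h => absurd rfl h⟩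
      simp only [if_true] at this
      rw [Finset.sum_eq_single m] at this
      · simpa using this
      · intro m' _ hm'; simp [hm']
      · simp
    funext a
    by_cases ha : a.val = 0
    · rw [show a = ⟨0, hk⟩ from Fin.ext ha]; exact h0 i
    · have := h ⟨a, a.2.trans_le hkN⟩ ⟨0, a.2, fun _ => rfl⟩
      simp only [ha, if_false] at this
      rw [Finset.sum_eq_single i] at this
      · simpa using this
      · intro m' _ hm'; simp [hm', h0]
      · simp

lemma card_slot_twoMessages {N k : ℕ} (hk : 1 ≤ k) (hkN : k ≤ N) (n : Fin N) :
    Fintype.card ((twoMessages N k hk hkN).Slot n) =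
      (if n.val < k then 1 else 0) + if n.val < 1 then 1 else 0 := by
  have e : Fintype.card ((twoMessages N k hk hkN).Slot n) =
      Fintype.card {a : Fin 2 // n.val < k ∧ (n.val ≠ 0 → a = 0)} := Fintype.card_congr (Equiv.refl _)
  rw [e, Fintype.card_subtype]
  by_cases h0 : n.val = 0
  · have : 0 < k := hk
    simp [h0, this]
  · by_cases h1 : n.val < k
    · have : ¬ n.val < 1 := by omega
      simp only [h0, h1, ne_eq, not_false_eq_true, true_and, forall_const, if_true, if_false,
        add_zero, this]
      rfl
    · have : ¬ n.val < 1 := by omega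
      simp [h0, h1]

/-- The column of the symbol of message `m` in a sum of database `n` of the system `threeMessages`. -/
def threeColumn {k : ℕ} (hk : 1 ≤ k) (i : Fin 3) (n : ℕ) (m : Fin 3) {p : Fin k → Prop} :
    {_a : Fin 3 // n < k} ⊕ {j : Fin k // p j} → Option (Fin k)
  | .inl a =>
    if n = 0 then if m = a.1 then some ⟨0, hk⟩ else none
    else if m = a.1 then none
    else if (if m = i then a.1 = i + 1 else a.1 ≠ i) then some ⟨0, hk⟩ else some ⟨n, a.2⟩
  | .inr j => some j.1

lemma threeColumn_eq_none {k : ℕ} (hk : 1 ≤ k) (i j : Fin 3) (n : ℕ) (m : Fin 3) {p : Fin k → Prop}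
    (σ : {_a : Fin 3 // n < k} ⊕ {j : Fin k // p j}) :
    threeColumn hk i n m σ = none ↔ threeColumn hk j n m σ = none := by
  rcases σ with σ | σ
  · simp only [threeColumn]
    by_cases h0 : n = 0 <;> by_cases h1 : m = σ.1 <;> simp only [h0, h1, if_true, if_false] <;>
      (split_ifs; all_goals simp)
  · simp [threeColumn]

lemma threeColumn_injective {k : ℕ} (hk : 1 ≤ k) (i : Fin 3) (n : ℕ) (m : Fin 3) {p : Fin k → Prop}
    (hp : ∀ j, p j → n < k → j.val ≠ 0 ∧ j.val ≠ n)
    (σ σ' : {_a : Fin 3 // n < k} ⊕ {j : Fin k // p j}) (a : Fin k)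
    (h : threeColumn hk i n m σ = some a) (h' : threeColumn hk i n m σ' = some a) : σ = σ' := by
  have hleft : ∀ σ : {_a : Fin 3 // n < k}, ∀ p' : Fin k → Prop,
      threeColumn hk i n m (p := p') (.inl σ) = some a → a.val = 0 ∨ a.val = n := by
    intro σ p' h
    simp only [threeColumn] at h
    split_ifs at h <;> simp only [Option.some.injEq] at h <;> simp [← h]
  have hright : ∀ (j : {j : Fin k // p j}), threeColumn hk i n m (.inr j) = some a → j.1 = a := by
    intro j h
    simpa [threeColumn] using h
  rcases σ with ⟨b, hb⟩ | j <;> rcases σ' with ⟨b', hb'⟩ | j'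
  · congr 2
    simp only [threeColumn] at h h'
    by_cases h0 : n = 0
    · simp only [h0, if_true] at h h'
      split_ifs at h h' with h1 h2
      exact h1.symm.trans h2
    · have hne : (⟨0, hk⟩ : Fin k) ≠ ⟨n, hb⟩ := fun h => h0 (Fin.mk.inj h).symm
      simp only [h0, if_false] at h h'
      have key : ∀ i m b b' : Fin 3, m ≠ b → m ≠ b' →
          ((if m = i then b = i + 1 else b ≠ i) ↔ (if m = i then b' = i + 1 else b' ≠ i)) →
          b = b' := by decide
      by_cases h1 : m = b
      · simp [h1] at h
      by_cases h2 : m = b'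
      · simp [h2] at h'
      rw [if_neg h1] at h
      rw [if_neg h2] at h'
      by_cases h3 : (if m = i then b = i + 1 else b ≠ i) <;>
        by_cases h4 : (if m = i then b' = i + 1 else b' ≠ i)
      · exact key i m b b' h1 h2 (iff_of_true h3 h4)
      · rw [if_pos h3] at h
        rw [if_neg h4] at h'
        exact absurd (Option.some.inj (h.trans h'.symm)) hne
      · rw [if_neg h3] at h
        rw [if_pos h4] at h'
        exact absurd (Option.some.inj (h'.trans h.symm)) hne
      · exact key i m b b' h1 h2 (iff_of_false h3 h4)
  · have h1 := hleft _ _ h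
    have h2 := hright _ h'
    have h3 := hp j'.1 j'.2 hb
    rw [h2] at h3
    exact (h1.elim h3.1 h3.2).elim
  · have h1 := hleft _ _ h'
    have h2 := hright _ h
    have h3 := hp j.1 j.2 hb'
    rw [h2] at h3
    exact (h1.elim h3.1 h3.2).elim
  · congr 1
    exact Subtype.ext ((hright _ h).trans (hright _ h').symm)

/-- Three messages, with the symbols of one message arranged in `k₂` rows and `k₁` columns. The
symbols of the undesired messages come from row `0` and those of the desired message from row `n` for
database `n`. The first database sends the symbol `(0, 0)` of every message. Every further database
`n < k₁` sends, for each message `a`, a sum of symbols of the other two messages; for the desired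
message `a` this is the interference in column `n`, and for the other `a` it is a fresh symbol
protected by a symbol `(0, 0)`. Finally the databases `n < k₂` send sums of three symbols, in all
columns whose interference is known from another database. -/
def threeMessages (N k₁ k₂ : ℕ) (hk : 1 ≤ k₁) (hk₁₂ : k₁ ≤ k₂) (hkN : k₂ ≤ N) : SlotSystem N 3 where
  Slot n := {_a : Fin 3 // n.val < k₁} ⊕
    {j : Fin k₁ // n.val < k₂ ∧ (n.val < k₁ → j.val ≠ 0 ∧ j.val ≠ n.val)}
  Sym := Fin k₂ × Fin k₁
  nonemptySym := ⟨(⟨0, hk.trans hk₁₂⟩, ⟨0, hk⟩)⟩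
  index i n m σ := (threeColumn hk i n m σ).map fun c =>
    (if h : m = i ∧ n.val < k₂ then ⟨n, h.2⟩ else ⟨0, hk.trans hk₁₂⟩, c)
  exists_perm i j n m := by
    refine exists_perm_of_injective _ _ (fun σ => ?_) ?_ ?_
    · rw [Option.map_eq_none_iff, Option.map_eq_none_iff]
      exact threeColumn_eq_none hk i j n m σ
    all_goals
      intro σ σ' a h1 h2
      obtain ⟨c, hc, rfl⟩ := Option.map_eq_some_iff.1 h1
      obtain ⟨c', hc', h3⟩ := Option.map_eq_some_iff.1 h2
      rw [(Prod.mk.inj h3).2] at hc'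
      exact threeColumn_injective hk _ n m (fun j hj => hj.2) σ σ' c hc hc'
  decodable i x h := by
    set z₂ : Fin k₂ := ⟨0, hk.trans hk₁₂⟩
    have h0 : ∀ m, x m (z₂, ⟨0, hk⟩) = 0 := by
      intro m
      have := h ⟨0, (hk.trans hk₁₂).trans hkN⟩ (.inl ⟨m, hk⟩)
      rw [Finset.sum_eq_single m] at this
      · simp only [threeColumn, if_true, Option.map_some, Option.elim_some] at this
        split_ifs at this <;> exact this
      · intro m' _ hm'; simp [threeColumn, hm']
      · simp
    have hint : ∀ c : Fin k₁, ∑ m ∈ Finset.univ.erase i, x m (z₂, c) = 0 := by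
      intro c
      by_cases hc : c.val = 0
      · rw [show c = ⟨0, hk⟩ from Fin.ext hc]
        exact Finset.sum_eq_zero fun m _ => h0 m
      · have := h ⟨c, (c.2.trans_le hk₁₂).trans_le hkN⟩ (.inl ⟨i, c.2⟩)
        rw [← Finset.add_sum_erase _ _ (Finset.mem_univ i)] at this
        simp only [threeColumn, hc, if_false, if_true, Option.map_none, Option.elim_none,
          zero_add] at this
        rw [← this]
        refine Finset.sum_congr rfl fun m hm => ?_
        have hm' := Finset.ne_of_mem_erase hm
        simp [hm', z₂]
    funext ⟨n, c⟩
    by_cases hc : n.val < k₁ → c.val ≠ 0 ∧ c.val ≠ n.val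
    · have := h ⟨n, n.2.trans_le hkN⟩ (.inr ⟨c, n.2, hc⟩)
      rw [← Finset.add_sum_erase _ _ (Finset.mem_univ i)] at this
      have e : ∀ m ∈ Finset.univ.erase i, (Option.map (fun c =>
          ((if h : m = i ∧ n.val < k₂ then ⟨n, h.2⟩ else z₂ : Fin k₂), c))
          (threeColumn hk i n.val m (p := fun j => n.val < k₂ ∧
            (n.val < k₁ → j.val ≠ 0 ∧ j.val ≠ n.val)) (.inr ⟨c, n.2, hc⟩))).elim 0 (x m) =
          x m (z₂, c) := by
        intro m hm
        have hm' := Finset.ne_of_mem_erase hm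
        simp [threeColumn, hm']
      rw [Finset.sum_congr rfl e, hint, add_zero] at this
      simpa [threeColumn] using this
    · push Not at hc
      obtain ⟨hn, hc⟩ := hc
      by_cases hn0 : n.val = 0
      · have hc0 : c.val = 0 := by
          by_contra h; exact h ((hc h).trans hn0)
        rw [show n = z₂ from Fin.ext hn0, show c = ⟨0, hk⟩ from Fin.ext hc0]
        exact h0 i
      -- the sum labelled `a ≠ i` contains a fresh symbol of message `i` and one known symbol
      have hsum : ∀ a : Fin 3, a ≠ i →
          x i (n, if a = i + 1 then ⟨0, hk⟩ else ⟨n.val, hn⟩) = 0 := by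
        intro a ha
        have := h ⟨n, n.2.trans_le hkN⟩ (.inl ⟨a, hn⟩)
        rw [Finset.sum_eq_single i] at this
        · rw [← this]
          by_cases ha' : a = i + 1 <;> simp [threeColumn, hn0, ha.symm, ha']
        · intro m _ hm
          by_cases hma : m = a
          · simp [threeColumn, hn0, hma]
          · simpa [threeColumn, hn0, hma, hm, ha] using h0 m
        · simp
      have hi1 : ∀ i : Fin 3, i + 1 ≠ i ∧ i + 2 ≠ i ∧ i + 2 ≠ i + 1 := by decide
      by_cases hc0 : c.val = 0
      · have := hsum (i + 1) (hi1 i).1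
        rw [if_pos rfl] at this
        rwa [show c = ⟨0, hk⟩ from Fin.ext hc0]
      · have := hsum (i + 2) (hi1 i).2.1
        rw [if_neg (hi1 i).2.2] at this
        rwa [show c = ⟨n.val, hn⟩ from Fin.ext (hc hc0)]

lemma card_slot_threeMessages {N k₁ k₂ : ℕ} (hk : 1 ≤ k₁) (hk₁₂ : k₁ ≤ k₂) (hkN : k₂ ≤ N)
    (n : Fin N) :
    Fintype.card ((threeMessages N k₁ k₂ hk hk₁₂ hkN).Slot n) =
      (if n.val < k₂ then k₁ else 0) + (if n.val < k₁ then 1 else 0) +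
        if n.val < 1 then 1 else 0 := by
  have e : Fintype.card ((threeMessages N k₁ k₂ hk hk₁₂ hkN).Slot n) =
      Fintype.card ({_a : Fin 3 // n.val < k₁} ⊕
        {j : Fin k₁ // n.val < k₂ ∧ (n.val < k₁ → j.val ≠ 0 ∧ j.val ≠ n.val)}) :=
    Fintype.card_congr (Equiv.refl _)
  rw [e, Fintype.card_sum, Fintype.card_subtype, Fintype.card_subtype]
  by_cases h1 : n.val < k₁
  · have h2 : n.val < k₂ := h1.trans_le hk₁₂
    have h3 : (Finset.univ.filter fun j : Fin k₁ =>
        n.val < k₂ ∧ (n.val < k₁ → j.val ≠ 0 ∧ j.val ≠ n.val)) =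
        ({⟨0, hk⟩, ⟨n, h1⟩} : Finset (Fin k₁))ᶜ := by
      ext j
      simp [h1, h2, Fin.ext_iff]
    rw [h3, Finset.card_compl, Fintype.card_fin]
    by_cases h0 : n.val = 0
    · have h4 : 0 < k₁ := hk
      have h5 : 0 < k₂ := hk.trans hk₁₂
      simp [h0, h4, h5]
      omega
    · rw [Finset.card_pair fun h => h0 (Fin.mk.inj h).symm]
      simp [h1, h2, h0]
      omega
  · have h0 : n.val ≠ 0 := by omega
    by_cases h2 : n.val < k₂ <;> simp [h1, h2, h0]

end Constructions

/-! ### The linear program over the traffic vectors -/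

section Optimization

open Finset

variable {c x : ℕ → ℝ} {P : ℕ}

/-- Summation by parts: an affine bound on the partial sums of `x` bounds the sums of `x` against
nonnegative antitone weights. -/
lemma sum_mul_le_of_partial_le {h : ℕ → ℝ} {A B : ℝ} (hP : 1 ≤ P)
    (hanti : ∀ i, i + 1 < P → h (i + 1) ≤ h i) (hnn : ∀ i < P, 0 ≤ h i)
    (hx : ∀ k, 1 ≤ k → k ≤ P → ∑ i ∈ range k, x i ≤ A + k * B) :
    ∑ i ∈ range P, x i * h i ≤ A * h 0 + B * ∑ i ∈ range P, h i := by
  have key : ∀ k, k + 1 ≤ P → (A + (k + 1 : ℕ) * B - ∑ i ∈ range (k + 1), x i) * h k ≤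
      A * h 0 + B * ∑ i ∈ range (k + 1), h i - ∑ i ∈ range (k + 1), x i * h i := by
    intro k
    induction k with
    | zero => intro _; simp; linarith
    | succ k ih =>
      intro hk
      have h1 := ih (by omega)
      have h2 := hanti k (by omega)
      have h3 := hx (k + 1) (by omega) (by omega)
      rw [sum_range_succ x, sum_range_succ h (k + 1), sum_range_succ (fun i => x i * h i) (k + 1)]
      have h4 := mul_le_mul_of_nonneg_left h2 (sub_nonneg.2 h3)
      push_cast at *
      linarith
  obtain ⟨p, rfl⟩ : ∃ p, P = p + 1 := ⟨P - 1, by omega⟩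
  have h1 := key p le_rfl
  have h2 := mul_nonneg (sub_nonneg.2 (hx (p + 1) hP le_rfl)) (hnn p (by omega))
  linarith

/-- Water filling: the level `v = min_k (∑_{i<k} c i + g) / k` has total depth `g`. -/
lemma sum_max_eq {g v : ℝ} (hg : 0 ≤ g) (hmono : ∀ i j, i ≤ j → j < P → c i ≤ c j)
    (hle : ∀ k, 1 ≤ k → k ≤ P → k * v ≤ ∑ i ∈ range k, c i + g)
    {m : ℕ} (hmP : m ≤ P) (hm : m * v = ∑ i ∈ range m, c i + g) :
    ∑ i ∈ range P, max (v - c i) 0 = g := by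
  refine le_antisymm ?_ ?_
  · have key : ∀ k, k ≤ P → ∑ i ∈ range k, max (v - c i) 0 ≤ g := by
      intro k
      induction k with
      | zero => intro _; simpa using hg
      | succ k ih =>
        intro hk
        rcases le_total (v - c k) 0 with h | h
        · rw [sum_range_succ, max_eq_right h, add_zero]
          exact ih (by omega)
        · have e : ∑ i ∈ range (k + 1), max (v - c i) 0 = ∑ i ∈ range (k + 1), (v - c i) := by
            refine sum_congr rfl fun i hi => max_eq_left ?_
            have := hmono i k (Nat.lt_succ_iff.1 (mem_range.1 hi)) (by omega)
            linarith
          rw [e, sum_sub_distrib, sum_const, card_range, nsmul_eq_mul]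
          have := hle (k + 1) (by omega) hk
          linarith
    exact key P le_rfl
  · calc g = ∑ i ∈ range m, (v - c i) := by
          rw [sum_sub_distrib, sum_const, card_range, nsmul_eq_mul]; linarith
      _ ≤ ∑ i ∈ range m, max (v - c i) 0 := sum_le_sum fun i _ => le_max_left _ _
      _ ≤ ∑ i ∈ range P, max (v - c i) 0 :=
          sum_le_sum_of_subset_of_nonneg (range_mono hmP) fun i _ _ => le_max_right _ _

lemma exists_level (hP : 1 ≤ P) (c : ℕ → ℝ) (g : ℝ) : ∃ m v, 1 ≤ m ∧ m ≤ P ∧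
    m * v = ∑ i ∈ range m, c i + g ∧
      ∀ k : ℕ, 1 ≤ k → k ≤ P → k * v ≤ ∑ i ∈ range k, c i + g := by
  obtain ⟨m, hm, hmin⟩ := exists_min_image (Icc 1 P) (fun k : ℕ => (∑ i ∈ range k, c i + g) / k)
    ⟨1, by simp [hP]⟩
  have hm' := mem_Icc.1 hm
  have hpos : ∀ k : ℕ, 1 ≤ k → (0 : ℝ) < k := fun k hk => by exact_mod_cast hk
  refine ⟨m, (∑ i ∈ range m, c i + g) / m, hm'.1, hm'.2, mul_div_cancel₀ _ (hpos m hm'.1).ne',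
    fun k h1 h2 => ?_⟩
  have := hmin k (mem_Icc.2 ⟨h1, h2⟩)
  rw [le_div_iff₀ (hpos k h1)] at this
  linarith

lemma level_ge {v g : ℝ} (hmono : ∀ i j, i ≤ j → j < P → c i ≤ c j) {m : ℕ} (h1 : 1 ≤ m)
    (hmP : m ≤ P) (hg : 0 ≤ g) (hm : m * v = ∑ i ∈ range m, c i + g) : c 0 ≤ v := by
  have h2 : (m : ℝ) * c 0 ≤ ∑ i ∈ range m, c i := by
    rw [← nsmul_eq_mul, ← card_range m, ← sum_const, card_range]
    exact sum_le_sum fun i hi => hmono 0 i (Nat.zero_le i) ((mem_range.1 hi).trans_le hmP)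
  have hpos : (0 : ℝ) < m := by exact_mod_cast h1
  exact le_of_mul_le_mul_left (by linarith) hpos

/-- The dual bound for two messages. -/
lemma lp_two {v R : ℝ} (hP : 1 ≤ P) (hc0 : 0 ≤ c 0) (hmono : ∀ i j, i ≤ j → j < P → c i ≤ c j)
    (hx0 : ∀ i, 0 ≤ x i) {m : ℕ} (hm1 : 1 ≤ m) (hmP : m ≤ P)
    (hm : m * v = ∑ i ∈ range m, c i + c 0)
    (hle : ∀ k : ℕ, 1 ≤ k → k ≤ P → k * v ≤ ∑ i ∈ range k, c i + c 0)
    (hx : ∀ k : ℕ, 1 ≤ k → k ≤ P → (k + 1) * R ≤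
      k * ∑ i ∈ range P, x i + (∑ i ∈ range P, x i - ∑ i ∈ range k, x i)) :
    R * v ≤ ∑ i ∈ range P, x i * c i := by
  set T := ∑ i ∈ range P, x i with hT
  have hv := level_ge hmono hm1 hmP hc0 hm
  have hw := sum_max_eq hc0 hmono hle hmP hm
  have h1 := sum_mul_le_of_partial_le (x := x) (h := fun i => max (v - c i) 0) (A := T - R)
    (B := T - R) hP (fun i hi => max_le_max (by linarith [hmono i (i + 1) (by omega) hi]) le_rfl)
    (fun i _ => le_max_right _ _) fun k h1 h2 => by have := hx k h1 h2; linarith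
  rw [hw] at h1
  simp only [max_eq_left (sub_nonneg.2 hv)] at h1
  have h2 : ∑ i ∈ range P, x i * (v - max (v - c i) 0) ≤ ∑ i ∈ range P, x i * c i :=
    sum_le_sum fun i _ => mul_le_mul_of_nonneg_left
      (by linarith [le_max_left (v - c i) 0]) (hx0 i)
  simp only [mul_sub, sum_sub_distrib, ← sum_mul] at h2
  simp only [mul_sub] at h1
  rw [← hT] at h2
  linarith

lemma max_sub_max_antitone {g v s t : ℝ} (hgv : g ≤ v) (hst : s ≤ t) :
    max (v - t) 0 - max (g - t) 0 ≤ max (v - s) 0 - max (g - s) 0 := by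
  rcases max_cases (v - t) 0 with h1 | h1 <;> rcases max_cases (g - t) 0 with h2 | h2 <;>
    rcases max_cases (v - s) 0 with h3 | h3 <;> rcases max_cases (g - s) 0 with h4 | h4 <;>
    linarith

/-- The dual bound for three messages. The weights `(v - c i)⁺` are split at the inner level `g`, so
that the unknown `α`, the least slack of the inner constraints, cancels. -/
lemma lp_three {g v R : ℝ} (hP : 1 ≤ P) (hc0 : 0 ≤ c 0)
    (hmono : ∀ i j, i ≤ j → j < P → c i ≤ c j) (hx0 : ∀ i, 0 ≤ x i)
    {m₁ m₂ : ℕ} (hm₁ : 1 ≤ m₁) (hm₁P : m₁ ≤ P) (hm₂P : m₂ ≤ P) (hgv : g ≤ v)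
    (hg : m₁ * g = ∑ i ∈ range m₁, c i + c 0)
    (hgle : ∀ k : ℕ, 1 ≤ k → k ≤ P → k * g ≤ ∑ i ∈ range k, c i + c 0)
    (hv : m₂ * v = ∑ i ∈ range m₂, c i + g)
    (hvle : ∀ k : ℕ, 1 ≤ k → k ≤ P → k * v ≤ ∑ i ∈ range k, c i + g)
    (hx : ∀ k₁ k₂ : ℕ, 1 ≤ k₁ → k₁ ≤ P → 1 ≤ k₂ → k₂ ≤ P → (k₂ * k₁ + k₂ + 1) * R ≤
      k₂ * k₁ * ∑ i ∈ range P, x i + k₂ * (∑ i ∈ range P, x i - ∑ i ∈ range k₁, x i) +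
        (∑ i ∈ range P, x i - ∑ i ∈ range k₂, x i)) :
    R * v ≤ ∑ i ∈ range P, x i * c i := by
  set T := ∑ i ∈ range P, x i with hT
  have hcg := level_ge hmono hm₁ hm₁P hc0 hg
  have hwg := sum_max_eq hc0 hmono hgle hm₁P hg
  have hwv := sum_max_eq (hc0.trans hcg) hmono hvle hm₂P hv
  obtain ⟨k₁, hk₁, hmin⟩ := exists_min_image (Icc 1 P)
    (fun k : ℕ => ((k : ℝ) + 1) * (T - R) - ∑ i ∈ range k, x i) ⟨1, by simp [hP]⟩
  have hk₁' := mem_Icc.1 hk₁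
  set α := ((k₁ : ℝ) + 1) * (T - R) - ∑ i ∈ range k₁, x i with hα
  have h1 := sum_mul_le_of_partial_le (x := x) (h := fun i => max (g - c i) 0) (A := T - R - α)
    (B := T - R) hP (fun i hi => max_le_max (by linarith [hmono i (i + 1) (by omega) hi]) le_rfl)
    (fun i _ => le_max_right _ _) fun k h1 h2 => by
      have := hmin k (mem_Icc.2 ⟨h1, h2⟩); linarith
  have h2 := sum_mul_le_of_partial_le (x := x)
    (h := fun i => max (v - c i) 0 - max (g - c i) 0) (A := T - R) (B := α) hP
    (fun i hi => max_sub_max_antitone hgv (hmono i (i + 1) (by omega) hi))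
    (fun i _ => sub_nonneg.2 (max_le_max (by linarith) le_rfl)) fun k h1 h2 => by
      have := hx k₁ k hk₁'.1 hk₁'.2 h1 h2
      rw [hα]
      linarith
  rw [sum_sub_distrib, hwg, hwv] at h2
  rw [hwg] at h1
  simp only [max_eq_left (sub_nonneg.2 hcg), max_eq_left (sub_nonneg.2 (hcg.trans hgv)), mul_sub,
    sum_sub_distrib] at h1 h2
  have h3 : ∑ i ∈ range P, x i * (v - max (v - c i) 0) ≤ ∑ i ∈ range P, x i * c i :=
    sum_le_sum fun i _ => mul_le_mul_of_nonneg_left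
      (by linarith [le_max_left (v - c i) 0]) (hx0 i)
  simp only [mul_sub, sum_sub_distrib, ← sum_mul] at h3
  rw [← hT] at h3
  linarith

/-- The levels for three messages can be attained in increasing order. -/
lemma exists_levels (hP : 1 ≤ P) (hc0 : 0 ≤ c 0) (hmono : ∀ i j, i ≤ j → j < P → c i ≤ c j) :
    ∃ m₁ m₂ g v, 1 ≤ m₁ ∧ m₁ ≤ m₂ ∧ m₂ ≤ P ∧ c 0 ≤ g ∧ g ≤ v ∧
      m₁ * g = ∑ i ∈ range m₁, c i + c 0 ∧
      (∀ k : ℕ, 1 ≤ k → k ≤ P → k * g ≤ ∑ i ∈ range k, c i + c 0) ∧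
      m₂ * v = ∑ i ∈ range m₂, c i + g ∧
      ∀ k : ℕ, 1 ≤ k → k ≤ P → k * v ≤ ∑ i ∈ range k, c i + g := by
  obtain ⟨m, g, hm1, hmP, hg, hgle⟩ := exists_level hP c (c 0)
  obtain ⟨k, v, hk1, hkP, hv, hvle⟩ := exists_level hP c g
  have hcg := level_ge hmono hm1 hmP hc0 hg
  have hm0 : (0 : ℝ) < m := by exact_mod_cast hm1
  have hk0 : (0 : ℝ) < k := by exact_mod_cast hk1
  have hgv : g ≤ v := le_of_mul_le_mul_left (by linarith [hgle k hk1 hkP]) hk0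
  rcases le_total m k with h | h
  · exact ⟨m, k, g, v, hm1, h, hkP, hcg, hgv, hg, hgle, hv, hvle⟩
  · -- beyond the minimiser `m` of the inner level the outer average cannot increase
    refine ⟨m, m, g, v, hm1, le_rfl, hmP, hcg, hgv, hg, hgle, le_antisymm (hvle m hm1 hmP) ?_, hvle⟩
    have hmk : (k : ℝ) ≤ m := by exact_mod_cast h
    have h1 := mul_le_mul_of_nonneg_left (hgle k hk1 hkP) hm0.le
    have h2 := mul_nonneg (sub_nonneg.2 hmk) (sub_nonneg.2 hcg)
    refine le_of_mul_le_mul_left (a := (k : ℝ)) ?_ hk0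
    have e1 : (k : ℝ) * (∑ i ∈ range m, c i + g) = k * (m * g) - k * c 0 + k * g := by rw [hg]; ring
    have e2 : (k : ℝ) * (m * v) = m * (∑ i ∈ range k, c i + g) := by rw [← hv]; ring
    rw [e1, e2]
    linarith

end Optimization

/-! ### Comparison with the closed formulas -/

section Formula

variable {N : ℕ}

/-- The sum of the reciprocal capacities of the first `k` databases. -/
def recipSum (C : Fin N → ℝ≥0∞) (k : ℕ) : ℝ≥0∞ := ∑ n : Fin N with n.val < k, (C n)⁻¹

lemma natCast_mul_recipSum (C : Fin N → ℝ≥0∞) (a k : ℕ) :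
    (a : ℝ≥0∞) * recipSum C k = ∑ n : Fin N, ((if n.val < k then a else 0 : ℕ) : ℝ≥0∞) * (C n)⁻¹ := by
  rw [recipSum, Finset.mul_sum, Finset.sum_filter]
  exact Finset.sum_congr rfl fun n _ => by split_ifs <;> simp

lemma sumInv_natCast (C : Fin N → ℝ≥0∞) (a b c : ℕ) :
    sumInv C a b c = ∑ n : Fin N,
      ((if a < n.val + 1 ∧ n.val + 1 ≤ b then c else 0 : ℕ) : ℝ≥0∞) * (C n)⁻¹ := by
  rw [sumInv, Finset.sum_filter]
  exact Finset.sum_congr rfl fun n _ => by split_ifs <;> simp [div_eq_mul_inv]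

lemma le_denominator_two (C : Fin N → ℝ≥0∞) (n₀ n₁ : ℕ) :
    n₀ * recipSum C n₁ + recipSum C n₀ ≤
      sumInv C 0 n₀ (n₀ + 1) + sumInv C n₀ n₁ n₀ := by
  have h := natCast_mul_recipSum C 1 n₀
  rw [Nat.cast_one, one_mul] at h
  have h1 := sumInv_natCast C 0 n₀ (n₀ + 1)
  rw [Nat.cast_add, Nat.cast_one] at h1
  rw [natCast_mul_recipSum, h, h1, sumInv_natCast, ← Finset.sum_add_distrib,
    ← Finset.sum_add_distrib]
  refine Finset.sum_le_sum fun n _ => ?_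
  rw [← add_mul, ← add_mul, ← Nat.cast_add, ← Nat.cast_add]
  refine mul_le_mul_left (Nat.cast_le.2 ?_) _
  split_ifs <;> omega

lemma denominator_two_eq (C : Fin N → ℝ≥0∞) {n₀ n₁ : ℕ} (h₀₁ : n₀ ≤ n₁) :
    sumInv C 0 n₀ (n₀ + 1) + sumInv C n₀ n₁ n₀ = n₀ * recipSum C n₁ + recipSum C n₀ := by
  have h := natCast_mul_recipSum C 1 n₀
  rw [Nat.cast_one, one_mul] at h
  have h1 := sumInv_natCast C 0 n₀ (n₀ + 1)
  rw [Nat.cast_add, Nat.cast_one] at h1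
  rw [natCast_mul_recipSum, h, h1, sumInv_natCast, ← Finset.sum_add_distrib,
    ← Finset.sum_add_distrib]
  refine Finset.sum_congr rfl fun n _ => ?_
  rw [← add_mul, ← add_mul, ← Nat.cast_add, ← Nat.cast_add]
  congr 2
  split_ifs <;> omega

lemma le_denominator_three (C : Fin N → ℝ≥0∞) (n₀ n₁ n₂ : ℕ) :
    n₀ * n₁ * recipSum C n₂ + n₀ * recipSum C n₁ + recipSum C n₀ ≤
      sumInv C 0 n₀ (n₀ * n₁ + n₀ + 1) + sumInv C n₀ n₁ (n₀ * n₁ + n₀) +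
        sumInv C n₁ n₂ (n₀ * n₁) := by
  have h := natCast_mul_recipSum C 1 n₀
  have h1 := sumInv_natCast C 0 n₀ (n₀ * n₁ + n₀ + 1)
  have h2 := sumInv_natCast C n₀ n₁ (n₀ * n₁ + n₀)
  have h3 := sumInv_natCast C n₁ n₂ (n₀ * n₁)
  have h4 := natCast_mul_recipSum C (n₀ * n₁) n₂
  rw [Nat.cast_one, one_mul] at h
  push_cast only [Nat.cast_add, Nat.cast_mul, Nat.cast_one] at h1 h2 h3 h4
  rw [h4, natCast_mul_recipSum, h, h1, h2, h3]
  simp only [← Finset.sum_add_distrib]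
  refine Finset.sum_le_sum fun n _ => ?_
  simp only [← add_mul]
  refine mul_le_mul_left ?_ _
  split_ifs <;> norm_cast <;> omega

lemma denominator_three_eq (C : Fin N → ℝ≥0∞) {n₀ n₁ n₂ : ℕ} (h₀₁ : n₀ ≤ n₁) (h₁₂ : n₁ ≤ n₂) :
    sumInv C 0 n₀ (n₀ * n₁ + n₀ + 1) + sumInv C n₀ n₁ (n₀ * n₁ + n₀) +
        sumInv C n₁ n₂ (n₀ * n₁) =
      n₀ * n₁ * recipSum C n₂ + n₀ * recipSum C n₁ + recipSum C n₀ := by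
  have h := natCast_mul_recipSum C 1 n₀
  have h1 := sumInv_natCast C 0 n₀ (n₀ * n₁ + n₀ + 1)
  have h2 := sumInv_natCast C n₀ n₁ (n₀ * n₁ + n₀)
  have h3 := sumInv_natCast C n₁ n₂ (n₀ * n₁)
  have h4 := natCast_mul_recipSum C (n₀ * n₁) n₂
  rw [Nat.cast_one, one_mul] at h
  push_cast only [Nat.cast_add, Nat.cast_mul, Nat.cast_one] at h1 h2 h3 h4
  rw [h4, natCast_mul_recipSum, h, h1, h2, h3]
  simp only [← Finset.sum_add_distrib]
  refine Finset.sum_congr rfl fun n _ => ?_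
  simp only [← add_mul]
  congr 1
  split_ifs <;> norm_cast <;> omega

/-- The reciprocal capacities as a sequence of real numbers, with the junk value `0` where the
capacity is `0` and beyond the last database. -/
def recip (C : Fin N → ℝ≥0∞) (i : ℕ) : ℝ := if h : i < N then (C ⟨i, h⟩).toReal⁻¹ else 0

lemma sum_fin_lt {k : ℕ} (hk : k ≤ N) (f : ℕ → ℝ) :
    ∑ n : Fin N with n.val < k, f n = ∑ i ∈ Finset.range k, f i := by
  rw [Finset.sum_filter, Fin.sum_univ_eq_sum_range (fun i => if i < k then f i else 0) N,
    ← Finset.sum_filter]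
  congr 1
  ext i
  simp only [Finset.mem_filter, Finset.mem_range]
  omega

lemma sum_ite_div {k : ℕ} (hk : k ≤ N) (C : Fin N → ℝ≥0∞) (a : ℝ) :
    ∑ n : Fin N, (if n.val < k then a else 0) / (C n).toReal =
      a * ∑ i ∈ Finset.range k, recip C i := by
  rw [← sum_fin_lt hk, Finset.sum_filter, Finset.mul_sum]
  exact Finset.sum_congr rfl fun n _ => by
    split_ifs <;> simp [recip, div_eq_mul_inv]

/-- `P` is the number of databases with positive capacity. -/
lemma exists_positive_count (C : Fin N → ℝ≥0∞) (hmono : Antitone C) :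
    ∃ P ≤ N, ∀ n : Fin N, n.val < P ↔ C n ≠ 0 := by
  classical
  have hex : ∃ p, ∀ n : Fin N, p ≤ n.val → C n = 0 := ⟨N, fun n hn => absurd n.2 (not_lt.2 hn)⟩
  refine ⟨Nat.find hex, Nat.find_min' hex fun n hn => absurd n.2 (not_lt.2 hn), fun n => ?_⟩
  refine ⟨fun h h0 => ?_, fun h => ?_⟩
  · exact Nat.find_min hex h fun j hj => le_antisymm ((hmono hj).trans h0.le) zero_le
  · by_contra hn
    exact h (Nat.find_spec hex n (not_lt.1 hn))

variable {C : Fin N → ℝ≥0∞} {P : ℕ}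

lemma recip_nonneg (i : ℕ) : 0 ≤ recip C i := by
  unfold recip
  split_ifs
  · exact inv_nonneg.2 ENNReal.toReal_nonneg
  · exact le_rfl

lemma recip_mono (hfin : ∀ n, C n ≠ ⊤) (hmono : Antitone C) (hPN : P ≤ N)
    (hP : ∀ n : Fin N, n.val < P ↔ C n ≠ 0) (i j : ℕ) (hij : i ≤ j) (hj : j < P) :
    recip C i ≤ recip C j := by
  have hjN : j < N := hj.trans_le hPN
  rw [recip, recip, dif_pos (hij.trans_lt hjN), dif_pos hjN]
  refine inv_anti₀ (ENNReal.toReal_pos ((hP ⟨j, hjN⟩).1 hj) (hfin _)) ?_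
  exact ENNReal.toReal_mono (hfin _) (hmono (Fin.mk_le_mk.2 hij))

lemma recip_zero_pos (hfin : ∀ n, C n ≠ ⊤) (hPN : P ≤ N)
    (hP : ∀ n : Fin N, n.val < P ↔ C n ≠ 0) (h1 : 1 ≤ P) : 0 < recip C 0 := by
  have h0 : 0 < N := h1.trans hPN
  rw [recip, dif_pos h0]
  exact inv_pos.2 (ENNReal.toReal_pos ((hP ⟨0, h0⟩).1 h1) (hfin _))

lemma recipSum_eq (hfin : ∀ n, C n ≠ ⊤) (hPN : P ≤ N)
    (hP : ∀ n : Fin N, n.val < P ↔ C n ≠ 0) {k : ℕ} (hk : k ≤ P) :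
    recipSum C k = ENNReal.ofReal (∑ i ∈ Finset.range k, recip C i) := by
  rw [← sum_fin_lt (hk.trans hPN), ENNReal.ofReal_sum_of_nonneg fun n _ => recip_nonneg _, recipSum]
  refine Finset.sum_congr rfl fun n hn => ?_
  have h0 := (hP n).1 ((Finset.mem_filter.1 hn).2.trans_le hk)
  rw [recip, dif_pos n.2, ENNReal.ofReal_inv_of_pos (ENNReal.toReal_pos h0 (hfin _)),
    ENNReal.ofReal_toReal (hfin _)]

lemma recipSum_eq_top (hP : ∀ n : Fin N, n.val < P ↔ C n ≠ 0) {k : ℕ} (hk : P < k) (hkN : k ≤ N) :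
    recipSum C k = ⊤ := by
  rw [recipSum, ENNReal.sum_eq_top]
  refine ⟨⟨P, hk.trans_le hkN⟩, by simpa using hk, ?_⟩
  rw [ENNReal.inv_eq_top]
  by_contra h
  exact (lt_irrefl P) ((hP ⟨P, hk.trans_le hkN⟩).2 h)

lemma mul_recip_zero_le (hfin : ∀ n, C n ≠ ⊤) (hmono : Antitone C) (hPN : P ≤ N)
    (hP : ∀ n : Fin N, n.val < P ↔ C n ≠ 0) {k : ℕ} (hk : k ≤ P) :
    k * recip C 0 ≤ ∑ i ∈ Finset.range k, recip C i := by
  rw [← nsmul_eq_mul, ← Finset.card_range k, ← Finset.sum_const, Finset.card_range]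
  exact Finset.sum_le_sum fun i hi =>
    recip_mono hfin hmono hPN hP 0 i (Nat.zero_le i) ((Finset.mem_range.1 hi).trans_le hk)

lemma formula_two_le (hfin : ∀ n, C n ≠ ⊤) (hmono : Antitone C) (hPN : P ≤ N)
    (hP : ∀ n : Fin N, n.val < P ↔ C n ≠ 0) {v : ℝ} (hv : 0 < v)
    (hle : ∀ k : ℕ, 1 ≤ k → k ≤ P → k * v ≤ ∑ i ∈ Finset.range k, recip C i + recip C 0)
    {n₀ n₁ : ℕ} (h₀ : n₀ ∈ Finset.Icc 1 N) (h₁ : n₁ ∈ Finset.Icc 1 N) :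
    ((n₀ * n₁ : ℕ) : ℝ≥0∞) / (sumInv C 0 n₀ (n₀ + 1) + sumInv C n₀ n₁ n₀) ≤
      ENNReal.ofReal v⁻¹ := by
  rw [Finset.mem_Icc] at h₀ h₁
  have hpos : ENNReal.ofReal v⁻¹ ≠ 0 := (ENNReal.ofReal_pos.2 (inv_pos.2 hv)).ne'
  refine ENNReal.div_le_of_le_mul ?_
  refine le_trans ?_ (mul_le_mul_right (le_denominator_two C n₀ n₁) _)
  have hn0 : (n₀ : ℝ≥0∞) ≠ 0 := by exact_mod_cast (show n₀ ≠ 0 by omega)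
  by_cases hP0 : P < n₀
  · rw [recipSum_eq_top hP hP0 h₀.2, add_top, ENNReal.mul_top hpos]
    exact le_top
  by_cases hP1 : P < n₁
  · rw [recipSum_eq_top hP hP1 h₁.2, ENNReal.mul_top hn0, top_add, ENNReal.mul_top hpos]
    exact le_top
  rw [recipSum_eq hfin hPN hP (not_lt.1 hP0), recipSum_eq hfin hPN hP (not_lt.1 hP1),
    ← ENNReal.ofReal_natCast n₀, ← ENNReal.ofReal_mul (Nat.cast_nonneg _),
    ← ENNReal.ofReal_add (mul_nonneg (Nat.cast_nonneg _) (Finset.sum_nonneg fun i _ =>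
      recip_nonneg i)) (Finset.sum_nonneg fun i _ => recip_nonneg i),
    ← ENNReal.ofReal_mul (inv_nonneg.2 hv.le), ← ENNReal.ofReal_natCast]
  refine ENNReal.ofReal_le_ofReal ?_
  rw [le_inv_mul_iff₀ hv]
  have a1 := mul_le_mul_of_nonneg_left (hle n₁ h₁.1 (not_lt.1 hP1)) (Nat.cast_nonneg (α := ℝ) n₀)
  have a2 := mul_recip_zero_le hfin hmono hPN hP (not_lt.1 hP0)
  push_cast
  linarith

lemma formula_three_le (hfin : ∀ n, C n ≠ ⊤) (hmono : Antitone C) (hPN : P ≤ N)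
    (hP : ∀ n : Fin N, n.val < P ↔ C n ≠ 0) {g v : ℝ} (hv : 0 < v)
    (hgle : ∀ k : ℕ, 1 ≤ k → k ≤ P → k * g ≤ ∑ i ∈ Finset.range k, recip C i + recip C 0)
    (hle : ∀ k : ℕ, 1 ≤ k → k ≤ P → k * v ≤ ∑ i ∈ Finset.range k, recip C i + g)
    {n₀ n₁ n₂ : ℕ} (h₀ : n₀ ∈ Finset.Icc 1 N) (h₁ : n₁ ∈ Finset.Icc 1 N)
    (h₂ : n₂ ∈ Finset.Icc 1 N) :
    ((n₀ * n₁ * n₂ : ℕ) : ℝ≥0∞) / (sumInv C 0 n₀ (n₀ * n₁ + n₀ + 1) +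
      sumInv C n₀ n₁ (n₀ * n₁ + n₀) + sumInv C n₁ n₂ (n₀ * n₁)) ≤ ENNReal.ofReal v⁻¹ := by
  rw [Finset.mem_Icc] at h₀ h₁ h₂
  have hpos : ENNReal.ofReal v⁻¹ ≠ 0 := (ENNReal.ofReal_pos.2 (inv_pos.2 hv)).ne'
  refine ENNReal.div_le_of_le_mul ?_
  refine le_trans ?_ (mul_le_mul_right (le_denominator_three C n₀ n₁ n₂) _)
  have hn0 : (n₀ : ℝ≥0∞) ≠ 0 := by exact_mod_cast (show n₀ ≠ 0 by omega)
  have hn1 : (n₁ : ℝ≥0∞) ≠ 0 := by exact_mod_cast (show n₁ ≠ 0 by omega)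
  by_cases hP0 : P < n₀
  · rw [recipSum_eq_top hP hP0 h₀.2, add_top, ENNReal.mul_top hpos]
    exact le_top
  by_cases hP1 : P < n₁
  · rw [recipSum_eq_top hP hP1 h₁.2, ENNReal.mul_top hn0, add_top, top_add, ENNReal.mul_top hpos]
    exact le_top
  by_cases hP2 : P < n₂
  · rw [recipSum_eq_top hP hP2 h₂.2, ENNReal.mul_top (mul_ne_zero hn0 hn1), top_add, top_add,
      ENNReal.mul_top hpos]
    exact le_top
  have hs : ∀ k, 0 ≤ ∑ i ∈ Finset.range k, recip C i := fun k =>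
    Finset.sum_nonneg fun i _ => recip_nonneg i
  have hs0 := hs n₀
  have hs1 := hs n₁
  have hs2 := hs n₂
  rw [recipSum_eq hfin hPN hP (not_lt.1 hP0), recipSum_eq hfin hPN hP (not_lt.1 hP1),
    recipSum_eq hfin hPN hP (not_lt.1 hP2),
    ← ENNReal.ofReal_natCast n₀, ← ENNReal.ofReal_natCast n₁,
    ← ENNReal.ofReal_mul (Nat.cast_nonneg _), ← ENNReal.ofReal_mul (by positivity),
    ← ENNReal.ofReal_mul (by positivity), ← ENNReal.ofReal_add (by positivity) (by positivity),
    ← ENNReal.ofReal_add (by positivity) (by positivity),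
    ← ENNReal.ofReal_mul (inv_nonneg.2 hv.le), ← ENNReal.ofReal_natCast]
  refine ENNReal.ofReal_le_ofReal ?_
  rw [le_inv_mul_iff₀ hv]
  have a0 := mul_recip_zero_le hfin hmono hPN hP (not_lt.1 hP0)
  have a1 := mul_le_mul_of_nonneg_left (hgle n₁ h₁.1 (not_lt.1 hP1)) (Nat.cast_nonneg (α := ℝ) n₀)
  have a2 := mul_le_mul_of_nonneg_left (hle n₂ h₂.1 (not_lt.1 hP2))
    (mul_nonneg (Nat.cast_nonneg (α := ℝ) n₀) (Nat.cast_nonneg (α := ℝ) n₁))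
  push_cast
  linarith

end Formula

/-! ### The capacity of two and three messages -/

section Capacity

variable {N : ℕ} {X Y : Fin N → Type*} [∀ n, Fintype (X n)] [∀ n, Fintype (Y n)]
  {W : ∀ n, X n → PMF (Y n)} {C : Fin N → ℝ≥0∞} {P : ℕ}

/-- The capacity-weighted traffic of database `i`, extended by zero. -/
def traffic (W : ∀ n, X n → PMF (Y n)) (τ : Fin N → ℝ) (i : ℕ) : ℝ :=
  if h : i < N then τ ⟨i, h⟩ * (channelCapacity (W ⟨i, h⟩)).toReal else 0

lemma traffic_nonneg {τ : Fin N → ℝ} (hτ : τ ∈ stdSimplex ℝ (Fin N)) (i : ℕ) :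
    0 ≤ traffic W τ i := by
  unfold traffic
  split_ifs
  · exact mul_nonneg (hτ.1 _) ENNReal.toReal_nonneg
  · exact le_rfl

lemma sum_traffic (hPN : P ≤ N) (hP : ∀ n : Fin N, n.val < P ↔ channelCapacity (W n) ≠ 0)
    (τ : Fin N → ℝ) :
    ∑ n, τ n * (channelCapacity (W n)).toReal = ∑ i ∈ Finset.range P, traffic W τ i := by
  rw [← sum_fin_lt hPN, Finset.sum_filter]
  refine Finset.sum_congr rfl fun n _ => ?_
  by_cases h : n.val < P
  · simp [h, traffic]
  · have : channelCapacity (W n) = 0 := by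
      by_contra h0; exact h ((hP n).2 h0)
    simp [h, this]

lemma sum_traffic_tail (hPN : P ≤ N) (hP : ∀ n : Fin N, n.val < P ↔ channelCapacity (W n) ≠ 0)
    (τ : Fin N → ℝ) {k : ℕ} (hk : k ≤ N) :
    ∑ n with ¬ n.val < k, τ n * (channelCapacity (W n)).toReal =
      ∑ i ∈ Finset.range P, traffic W τ i - ∑ i ∈ Finset.range k, traffic W τ i := by
  rw [← sum_traffic hPN hP, eq_sub_iff_add_eq', ← sum_fin_lt hk,
    ← Finset.sum_filter_add_sum_filter_not Finset.univ (fun n : Fin N => n.val < k)]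
  congr 1
  exact Finset.sum_congr rfl fun n _ => by simp [traffic]

lemma sum_traffic_mul_recip_le (hPN : P ≤ N) {τ : Fin N → ℝ} (hτ : τ ∈ stdSimplex ℝ (Fin N)) :
    ∑ i ∈ Finset.range P, traffic W τ i * recip (fun n => channelCapacity (W n)) i ≤ 1 := by
  rw [← sum_fin_lt hPN, ← hτ.2]
  refine (Finset.sum_le_sum (g := τ) fun n _ => ?_).trans
    (Finset.sum_le_sum_of_subset_of_nonneg (Finset.filter_subset _ _) fun n _ _ => hτ.1 n)
  simp only [traffic, recip, n.2, dif_pos]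
  rw [mul_assoc]
  exact mul_le_of_le_one_right (hτ.1 n) mul_inv_le_one

lemma le_ofReal_inv {R : ℝ≥0∞} {v : ℝ} (hv : 0 < v) (hR : R ≠ ⊤) (h : R.toReal * v ≤ 1) :
    R ≤ ENNReal.ofReal v⁻¹ := by
  rw [← ENNReal.ofReal_toReal hR]
  refine ENNReal.ofReal_le_ofReal ?_
  rw [← one_div, le_div_iff₀ hv]
  exact h

lemma capacity_two_le (hC : ∀ n, C n = channelCapacity (W n)) (hmono : Antitone C) (hPN : P ≤ N)
    (hP : ∀ n : Fin N, n.val < P ↔ C n ≠ 0) (h1 : 1 ≤ P) {v : ℝ} (hv : 0 < v)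
    {m : ℕ} (hm1 : 1 ≤ m) (hmP : m ≤ P)
    (hm : m * v = ∑ i ∈ Finset.range m, recip C i +
      recip C 0)
    (hle : ∀ k : ℕ, 1 ≤ k → k ≤ P →
      k * v ≤ ∑ i ∈ Finset.range k, recip C i +
        recip C 0) :
    capacity W 2 ≤ ENNReal.ofReal v⁻¹ := by
  obtain rfl : C = fun n => channelCapacity (W n) := funext hC
  refine sSup_le ?_
  rintro R ⟨τ, hτ, hR⟩
  refine le_ofReal_inv hv (converse_two W hτ hR (Nat.zero_le N)).1 ?_
  refine (lp_two h1 (recip_nonneg 0) (recip_mono (fun n => channelCapacity_ne_top _) hmono hPN hP)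
    (fun i => traffic_nonneg hτ i) hm1 hmP hm hle fun k hk1 hkP => ?_).trans
    (sum_traffic_mul_recip_le hPN hτ)
  have h2 := (converse_two W hτ hR (hkP.trans hPN)).2
  rwa [sum_traffic hPN hP, sum_traffic_tail hPN hP τ (hkP.trans hPN)] at h2

lemma capacity_three_le (hC : ∀ n, C n = channelCapacity (W n)) (hmono : Antitone C) (hPN : P ≤ N)
    (hP : ∀ n : Fin N, n.val < P ↔ C n ≠ 0) (h1 : 1 ≤ P) {g v : ℝ} (hv : 0 < v)
    {m₁ m₂ : ℕ} (hm₁ : 1 ≤ m₁) (hm₁₂ : m₁ ≤ m₂) (hm₂ : m₂ ≤ P) (hgv : g ≤ v)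
    (hg : m₁ * g = ∑ i ∈ Finset.range m₁, recip C i +
      recip C 0)
    (hgle : ∀ k : ℕ, 1 ≤ k → k ≤ P →
      k * g ≤ ∑ i ∈ Finset.range k, recip C i +
        recip C 0)
    (hm : m₂ * v = ∑ i ∈ Finset.range m₂, recip C i + g)
    (hle : ∀ k : ℕ, 1 ≤ k → k ≤ P →
      k * v ≤ ∑ i ∈ Finset.range k, recip C i + g) :
    capacity W 3 ≤ ENNReal.ofReal v⁻¹ := by
  obtain rfl : C = fun n => channelCapacity (W n) := funext hC
  refine sSup_le ?_
  rintro R ⟨τ, hτ, hR⟩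
  refine le_ofReal_inv hv (converse_three W hτ hR (Nat.zero_le N) (Nat.zero_le N)).1 ?_
  refine (lp_three h1 (recip_nonneg 0)
    (recip_mono (fun n => channelCapacity_ne_top _) hmono hPN hP)
    (fun i => traffic_nonneg hτ i) hm₁ (hm₁₂.trans hm₂) hm₂ hgv hg hgle hm hle
    fun k₁ k₂ _ hk₁ _ hk₂ => ?_).trans (sum_traffic_mul_recip_le hPN hτ)
  have h2 := (converse_three W hτ hR (hk₁.trans hPN) (hk₂.trans hPN)).2
  rwa [sum_traffic hPN hP, sum_traffic_tail hPN hP τ (hk₁.trans hPN),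
    sum_traffic_tail hPN hP τ (hk₂.trans hPN)] at h2

lemma capacity_eq_zero (hN : 1 ≤ N) (h0 : ∀ n, channelCapacity (W n) = 0) :
    capacity W 2 = 0 ∧ capacity W 3 = 0 := by
  refine ⟨le_antisymm (sSup_le ?_) zero_le, le_antisymm (sSup_le ?_) zero_le⟩
  · rintro R ⟨τ, hτ, hR⟩
    have h := converse_two W hτ hR hN
    simp only [h0, ENNReal.toReal_zero, mul_zero, Finset.sum_const_zero, add_zero] at h
    have : R.toReal = 0 := le_antisymm (by push_cast at h; linarith) ENNReal.toReal_nonneg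
    exact ((ENNReal.toReal_eq_zero_iff R).1 this).resolve_right h.1 |>.le
  · rintro R ⟨τ, hτ, hR⟩
    have h := converse_three W hτ hR hN hN
    simp only [h0, ENNReal.toReal_zero, mul_zero, Finset.sum_const_zero, add_zero] at h
    have : R.toReal = 0 := le_antisymm (by push_cast at h; linarith) ENNReal.toReal_nonneg
    exact ((ENNReal.toReal_eq_zero_iff R).1 this).resolve_right h.1 |>.le

variable [∀ n, Nonempty (X n)]

lemma le_capacity_two (hC : ∀ n, C n = channelCapacity (W n)) (hPN : P ≤ N)
    (hP : ∀ n : Fin N, n.val < P ↔ C n ≠ 0)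
    {v : ℝ} {m : ℕ} (hm1 : 1 ≤ m) (hmP : m ≤ P)
    (hm : m * v = ∑ i ∈ Finset.range m, recip C i +
      recip C 0) :
    ENNReal.ofReal v⁻¹ ≤ capacity W 2 := by
  obtain rfl : C = fun n => channelCapacity (W n) := funext hC
  have hmN := hmP.trans hPN
  have hcard := card_slot_twoMessages hm1 hmN
  have h := (twoMessages N m hm1 hmN).le_capacity W
    ⟨⟨0, hm1.trans hmN⟩, Fintype.card_pos_iff.1 (by rw [hcard]; simp)⟩ fun n hn => by
      have h1 := Fintype.card_pos_iff.2 hn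
      rw [hcard] at h1
      refine pos_iff_ne_zero.2 ((hP n).1 ?_)
      split_ifs at h1 <;> omega
  have e1 : Fintype.card (twoMessages N m hm1 hmN).Sym = m := Fintype.card_fin m
  have e2 : ∑ n, (Fintype.card ((twoMessages N m hm1 hmN).Slot n) : ℝ) /
      (channelCapacity (W n)).toReal = m * v := by
    have e3 := sum_ite_div hmN (fun n => channelCapacity (W n)) 1
    have e4 := sum_ite_div (hm1.trans hmN) (fun n => channelCapacity (W n)) 1
    rw [hm, ← one_mul (∑ i ∈ Finset.range m, _), ← e3]
    rw [Finset.sum_range_one, one_mul] at e4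
    rw [← e4, ← Finset.sum_add_distrib]
    refine Finset.sum_congr rfl fun n _ => ?_
    rw [hcard]
    push_cast
    rw [add_div]
  have hm0 : (m : ℝ) ≠ 0 := by exact_mod_cast (show m ≠ 0 by omega)
  rw [e1, e2, div_mul_eq_div_div, div_self hm0, one_div] at h
  exact h

lemma le_capacity_three (hC : ∀ n, C n = channelCapacity (W n)) (hPN : P ≤ N)
    (hP : ∀ n : Fin N, n.val < P ↔ C n ≠ 0)
    {g v : ℝ} {m₁ m₂ : ℕ} (hm₁ : 1 ≤ m₁) (hm₁₂ : m₁ ≤ m₂) (hm₂ : m₂ ≤ P)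
    (hg : m₁ * g = ∑ i ∈ Finset.range m₁, recip C i +
      recip C 0)
    (hm : m₂ * v = ∑ i ∈ Finset.range m₂, recip C i + g) :
    ENNReal.ofReal v⁻¹ ≤ capacity W 3 := by
  obtain rfl : C = fun n => channelCapacity (W n) := funext hC
  have hmN := hm₂.trans hPN
  have hcard := card_slot_threeMessages hm₁ hm₁₂ hmN
  have h := (threeMessages N m₁ m₂ hm₁ hm₁₂ hmN).le_capacity W
    ⟨⟨0, (hm₁.trans hm₁₂).trans hmN⟩, Fintype.card_pos_iff.1 (by rw [hcard]; simp)⟩ fun n hn => by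
      have h1 := Fintype.card_pos_iff.2 hn
      rw [hcard] at h1
      refine pos_iff_ne_zero.2 ((hP n).1 ?_)
      split_ifs at h1 <;> omega
  have e1 : Fintype.card (threeMessages N m₁ m₂ hm₁ hm₁₂ hmN).Sym = m₂ * m₁ := by
    refine (Fintype.card_prod (Fin m₂) (Fin m₁)).trans ?_
    rw [Fintype.card_fin, Fintype.card_fin]
  have e2 : ∑ n, (Fintype.card ((threeMessages N m₁ m₂ hm₁ hm₁₂ hmN).Slot n) : ℝ) /
      (channelCapacity (W n)).toReal = m₂ * m₁ * v := by
    have e3 := sum_ite_div hmN (fun n => channelCapacity (W n)) m₁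
    have e4 := sum_ite_div (hm₁₂.trans hmN) (fun n => channelCapacity (W n)) 1
    have e5 := sum_ite_div ((hm₁.trans hm₁₂).trans hmN) (fun n => channelCapacity (W n)) 1
    rw [Finset.sum_range_one, one_mul] at e5
    rw [one_mul] at e4
    have e6 : (m₂ : ℝ) * m₁ * v = m₁ * ∑ i ∈ Finset.range m₂,
        recip (fun n => channelCapacity (W n)) i + (∑ i ∈ Finset.range m₁,
        recip (fun n => channelCapacity (W n)) i + recip (fun n => channelCapacity (W n)) 0) := by
      rw [← hg, ← mul_add, ← hm]; ring
    rw [e6, ← e3, ← e4, ← e5, ← Finset.sum_add_distrib, ← Finset.sum_add_distrib]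
    refine Finset.sum_congr rfl fun n _ => ?_
    rw [hcard]
    push_cast
    rw [add_div, add_div, add_assoc]
  have hm0 : (m₂ : ℝ) * m₁ ≠ 0 := mul_ne_zero (by exact_mod_cast (show m₂ ≠ 0 by omega))
    (by exact_mod_cast (show m₁ ≠ 0 by omega))
  rw [e1, e2, Nat.cast_mul, div_mul_eq_div_div, div_self hm0, one_div] at h
  exact h

end Capacity

end

end NPIR

theorem corollary1 {N : ℕ} (hN : 1 ≤ N) {X Y : Fin N → Type*}
    [∀ n, Fintype (X n)] [∀ n, Nonempty (X n)] [∀ n, Fintype (Y n)]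
    (W : ∀ n, X n → PMF (Y n)) (C : Fin N → ℝ≥0∞)
    (hC : ∀ n, C n = NPIR.channelCapacity (W n)) (hmono : Antitone C) :
    IsGreatest
      {r : ℝ≥0∞ | ∃ n₀ ∈ Finset.Icc 1 N, ∃ n₁ ∈ Finset.Icc 1 N,
        r = ((n₀ * n₁ : ℕ) : ℝ≥0∞) /
          (NPIR.sumInv C 0 n₀ (n₀ + 1) + NPIR.sumInv C n₀ n₁ n₀)}
      (NPIR.capacity W 2) ∧
    IsGreatest
      {r : ℝ≥0∞ | ∃ n₀ ∈ Finset.Icc 1 N, ∃ n₁ ∈ Finset.Icc 1 N, ∃ n₂ ∈ Finset.Icc 1 N,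
        r = ((n₀ * n₁ * n₂ : ℕ) : ℝ≥0∞) /
          (NPIR.sumInv C 0 n₀ (n₀ * n₁ + n₀ + 1) + NPIR.sumInv C n₀ n₁ (n₀ * n₁ + n₀) +
            NPIR.sumInv C n₁ n₂ (n₀ * n₁))}
      (NPIR.capacity W 3) := by
  have hfin : ∀ n, C n ≠ ⊤ := fun n => hC n ▸ NPIR.channelCapacity_ne_top (W n)
  obtain ⟨P, hPN, hP⟩ := NPIR.exists_positive_count _ hmono
  rcases Nat.eq_zero_or_pos P with rfl | hP1
  · -- all channels are useless, and both sides vanish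
    have h0 : ∀ n, NPIR.channelCapacity (W n) = 0 := fun n => by
      rw [← hC]; by_contra h; exact absurd ((hP n).2 h) (Nat.not_lt_zero _)
    obtain ⟨h2, h3⟩ := NPIR.capacity_eq_zero hN h0
    have f2 : ∀ n₀ ∈ Finset.Icc 1 N, ∀ n₁, ((n₀ * n₁ : ℕ) : ℝ≥0∞) /
        (NPIR.sumInv C 0 n₀ (n₀ + 1) + NPIR.sumInv C n₀ n₁ n₀) = 0 := fun n₀ h₀ n₁ => by
      rw [Finset.mem_Icc] at h₀
      have h := NPIR.le_denominator_two C n₀ n₁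
      rw [NPIR.recipSum_eq_top hP h₀.1 h₀.2, add_top, top_le_iff] at h
      rw [h, ENNReal.div_top]
    have f3 : ∀ n₀ ∈ Finset.Icc 1 N, ∀ n₁ n₂, ((n₀ * n₁ * n₂ : ℕ) : ℝ≥0∞) /
        (NPIR.sumInv C 0 n₀ (n₀ * n₁ + n₀ + 1) + NPIR.sumInv C n₀ n₁ (n₀ * n₁ + n₀) +
            NPIR.sumInv C n₁ n₂ (n₀ * n₁)) = 0 := fun n₀ h₀ n₁ n₂ => by
      rw [Finset.mem_Icc] at h₀
      have h := NPIR.le_denominator_three C n₀ n₁ n₂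
      rw [NPIR.recipSum_eq_top hP h₀.1 h₀.2, add_top, top_le_iff] at h
      rw [h, ENNReal.div_top]
    have h1 : 1 ∈ Finset.Icc 1 N := Finset.mem_Icc.2 ⟨le_rfl, hN⟩
    refine ⟨⟨⟨1, h1, 1, h1, ?_⟩, ?_⟩, ⟨⟨1, h1, 1, h1, 1, h1, ?_⟩, ?_⟩⟩
    · rw [h2, f2 1 h1]
    · rintro r ⟨n₀, h₀, n₁, -, rfl⟩
      exact (f2 n₀ h₀ n₁).trans_le zero_le
    · rw [h3, f3 1 h1]
    · rintro r ⟨n₀, h₀, n₁, -, n₂, -, rfl⟩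
      exact (f3 n₀ h₀ n₁ n₂).trans_le zero_le
  have hc0 := NPIR.recip_zero_pos hfin hPN hP hP1
  have hcm := NPIR.recip_mono hfin hmono hPN hP
  have hIcc : ∀ {m}, 1 ≤ m → m ≤ P → m ∈ Finset.Icc 1 N := fun h1 h2 =>
    Finset.mem_Icc.2 ⟨h1, h2.trans hPN⟩
  have hs1 : NPIR.recipSum C 1 = ENNReal.ofReal (NPIR.recip C 0) := by
    rw [NPIR.recipSum_eq hfin hPN hP hP1, Finset.sum_range_one]
  have hs : ∀ k, 0 ≤ ∑ i ∈ Finset.range k, NPIR.recip C i := fun k =>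
    Finset.sum_nonneg fun i _ => NPIR.recip_nonneg i
  have hquot : ∀ {a v : ℝ}, 0 < a → 0 < v →
      ENNReal.ofReal a / ENNReal.ofReal (a * v) = ENNReal.ofReal v⁻¹ := fun {a v} ha hv => by
    rw [← ENNReal.ofReal_div_of_pos (mul_pos ha hv), div_mul_eq_div_div, div_self ha.ne', one_div]
  constructor
  · obtain ⟨m, v, hm1, hmP, hm, hle⟩ := NPIR.exists_level hP1 (NPIR.recip C) (NPIR.recip C 0)
    have hv : 0 < v := hc0.trans_le (NPIR.level_ge hcm hm1 hmP hc0.le hm)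
    have hcap : NPIR.capacity W 2 = ENNReal.ofReal v⁻¹ :=
      le_antisymm (NPIR.capacity_two_le hC hmono hPN hP hP1 hv hm1 hmP hm hle)
        (NPIR.le_capacity_two hC hPN hP hm1 hmP hm)
    rw [hcap]
    refine ⟨⟨1, hIcc le_rfl hP1, m, hIcc hm1 hmP, ?_⟩, ?_⟩
    · have hm0 : (0 : ℝ) < m := by exact_mod_cast hm1
      rw [NPIR.denominator_two_eq C hm1, hs1, NPIR.recipSum_eq hfin hPN hP hmP, Nat.cast_one,
        one_mul, one_mul, ← ENNReal.ofReal_add (hs m) hc0.le, ← hm, ← ENNReal.ofReal_natCast m,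
        hquot hm0 hv]
    · rintro r ⟨n₀, h₀, n₁, h₁, rfl⟩
      exact NPIR.formula_two_le hfin hmono hPN hP hv hle h₀ h₁
  · obtain ⟨m₁, m₂, g, v, hm₁, hm₁₂, hm₂, hcg, hgv, hg, hgle, hv', hvle⟩ :=
      NPIR.exists_levels hP1 hc0.le hcm
    have hv : 0 < v := hc0.trans_le (hcg.trans hgv)
    have hcap : NPIR.capacity W 3 = ENNReal.ofReal v⁻¹ :=
      le_antisymm
        (NPIR.capacity_three_le hC hmono hPN hP hP1 hv hm₁ hm₁₂ hm₂ hgv hg hgle hv' hvle)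
        (NPIR.le_capacity_three hC hPN hP hm₁ hm₁₂ hm₂ hg hv')
    rw [hcap]
    refine ⟨⟨1, hIcc le_rfl hP1, m₁, hIcc hm₁ (hm₁₂.trans hm₂), m₂,
      hIcc (hm₁.trans hm₁₂) hm₂, ?_⟩, ?_⟩
    · have hm0 : (0 : ℝ) < m₁ * m₂ := by
        exact_mod_cast Nat.mul_pos hm₁ (hm₁.trans hm₁₂)
      have hsm₁ := hs m₁
      have hsm₂ := hs m₂
      rw [NPIR.denominator_three_eq C hm₁ hm₁₂, hs1, NPIR.recipSum_eq hfin hPN hP hm₂,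
        NPIR.recipSum_eq hfin hPN hP (hm₁₂.trans hm₂), Nat.cast_one, one_mul, one_mul, one_mul,
        ← ENNReal.ofReal_natCast m₁, ← ENNReal.ofReal_mul (Nat.cast_nonneg _),
        ← ENNReal.ofReal_add (by positivity) (by positivity),
        ← ENNReal.ofReal_add (by positivity) hc0.le, add_assoc, ← hg, ← mul_add, ← hv',
        ← mul_assoc, ← ENNReal.ofReal_natCast, Nat.cast_mul, hquot hm0 hv]
    · rintro r ⟨n₀, h₀, n₁, h₁, n₂, h₂, rfl⟩
      exact NPIR.formula_three_le hfin hmono hPN hP hv hgle hvle h₀ h₁ h₂
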